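/- **Theorem (Approximate Poincaré Lemma in Gevrey classes).** Let $s>1$, let $\Omega\subset\mathbb R^m\times\mathbb R^n$ be an open neighbourhood of the origin, with coordinates $(x,t)$, and let $\phi=(\phi_1,\dots,\phi_m):\Omega\to\mathbb R^m$ be of Gevrey class $G^s$ with $\phi(0,0)=0$ and $\mathrm d_x\phi(0,0)=0$. Put $Z_k(x,t)=x_k+i\phi_k(x,t)$, and assume that $\mathrm dZ_1,\dots,\mathrm dZ_m,\mathrm dt_1,\dots,\mathrm dt_n$ is a frame of $\mathbb CT^*\Omega$, i.e. $\det Z_x\neq0$ on $\Omega$. Let $\mathrm L_1,\dots,\mathrm L_n$ be the complex vector fields on $\Omega$ determined by $\mathrm L_jZ_k=0$, $\mathrm L_jt_i=\delta_{ij}$. A $(p,q)$-form is $f=\sum_{|I|=p}\sum_{|J|=q}f_{IJ}\,\mathrm dZ_I\wedge \mathrm dt_J$ (with $I,J$ strictly increasing multi-indices); membership and convergence in $G^s(U,\Lambda^{p,q})$ mean membership and convergence in $G^s(U)$ of the coefficients. (A family $g_\tau$ of elements of $G^s(U)$ converges to $g\in G^s(U)$ if for every compact $K\subset U$ there is $h>0$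 with $\sup_\alpha h^{-|\alpha|}\alpha!^{-s}\sup_K|\partial^\alpha g_\tau-\partial^\alpha g|\to0$.) Set $$\mathbb Lf=\sum_{|I|=p}\sum_{|J|=q}\sum_{j=1}^n \mathrm L_jf_{IJ}\,\mathrm dt_j\wedge \mathrm dZ_I\wedge \mathrm dt_J .$$ Write $B_\rho$ for the open ball of radius $\rho$ about the origin (in $\mathbb R^m$ or $\mathbb R^n$). Call $(R,W)$ admissible if $R>0$, $W$ is open, $\overline V\subset W$ for $V=B_R\times B_R$, $\overline W$ is a compact subset of $\Omega$, and $|\phi(x,t)-\phi(y,t)|\le\frac12|x-y|$ whenever $(x,t),(y,t)\in\overline V$. For $\chi\in G^s_c(B_R)$, $\tau>0$ and a $(p,q)$-form $f$ with $q\ge1$ put $$\mathcal G_\tau^\chi[g](z,t)=\Big(\frac\tau\pi\Big)^{m/2}\int_{\mathbb R^m}e^{-\tau\langle z-Z(x',t)\rangle^2}\chi(x')g(x',t)\det Z_x(x',t)\,\mathrm dx',\qquad \langle\zeta\rangle^2=\sum_k\zeta_k^2,$$ $$\mathcal K_\tau^{(p,q)}[f,\chi](z,t)=(-1)^p\sum_{|I|=p}\sum_{|J|=q}\Big\{\int_0^1\mathcal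 G_\tau^\chi[f_{IJ}](z,\sigma t)\,\sigma^{q-1}\,\mathrm d\sigma\Big\}\,\mathrm dz_I\wedge\omega_J,\qquad \omega_J=\sum_{j\in J}\epsilon(j,J\setminus\{j\})\,t_j\,\mathrm dt_{J\setminus\{j\}},$$ where $\epsilon(j,J')=\pm1$ is the sign with $\mathrm dt_j\wedge \mathrm dt_{J'}=\epsilon(j,J')\,\mathrm dt_{J'\cup\{j\}}$, and let $\lambda(x,t)=(Z(x,t),t)$. Let $0\le p\le m$ and $1\le q\le n$. Then admissible pairs $(R,W)$ exist, and for every admissible $(R,W)$ there is $T$ with $0<T<R$ such that, with $U=B_{R/4}\times B_T$, the following holds: for every $(p,q)$-form $f$ with coefficients in $G^s(\overline W)$ that satisfies $\mathbb Lf=0$ in $W$, and every $\chi\in G^s_c(B_R)$ equal to $1$ on $B_{R/2}$, the forms $\lambda^*\mathcal K_\tau^{(p,q)}[f,\chi]$ $(\tau>0)$ belong to $G^s(U,\Lambda^{p,q-1})$ and $$f=\lim_{\tau\to\infty}\mathbb L\big(\lambda^*\mathcal K_\tau^{(p,q)}[f,\chi]\big)\qquad\text{in }G^s(U,\Lambda^{p,q}).$$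 -/

import Mathlib

open scoped ContDiff
open Set Filter MeasureTheory

noncomputable section

namespace GevreyPoincare

/-! ### Gevrey functions -/

section Gevrey

variable {E F : Type*} [NormedAddCommGroup E] [NormedSpace ℝ E]
  [NormedAddCommGroup F] [NormedSpace ℝ F]

/-- `f ∈ G^s(Ω)` for an open set `Ω`: `f` is smooth on `Ω` and on every compact `K ⊆ Ω` all
derivatives of order `k` are bounded by `C h ^ k (k!) ^ s` for some `h > 0` and `C`.
In finite dimension, bounding the operator norm of the `k`-th total derivative by a multiple of
`h ^ k (k!) ^ s` is the same, up to the value of `h`, as bounding every `∂^α`, `|α| = k`, by a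
multiple of `h ^ |α| (α!) ^ s`. -/
def IsGevreyOn (s : ℝ) (f : E → F) (Ω : Set E) : Prop :=
  ContDiffOn ℝ ∞ f Ω ∧
    ∀ K : Set E, K ⊆ Ω → IsCompact K →
      ∃ h : ℝ, 0 < h ∧ ∃ C : ℝ, ∀ k : ℕ, ∀ x ∈ K,
        ‖iteratedFDeriv ℝ k f x‖ ≤ C * h ^ k * (k.factorial : ℝ) ^ s

/-- `f ∈ G^s(closure W)` for a relatively compact open set `W`: `f` is smooth on `W` and the Gevrey
bounds hold with the same `h` and `C` on all of `W` (equivalently, by continuity of the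
derivatives, on the closure of `W`, where they are defined). -/
def IsGevreyUpToClosure (s : ℝ) (f : E → F) (W : Set E) : Prop :=
  ContDiffOn ℝ ∞ f W ∧
    ∃ h : ℝ, 0 < h ∧ ∃ C : ℝ, ∀ k : ℕ, ∀ x ∈ W,
      ‖iteratedFDeriv ℝ k f x‖ ≤ C * h ^ k * (k.factorial : ℝ) ^ s

/-- Convergence `g τ → f` in `G^s(U)`, `U` open, as `τ → ∞`: the functions `g τ`, `τ > 0`, and `f`
belong to `G^s(U)`, and for every compact `K ⊆ U` there is one `h > 0` such that the `h`-Gevrey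
norm on `K` of `g τ - f` tends to `0`. -/
def GevreyTendsto (s : ℝ) (g : ℝ → E → F) (f : E → F) (U : Set E) : Prop :=
  (∀ τ : ℝ, 0 < τ → IsGevreyOn s (g τ) U) ∧ IsGevreyOn s f U ∧
    ∀ K : Set E, K ⊆ U → IsCompact K →
      ∃ h : ℝ, 0 < h ∧ ∀ ε : ℝ, 0 < ε → ∀ᶠ τ : ℝ in atTop, ∀ k : ℕ, ∀ x ∈ K,
        ‖iteratedFDeriv ℝ k (g τ) x - iteratedFDeriv ℝ k f x‖ ≤ ε * h ^ k * (k.factorial : ℝ) ^ s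

end Gevrey

/-! ### The structure defined by `Z = x + i φ(x, t)` and its vector fields `L_j` -/

/-- The space `ℝ^m × ℝ^n` of points `(x, t)`. -/
abbrev Pt (m n : ℕ) : Type := EuclideanSpace ℝ (Fin m) × EuclideanSpace ℝ (Fin n)

variable {m n : ℕ}

/-- The coordinate vector `∂/∂x_k`. -/
def ex (k : Fin m) : Pt m n := (EuclideanSpace.single k (1 : ℝ), 0)

/-- The coordinate vector `∂/∂t_j`. -/
def et (j : Fin n) : Pt m n := (0, EuclideanSpace.single j (1 : ℝ))

/-- `Z_k(x, t) = x_k + i φ_k(x, t)`. -/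
def Z (φ : Pt m n → EuclideanSpace ℝ (Fin m)) (w : Pt m n) : Fin m → ℂ :=
  fun k => (w.1 k : ℂ) + Complex.I * (φ w k : ℂ)

/-- The Jacobian matrix `Z_x = (∂Z_k/∂x_l)`. -/
def Zx (φ : Pt m n → EuclideanSpace ℝ (Fin m)) (w : Pt m n) : Matrix (Fin m) (Fin m) ℂ :=
  Matrix.of fun k l => fderiv ℝ (fun w' => Z φ w' k) w (ex l)

/-- The Jacobian matrix `Z_t = (∂Z_k/∂t_j)`. -/
def Zt (φ : Pt m n → EuclideanSpace ℝ (Fin m)) (w : Pt m n) : Matrix (Fin m) (Fin n) ℂ :=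
  Matrix.of fun k j => fderiv ℝ (fun w' => Z φ w' k) w (et j)

/-- The complex vector field
`L_j = ∂/∂t_j - ∑_k (Z_x⁻¹ Z_t)_{kj} ∂/∂x_k`, applied to the function `g`. Where `Z_x` is invertible
it is the vector field with `L_j Z_k = 0` and `L_j t_i = δ_{ij}`, see `Lv_Z` and `Lv_t`. -/
def Lv (φ : Pt m n → EuclideanSpace ℝ (Fin m)) (j : Fin n) (g : Pt m n → ℂ) (w : Pt m n) : ℂ :=
  fderiv ℝ g w (et j) - ∑ k : Fin m, ((Zx φ w)⁻¹ * Zt φ w) k j * fderiv ℝ g w (ex k)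

theorem Lv_Z (φ : Pt m n → EuclideanSpace ℝ (Fin m)) (w : Pt m n) (hw : (Zx φ w).det ≠ 0)
    (j : Fin n) (k : Fin m) : Lv φ j (fun w' => Z φ w' k) w = 0 := by
  have h : Zx φ w * ((Zx φ w)⁻¹ * Zt φ w) = Zt φ w := by
    rw [← Matrix.mul_assoc, Matrix.mul_nonsing_inv _ (isUnit_iff_ne_zero.mpr hw), Matrix.one_mul]
  have h2 := congrFun (congrFun h k) j
  rw [Matrix.mul_apply] at h2
  have h3 : Lv φ j (fun w' => Z φ w' k) w
      = Zt φ w k j - ∑ l, ((Zx φ w)⁻¹ * Zt φ w) l j * Zx φ w k l := rfl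
  rw [h3, ← h2, sub_eq_zero]
  exact Finset.sum_congr rfl fun l _ => mul_comm _ _

theorem Lv_t (φ : Pt m n → EuclideanSpace ℝ (Fin m)) (w : Pt m n) (i j : Fin n) :
    Lv φ j (fun w' => (w'.2 i : ℂ)) w = if i = j then 1 else 0 := by
  let A : Pt m n →L[ℝ] ℂ := Complex.ofRealCLM.comp
    ((EuclideanSpace.proj (𝕜 := ℝ) i).comp (ContinuousLinearMap.snd ℝ _ _))
  have h : fderiv ℝ (fun w' : Pt m n => (w'.2 i : ℂ)) w = A := A.fderiv
  simp only [Lv, h]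
  by_cases hij : i = j <;> simp [A, ex, et, hij]

/-! ### `(p,q)`-forms, given by their coefficients in the frame `dZ_I ∧ dt_J` -/

/-- Strictly increasing multi-indices of length `k` in `{1, …, r}`. -/
abbrev MIdx (k r : ℕ) : Type := {I : Finset (Fin r) // I.card = k}

/-- A `(p,q)`-form `f = ∑_{|I|=p} ∑_{|J|=q} f_{IJ} dZ_I ∧ dt_J`, as the family `f_{IJ}`. -/
abbrev Form (m n p q : ℕ) : Type := MIdx p m → MIdx q n → Pt m n → ℂ

/-- `J \ {j}`. -/
def MIdx.del {q r : ℕ} (J : MIdx (q + 1) r) (j : Fin r) (hj : j ∈ J.1) : MIdx q r :=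
  ⟨J.1.erase j, by rw [Finset.card_erase_of_mem hj, J.2, Nat.add_sub_cancel]⟩

/-- `J ∪ {j}`. -/
def MIdx.ins {q r : ℕ} (J : MIdx q r) (j : Fin r) (hj : j ∉ J.1) : MIdx (q + 1) r :=
  ⟨insert j J.1, by rw [Finset.card_insert_of_notMem hj, J.2]⟩

/-- For `j ∉ J`, the sign `ε(j, J)` with `dt_j ∧ dt_J = ε(j, J) dt_{J ∪ {j}}`. -/
def eps {r : ℕ} (j : Fin r) (J : Finset (Fin r)) : ℂ := (-1) ^ (J.filter (· < j)).card

/-- The wedge product `θ_{i_1} ∧ ⋯ ∧ θ_{i_k}`, `I = {i_1 < ⋯ < i_k}`, of covectors `θ_1, …, θ_r` in a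
complex vector space `M` such as the complexified cotangent space at a point. It is used to
check the signs in the coefficient formulas below. -/
def wedge {M : Type*} [AddCommGroup M] [Module ℂ M] {r : ℕ} (θ : Fin r → M)
    (I : Finset (Fin r)) : ExteriorAlgebra ℂ M :=
  ((I.sort (· ≤ ·)).map fun i => ExteriorAlgebra.ι ℂ (θ i)).prod

theorem ι_mul_prod_sorted {M : Type*} [AddCommGroup M] [Module ℂ M] {r : ℕ} (θ : Fin r → M)
    (j : Fin r) (l : List (Fin r)) (hl : l.Pairwise (· ≤ ·)) (hj : j ∉ l) :
    ExteriorAlgebra.ι ℂ (θ j) * (l.map fun i => ExteriorAlgebra.ι ℂ (θ i)).prod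
      = ((-1 : ℂ) ^ (l.filter (· < j)).length) •
        ((l.orderedInsert (· ≤ ·) j).map fun i => ExteriorAlgebra.ι ℂ (θ i)).prod := by
  induction l with
  | nil => simp
  | cons a l ih =>
    have hl' := List.pairwise_cons.mp hl
    have hja : j ≠ a := fun h => hj (by simp [h])
    have hjl : j ∉ l := fun h => hj (by simp [h])
    by_cases h : j ≤ a
    · have h1 : (a :: l).filter (· < j) = [] := by
        rw [List.filter_eq_nil_iff]
        intro b hb
        rcases List.mem_cons.mp hb with rfl | hb
        · simpa using h
        · simpa using h.trans (hl'.1 b hb)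
      rw [h1, List.orderedInsert_cons_of_le _ _ h]
      simp
    · have h1 : (a :: l).filter (· < j) = a :: l.filter (· < j) := by
        rw [List.filter_cons_of_pos]
        simpa using h
      have h2 := eq_neg_of_add_eq_zero_left (ExteriorAlgebra.ι_add_mul_swap (R := ℂ) (θ j) (θ a))
      rw [h1, List.orderedInsert_of_not_le _ _ h]
      simp only [List.map_cons, List.prod_cons, List.length_cons]
      rw [← mul_assoc, h2, neg_mul, mul_assoc, ih hl'.2 hjl, mul_smul_comm, pow_succ]
      simp

theorem ι_mul_wedge {M : Type*} [AddCommGroup M] [Module ℂ M] {r : ℕ} (θ : Fin r → M)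
    (j : Fin r) (J : Finset (Fin r)) (hj : j ∉ J) :
    ExteriorAlgebra.ι ℂ (θ j) * wedge θ J = eps j J • wedge θ (insert j J) := by
  have h1 := ι_mul_prod_sorted θ j (J.sort (· ≤ ·)) (J.pairwise_sort _) (by simpa using hj)
  have h2 : (J.sort (· ≤ ·)).orderedInsert (· ≤ ·) j = (insert j J).sort (· ≤ ·) := by
    apply List.Perm.eq_of_pairwise' (r := (· ≤ ·))
    · exact (J.pairwise_sort _).orderedInsert _ _
    · exact Finset.pairwise_sort _ _
    · rw [List.perm_ext_iff_of_nodup]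
      · intro a; simp
      · rw [(List.perm_orderedInsert _ _ _).nodup_iff]
        simpa using hj
      · exact Finset.sort_nodup _ _
  have h3 : ((J.sort (· ≤ ·)).filter (· < j)).length = (J.filter (· < j)).card := by
    rw [← List.toFinset_card_of_nodup ((J.sort_nodup _).filter _)]
    congr 1
    ext a; simp
  rw [h2, h3] at h1
  exact h1

theorem ι_mul_wedge_self {M : Type*} [AddCommGroup M] [Module ℂ M] {r : ℕ} (θ : Fin r → M)
    (j : Fin r) (J : Finset (Fin r)) (hj : j ∈ J) :
    ExteriorAlgebra.ι ℂ (θ j) * wedge θ J = 0 := by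
  have h := ι_mul_wedge θ j (J.erase j) (Finset.notMem_erase j J)
  rw [Finset.insert_erase hj] at h
  have h2 : wedge θ J = eps j (J.erase j) • (ExteriorAlgebra.ι ℂ (θ j) * wedge θ (J.erase j)) := by
    rw [h, smul_smul, eps, ← mul_pow]
    simp
  rw [h2, mul_smul_comm, ← mul_assoc, ExteriorAlgebra.ι_sq_zero]
  simp

theorem ι_mul_wedge_comm {M : Type*} [AddCommGroup M] [Module ℂ M] {r : ℕ} (v : M)
    (θ : Fin r → M) (I : Finset (Fin r)) :
    ExteriorAlgebra.ι ℂ v * wedge θ I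
      = ((-1 : ℂ) ^ I.card) • (wedge θ I * ExteriorAlgebra.ι ℂ v) := by
  rw [← Finset.length_sort (s := I) (· ≤ ·), wedge]
  induction I.sort (· ≤ ·) with
  | nil => simp
  | cons a l ih =>
    have h2 := eq_neg_of_add_eq_zero_left (ExteriorAlgebra.ι_add_mul_swap (R := ℂ) v (θ a))
    simp only [List.map_cons, List.prod_cons, List.length_cons]
    rw [← mul_assoc, h2, neg_mul, mul_assoc, ih, mul_smul_comm, pow_succ, mul_assoc]
    simp

theorem sum_del_ins {A : Type*} [AddCommMonoid A] {q r : ℕ}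
    (F : MIdx q r → MIdx (q + 1) r → Fin r → A) :
    ∑ K : MIdx (q + 1) r, ∑ j : {j // j ∈ K.1}, F (K.del j.1 j.2) K j.1
      = ∑ J : MIdx q r, ∑ j : {j // j ∉ J.1}, F J (J.ins j.1 j.2) j.1 := by
  rw [Finset.sum_sigma', Finset.sum_sigma']
  refine Finset.sum_bij' (fun x _ => ⟨x.1.del x.2.1 x.2.2, x.2.1, Finset.notMem_erase _ _⟩)
    (fun x _ => ⟨x.1.ins x.2.1 x.2.2, x.2.1, Finset.mem_insert_self _ _⟩) ?_ ?_ ?_ ?_ ?_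
  · simp
  · simp
  · rintro ⟨⟨K, hK⟩, j, hj⟩ _
    exact Sigma.subtype_ext (Subtype.ext (Finset.insert_erase hj)) rfl
  · rintro ⟨⟨K, hK⟩, j, hj⟩ _
    exact Sigma.subtype_ext (Subtype.ext (Finset.erase_insert hj)) rfl
  · rintro ⟨⟨K, hK⟩, j, hj⟩ _
    have : insert j (K.erase j) = K := Finset.insert_erase hj
    simp only [MIdx.del, MIdx.ins]
    congr!
    exact this.symm

/-- The operator `𝕃 f = ∑_{I,J} ∑_j L_j f_{IJ} dt_j ∧ dZ_I ∧ dt_J`. Since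
`dt_j ∧ dZ_I ∧ dt_J = (-1)^p ε(j, J) dZ_I ∧ dt_{J ∪ {j}}` if `j ∉ J` and `= 0` otherwise, its
coefficients are as given here; see `sum_LL`. -/
def LL (φ : Pt m n → EuclideanSpace ℝ (Fin m)) {p q : ℕ} (f : Form m n p q) :
    Form m n p (q + 1) :=
  fun I K w => (-1) ^ p * ∑ j : {j // j ∈ K.1},
    eps j.1 (K.1.erase j.1) * Lv φ j.1 (f I (K.del j.1 j.2)) w

/-- `∑_{I,K} (𝕃 f)_{IK} dZ_I ∧ dt_K = ∑_{I,J} ∑_j L_j f_{IJ} dt_j ∧ dZ_I ∧ dt_J`. -/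
theorem sum_LL {M : Type*} [AddCommGroup M] [Module ℂ M] (dZ : Fin m → M) (dt : Fin n → M)
    (φ : Pt m n → EuclideanSpace ℝ (Fin m)) {p q : ℕ} (f : Form m n p q) (w : Pt m n) :
    ∑ I : MIdx p m, ∑ K : MIdx (q + 1) n, LL φ f I K w • (wedge dZ I.1 * wedge dt K.1)
      = ∑ I : MIdx p m, ∑ J : MIdx q n, ∑ j : Fin n,
          Lv φ j (f I J) w • (ExteriorAlgebra.ι ℂ (dt j) * wedge dZ I.1 * wedge dt J.1) := by
  refine Finset.sum_congr rfl fun I _ => ?_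
  have h1 : ∀ (J : MIdx q n) (j : Fin n),
      ExteriorAlgebra.ι ℂ (dt j) * wedge dZ I.1 * wedge dt J.1
        = ((-1 : ℂ) ^ p) • (wedge dZ I.1 * (ExteriorAlgebra.ι ℂ (dt j) * wedge dt J.1)) := by
    intro J j
    rw [ι_mul_wedge_comm, I.2, smul_mul_assoc, mul_assoc]
  have h2 := sum_del_ins (q := q) (r := n) fun J K j =>
    ((-1 : ℂ) ^ p * (eps j J.1 * Lv φ j (f I J) w)) • (wedge dZ I.1 * wedge dt K.1)
  simp only [LL, Finset.mul_sum, Finset.sum_smul]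
  refine h2.trans (Finset.sum_congr rfl fun J _ => ?_)
  have h3 : ∑ j : Fin n,
      Lv φ j (f I J) w • (ExteriorAlgebra.ι ℂ (dt j) * wedge dZ I.1 * wedge dt J.1)
      = ∑ j ∈ J.1ᶜ,
        Lv φ j (f I J) w • (ExteriorAlgebra.ι ℂ (dt j) * wedge dZ I.1 * wedge dt J.1) := by
    refine (Finset.sum_subset (Finset.subset_univ _) fun j _ hj => ?_).symm
    rw [h1, ι_mul_wedge_self dt j J.1 (by simpa using hj)]
    simp
  rw [h3, Finset.sum_subtype J.1ᶜ (p := fun j => j ∉ J.1) (by simp)]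
  refine Finset.sum_congr rfl fun j _ => ?_
  rw [h1, ι_mul_wedge dt j.1 J.1 j.2, mul_smul_comm, smul_smul, smul_smul]
  congr 1
  ring

/-- The approximation operator
`𝒢_τ^χ[g](z, t) = (τ/π)^{m/2} ∫ exp(-τ ⟨z - Z(x',t)⟩²) χ(x') g(x',t) det Z_x(x',t) dx'`,
where `⟨ζ⟩² = ∑ ζ_k²`. -/
def calG (φ : Pt m n → EuclideanSpace ℝ (Fin m)) (χ : EuclideanSpace ℝ (Fin m) → ℂ) (τ : ℝ)
    (g : Pt m n → ℂ) (z : Fin m → ℂ) (t : EuclideanSpace ℝ (Fin n)) : ℂ :=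
  (((τ / Real.pi) ^ ((m : ℝ) / 2) : ℝ) : ℂ) *
    ∫ x' : EuclideanSpace ℝ (Fin m),
      Complex.exp (-(τ : ℂ) * ∑ k, (z k - Z φ (x', t) k) ^ 2) * χ x' * g (x', t) *
        (Zx φ (x', t)).det

/-- The coefficients, in the frame `dz_I ∧ dt_J` of `ℂ^m × ℝ^n`, of the form
`𝒦_τ^{(p,q+1)}[f, χ](z,t)
  = (-1)^p ∑_{|I|=p} ∑_{|J|=q+1} {∫_0^1 𝒢_τ^χ[f_{IJ}](z, σ t) σ^q dσ} dz_I ∧ ω_J`,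
where `ω_J = ∑_{j ∈ J} ε(j, J \ {j}) t_j dt_{J \ {j}}`; see `sum_calK`. -/
def calK (φ : Pt m n → EuclideanSpace ℝ (Fin m)) (χ : EuclideanSpace ℝ (Fin m) → ℂ) (τ : ℝ)
    {p q : ℕ} (f : Form m n p (q + 1)) (I : MIdx p m) (J : MIdx q n)
    (z : Fin m → ℂ) (t : EuclideanSpace ℝ (Fin n)) : ℂ :=
  (-1) ^ p * ∑ j : {j // j ∉ J.1},
    (∫ σ in (0 : ℝ)..1, calG φ χ τ (f I (J.ins j.1 j.2)) z (σ • t) * (σ : ℂ) ^ q) *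
      (eps j.1 J.1 * (t j.1 : ℂ))

/-- `∑_{I,J} 𝒦_{IJ} dz_I ∧ dt_J` is
`(-1)^p ∑_{|I|=p} ∑_{|J|=q+1} {∫_0^1 𝒢_τ^χ[f_{IJ}](z, σ t) σ^q dσ} dz_I ∧ ω_J`. -/
theorem sum_calK {M : Type*} [AddCommGroup M] [Module ℂ M] (dz : Fin m → M) (dt : Fin n → M)
    (φ : Pt m n → EuclideanSpace ℝ (Fin m)) (χ : EuclideanSpace ℝ (Fin m) → ℂ) (τ : ℝ)
    {p q : ℕ} (f : Form m n p (q + 1)) (z : Fin m → ℂ) (t : EuclideanSpace ℝ (Fin n)) :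
    ∑ I : MIdx p m, ∑ J : MIdx q n, calK φ χ τ f I J z t • (wedge dz I.1 * wedge dt J.1)
      = ((-1 : ℂ) ^ p) • ∑ I : MIdx p m, ∑ J : MIdx (q + 1) n,
          (∫ σ in (0 : ℝ)..1, calG φ χ τ (f I J) z (σ • t) * (σ : ℂ) ^ q) •
            (wedge dz I.1 *
              ∑ j ∈ J.1, (eps j (J.1.erase j) * (t j : ℂ)) • wedge dt (J.1.erase j)) := by
  rw [Finset.smul_sum]
  refine Finset.sum_congr rfl fun I _ => ?_
  have h2 := sum_del_ins (q := q) (r := n) fun J K j =>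
    ((-1 : ℂ) ^ p * ((∫ σ in (0 : ℝ)..1, calG φ χ τ (f I K) z (σ • t) * (σ : ℂ) ^ q) *
      (eps j J.1 * (t j : ℂ)))) • (wedge dz I.1 * wedge dt J.1)
  simp only [calK, Finset.mul_sum, Finset.sum_smul]
  refine h2.symm.trans ?_
  rw [Finset.smul_sum]
  refine Finset.sum_congr rfl fun K _ => ?_
  rw [← Finset.sum_coe_sort K.1, Finset.smul_sum, Finset.smul_sum]
  refine Finset.sum_congr rfl fun j _ => ?_
  simp only [MIdx.del, mul_smul_comm, smul_smul]

/-- The pullback by `λ(x,t) = (Z(x,t), t)`, for which `λ^* dz_k = dZ_k` and `λ^* dt_j = dt_j`. -/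
def pullback (φ : Pt m n → EuclideanSpace ℝ (Fin m)) {p q : ℕ}
    (k : MIdx p m → MIdx q n → (Fin m → ℂ) → EuclideanSpace ℝ (Fin n) → ℂ) : Form m n p q :=
  fun I J w => k I J (Z φ w) w.2

/-! ### The neighbourhoods -/

/-- `B_R(0) × B_S(0) ⊆ ℝ^m × ℝ^n`. -/
def box (m n : ℕ) (R S : ℝ) : Set (Pt m n) := Metric.ball 0 R ×ˢ Metric.ball 0 S

/-- `V = B_R(0) × B_R(0)` and the open set `W` satisfy `V ⊂⊂ W ⊂⊂ Ω`, and
`|φ(x,t) - φ(y,t)| ≤ |x - y| / 2` on the closure of `V`. -/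
structure Admissible (φ : Pt m n → EuclideanSpace ℝ (Fin m)) (Ω : Set (Pt m n)) (R : ℝ)
    (W : Set (Pt m n)) : Prop where
  R_pos : 0 < R
  isOpen : IsOpen W
  closure_subset : closure (box m n R R) ⊆ W
  isCompact_closure : IsCompact (closure W)
  closure_subset_domain : closure W ⊆ Ω
  lipschitz : ∀ x y t, (x, t) ∈ closure (box m n R R) → (y, t) ∈ closure (box m n R R) →
    ‖φ (x, t) - φ (y, t)‖ ≤ 1 / 2 * ‖x - y‖

end GevreyPoincare

end

open GevreyPoincare

noncomputable section

namespace GevreyPoincare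

/-! ### Pointwise Gevrey bounds: products, derivatives, exponentials -/

section GevreyCalculus

variable {ι κ E F G H : Type*} [NormedAddCommGroup E] [NormedSpace ℝ E]
  [NormedAddCommGroup F] [NormedSpace ℝ F] [NormedAddCommGroup G] [NormedSpace ℝ G]
  [NormedAddCommGroup H] [NormedSpace ℝ H]

/-! Algebra. For fixed `z` the kernel `exp(-τ⟨z - Z⟩²)` is an entire function of `Z`, hence
annihilated by every `L_j`. Differentiating `𝒢_τ[u](z,t)` in `t_j` therefore moves `L_j` onto `χ u`,
up to the integral of an `x'`-divergence with compact support, which is zero (`divergence_identity`,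
`fderiv_setIntegral_holomorphic`). So `𝒢_τ` turns `𝕃` into the exterior derivative in `t`, with `z`
a parameter, and `𝒦_τ` is the radial Poincaré homotopy for that derivative. After the pullback by
`λ`, `L_j` kills the dependence through `Z(x,t)` and acts as `∂/∂t_j` on the rest (`Lv_coneKernel`,
`Lv_coneIntegral`). The outcome is `LL_pullback_calK`: `𝕃 λ^*𝒦_τ f` is `𝒢_τ f` along the structure,
minus the homotopy applied to the coefficients of `det Z_x 𝕃(χ f)`, up to sign.

Error term. Since `𝕃 f = 0`, that density vanishes where `χ = 1`, so only `|x'| ≥ R/2` contributes,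
whereas `|x| < R/4`. For `T` small the real part of the phase is then at least `R²/64`
(`le_re_sum_sq`), and the term decays exponentially in `τ`.

Main term. Convergence of `𝒢_τ f(Z(x,t),t)` to `f` in the Gevrey class follows from uniform
convergence together with Gevrey bounds uniform in `τ`, by interpolation
(`gevreyTendsto_of_uniform_bound`). Uniform convergence, at rate `τ^{-1/2}`, is
`exists_norm_calG_sub_le`: the contour `Z(x',t) - Z(x,t)` is deformed to the real one `x' - x`,
where the Gaussian integral is explicit.

Uniform Gevrey bounds rest on `UniformGevrey.cexp`: for Gevrey `q` and any `δ > 0`, `exp(c q)` has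
Gevrey constant `exp(c (Re q + δ))` with a radius parameter that does not depend on `c ≥ 0`.
Derivatives of the exponential thus cost only an arbitrarily small part of its decay. In
`exists_gevreyAt_calG` the substitution `x' = x + y` makes the exponent `τ|y|²` times minus a sum of
squares of difference quotients of `Z`. These are Gevrey uniformly in `y`, the real part is at most
`-3/4`, and the choice `δ = 1/4` leaves `exp(-τ|y|²/2)`, whose normalised integral does not depend
on `τ`. For the error term the same lemma is used with `c = τ`. -/

theorem _root_.ContDiffAt.exists_isOpen_contDiffOn {f : E → F} {x : E} (hf : ContDiffAt ℝ ∞ f x)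
    (n : ℕ) : ∃ u : Set E, IsOpen u ∧ x ∈ u ∧ ContDiffOn ℝ n f u := by
  -- The neighbourhood on which `f` is `n` times differentiable may shrink as `n` grows, so the
  -- order is fixed first.
  have h : ContDiffAt ℝ n f x := hf.of_le (by exact_mod_cast le_top)
  obtain ⟨u, hu, hfu⟩ := h.eventually (by simp) |>.exists_mem
  obtain ⟨v, hvu, hv, hxv⟩ := mem_nhds_iff.mp hu
  exact ⟨v, hv, hxv, fun y hy => (hfu y (hvu hy)).contDiffWithinAt⟩

theorem norm_iteratedFDeriv_bilinear_le (B : F →L[ℝ] G →L[ℝ] H) {f : E → F} {g : E → G} {x : E}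
    (hf : ContDiffAt ℝ ∞ f x) (hg : ContDiffAt ℝ ∞ g x) (n : ℕ) :
    ‖iteratedFDeriv ℝ n (fun y => B (f y) (g y)) x‖ ≤ ‖B‖ * ∑ i ∈ Finset.range (n + 1),
      (n.choose i : ℝ) * ‖iteratedFDeriv ℝ i f x‖ * ‖iteratedFDeriv ℝ (n - i) g x‖ := by
  obtain ⟨u, hu, hxu, hfu⟩ := hf.exists_isOpen_contDiffOn n
  obtain ⟨v, hv, hxv, hgv⟩ := hg.exists_isOpen_contDiffOn n
  have huv := hu.inter hv
  have hx : x ∈ u ∩ v := ⟨hxu, hxv⟩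
  have h := B.norm_iteratedFDerivWithin_le_of_bilinear (hfu.mono inter_subset_left)
    (hgv.mono inter_subset_right) huv.uniqueDiffOn hx (n := n) le_rfl
  simpa only [iteratedFDerivWithin_of_isOpen _ huv hx] using h

theorem iteratedFDeriv_comp_affine {f : E → F} (A : G →L[ℝ] E) (b : E) {x : G}
    (hf : ContDiffAt ℝ ∞ f (A x + b)) (n : ℕ) :
    iteratedFDeriv ℝ n (fun y => f (A y + b)) x =
      (iteratedFDeriv ℝ n f (A x + b)).compContinuousLinearMap fun _ => A := by
  have hf' : ContDiffAt ℝ ∞ (fun z => f (z + b)) (A x) :=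
    hf.comp (A x) (contDiffAt_id.add contDiffAt_const)
  obtain ⟨u, hu, hxu, hfu⟩ := hf'.exists_isOpen_contDiffOn n
  have hpre : IsOpen (A ⁻¹' u) := hu.preimage A.continuous
  have h := A.iteratedFDerivWithin_comp_right hfu hu.uniqueDiffOn hpre.uniqueDiffOn hxu
    (i := n) le_rfl
  rw [iteratedFDerivWithin_of_isOpen _ hu hxu,
    iteratedFDerivWithin_of_isOpen _ hpre (show x ∈ A ⁻¹' u from hxu),
    iteratedFDeriv_comp_add_right] at h
  exact h

/-- Writing `n!` as the binomial times `j! (n-j)!`, the left side has the binomial to the power one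
and the right side to the power `s ≥ 1`. This is what closes Gevrey bounds under products and
exponentials. -/
theorem choose_mul_factorial_rpow_le {s : ℝ} (hs : 1 ≤ s) {n j : ℕ} (hj : j ≤ n) :
    (n.choose j : ℝ) * ((j.factorial : ℝ) ^ s * ((n - j).factorial : ℝ) ^ s)
      ≤ (n.factorial : ℝ) ^ s := by
  have h1 : (1 : ℝ) ≤ n.choose j := by exact_mod_cast Nat.choose_pos hj
  have h2 : (n.factorial : ℝ) = n.choose j * (j.factorial * (n - j).factorial) := by
    rw [← mul_assoc]
    exact_mod_cast (Nat.choose_mul_factorial_mul_factorial hj).symm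
  rw [h2, Real.mul_rpow (by positivity) (by positivity), Real.mul_rpow (by positivity)
    (by positivity)]
  gcongr
  exact Real.self_le_rpow_of_one_le h1 hs

/-- `f` is smooth at `x` and its `k`-th derivative there is at most `C h ^ k (k!) ^ s`. -/
def GevreyAt (s C h : ℝ) (f : E → F) (x : E) : Prop :=
  ContDiffAt ℝ ∞ f x ∧ ∀ k : ℕ, ‖iteratedFDeriv ℝ k f x‖ ≤ C * h ^ k * (k.factorial : ℝ) ^ s

namespace GevreyAt

variable {s C C' h h' : ℝ} {f g : E → F} {x : E}

theorem mono (hf : GevreyAt s C h f x) (hh : 0 ≤ h) (hC' : 0 ≤ C') (h1 : C ≤ C') (h2 : h ≤ h') :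
    GevreyAt s C' h' f x := by
  refine ⟨hf.1, fun k => (hf.2 k).trans ?_⟩
  gcongr

theorem congr (hf : GevreyAt s C h f x) (hfg : f =ᶠ[nhds x] g) : GevreyAt s C h g x :=
  ⟨hf.1.congr_of_eventuallyEq hfg.symm, fun k => by
    rw [← (hfg.iteratedFDeriv ℝ k).eq_of_nhds]; exact hf.2 k⟩

theorem of_eventuallyEq_zero (hf : f =ᶠ[nhds x] 0) (hC : 0 ≤ C) (hh : 0 ≤ h) :
    GevreyAt s C h f x := by
  refine congr (f := 0) ⟨contDiffAt_const, fun k => ?_⟩ hf.symm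
  have : iteratedFDeriv ℝ k (0 : E → F) = 0 := by
    change iteratedFDeriv ℝ k (fun _ => 0) = 0
    simp
  rw [this]
  simp only [Pi.zero_apply, norm_zero]
  positivity

theorem bilinear (hs : 1 ≤ s) {C₁ h₁ C₂ h₂ : ℝ} {g : E → G} (B : F →L[ℝ] G →L[ℝ] H)
    (hf : GevreyAt s C₁ h₁ f x) (hg : GevreyAt s C₂ h₂ g x) (hC₁ : 0 ≤ C₁) (hC₂ : 0 ≤ C₂)
    (hh₁ : 0 ≤ h₁) (hh₂ : 0 ≤ h₂) :
    GevreyAt s (‖B‖ * (C₁ * C₂)) (h₁ + h₂) (fun y => B (f y) (g y)) x := by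
  refine ⟨B.isBoundedBilinearMap.contDiff.contDiffAt.comp x (hf.1.prodMk hg.1), fun n => ?_⟩
  refine (norm_iteratedFDeriv_bilinear_le B hf.1 hg.1 n).trans ?_
  rw [mul_assoc, mul_assoc]
  refine mul_le_mul_of_nonneg_left ?_ (norm_nonneg B)
  rw [add_pow, Finset.sum_mul, Finset.mul_sum]
  refine Finset.sum_le_sum fun j hj => ?_
  have hjn : j ≤ n := Nat.lt_succ_iff.mp (Finset.mem_range.mp hj)
  have h1 : (1 : ℝ) ≤ n.choose j := by exact_mod_cast Nat.choose_pos hjn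
  calc (n.choose j : ℝ) * ‖iteratedFDeriv ℝ j f x‖ * ‖iteratedFDeriv ℝ (n - j) g x‖
      ≤ (n.choose j : ℝ) * (C₁ * h₁ ^ j * (j.factorial : ℝ) ^ s)
          * (C₂ * h₂ ^ (n - j) * ((n - j).factorial : ℝ) ^ s) := by
        gcongr
        · exact hf.2 j
        · exact hg.2 (n - j)
    _ = (C₁ * C₂ * (h₁ ^ j * h₂ ^ (n - j)))
        * ((n.choose j : ℝ) * ((j.factorial : ℝ) ^ s * ((n - j).factorial : ℝ) ^ s)) := by ring
    _ ≤ (C₁ * C₂ * (h₁ ^ j * h₂ ^ (n - j))) * (n.factorial : ℝ) ^ s :=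
        mul_le_mul_of_nonneg_left (choose_mul_factorial_rpow_le hs hjn) (by positivity)
    -- The Leibniz binomial was spent on the factorials; a second one, at least `1`, is inserted so
    -- that the terms sum to `(h₁ + h₂)^n`.
    _ ≤ (C₁ * C₂ * (h₁ ^ j * h₂ ^ (n - j))) * (n.factorial : ℝ) ^ s * n.choose j :=
        le_mul_of_one_le_right (by positivity) h1
    _ = _ := by ring

theorem mul {f g : E → ℂ} (hs : 1 ≤ s) {C₁ h₁ C₂ h₂ : ℝ}
    (hf : GevreyAt s C₁ h₁ f x) (hg : GevreyAt s C₂ h₂ g x) (hC₁ : 0 ≤ C₁) (hC₂ : 0 ≤ C₂)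
    (hh₁ : 0 ≤ h₁) (hh₂ : 0 ≤ h₂) :
    GevreyAt s (C₁ * C₂) (h₁ + h₂) (fun y => f y * g y) x := by
  refine (bilinear hs (ContinuousLinearMap.mul ℝ ℂ) hf hg hC₁ hC₂ hh₁ hh₂).mono
    (by positivity) (by positivity) ?_ le_rfl
  exact mul_le_of_le_one_left (by positivity) (ContinuousLinearMap.opNorm_mul_le _ _)

theorem add (hf : GevreyAt s C h f x) (hg : GevreyAt s C' h g x) :
    GevreyAt s (C + C') h (fun y => f y + g y) x := by
  refine ⟨hf.1.add hg.1, fun k => ?_⟩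
  rw [fun_iteratedFDeriv_add_apply (hf.1.of_le (by exact_mod_cast le_top))
    (hg.1.of_le (by exact_mod_cast le_top)), add_mul, add_mul]
  exact (norm_add_le _ _).trans (add_le_add (hf.2 k) (hg.2 k))

theorem clm_comp (L : F →L[ℝ] G) (hf : GevreyAt s C h f x) :
    GevreyAt s (‖L‖ * C) h (fun y => L (f y)) x := by
  refine ⟨L.contDiff.contDiffAt.comp x hf.1, fun k => ?_⟩
  refine (L.norm_iteratedFDeriv_comp_left hf.1 (n := k) (by exact_mod_cast le_top)).trans ?_
  rw [mul_assoc, mul_assoc, ← mul_assoc C]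
  exact mul_le_mul_of_nonneg_left (hf.2 k) (norm_nonneg L)

theorem comp_affine (A : G →L[ℝ] E) (b : E) {y : G} (hf : GevreyAt s C h f (A y + b))
    (hA : ‖A‖ ≤ 1) : GevreyAt s C h (fun z => f (A z + b)) y := by
  refine ⟨hf.1.comp y (A.contDiff.contDiffAt.add contDiffAt_const), fun k => ?_⟩
  rw [iteratedFDeriv_comp_affine A b hf.1]
  refine (ContinuousMultilinearMap.norm_compContinuousLinearMap_le _ _).trans ?_
  refine (mul_le_of_le_one_right (norm_nonneg _) ?_).trans (hf.2 k)
  exact Finset.prod_le_one (fun _ _ => norm_nonneg _) (fun _ _ => hA)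

theorem const (c : F) (x : E) (hC : ‖c‖ ≤ C) (hh : 0 ≤ h) : GevreyAt s C h (fun _ : E => c) x := by
  refine ⟨contDiffAt_const, fun k => ?_⟩
  have hC0 := (norm_nonneg c).trans hC
  rcases k with _ | k
  · simpa using hC
  · rw [iteratedFDeriv_const_of_ne (Nat.succ_ne_zero k)]
    simp only [Pi.zero_apply, norm_zero]
    positivity

theorem factorial_succ_rpow_le (hs : 0 ≤ s) (k : ℕ) :
    ((k + 1).factorial : ℝ) ^ s ≤ ((2 : ℝ) ^ s) ^ k * (k.factorial : ℝ) ^ s := by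
  rw [Nat.factorial_succ, Nat.cast_mul, Real.mul_rpow (by positivity) (by positivity),
    ← Real.rpow_natCast, ← Real.rpow_mul (by norm_num), mul_comm s, Real.rpow_mul (by norm_num),
    Real.rpow_natCast]
  gcongr
  exact_mod_cast Nat.lt_two_pow_self

/-- A derivative shifts the factorial by one, at the price `(k+1)^s ≤ (2^s)^k`, which goes into the
radius parameter. -/
theorem fderiv_right (hs : 0 ≤ s) (hC : 0 ≤ C) (hh : 0 ≤ h) (hf : GevreyAt s C h f x) :
    GevreyAt s (C * h) (h * 2 ^ s) (fderiv ℝ f) x := by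
  refine ⟨hf.1.fderiv_right (by simp), fun k => ?_⟩
  rw [norm_iteratedFDeriv_fderiv]
  calc _ ≤ C * h ^ (k + 1) * ((k + 1).factorial : ℝ) ^ s := hf.2 (k + 1)
    _ ≤ C * h ^ (k + 1) * (((2 : ℝ) ^ s) ^ k * (k.factorial : ℝ) ^ s) := by
      gcongr
      exact factorial_succ_rpow_le hs k
    _ = _ := by rw [mul_pow]; ring

theorem of_fderiv (hC : ‖f x‖ ≤ C) (hd : ContDiffAt ℝ ∞ f x) (hs : 0 ≤ s)
    (hC0 : 0 ≤ C) (hh : 0 < h) (hf : GevreyAt s (C * h) h (fderiv ℝ f) x) :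
    GevreyAt s C h f x := by
  refine ⟨hd, fun k => ?_⟩
  rcases k with _ | k
  · simpa using hC
  · rw [← norm_iteratedFDeriv_fderiv]
    refine (hf.2 k).trans ?_
    rw [pow_succ', ← mul_assoc]
    gcongr
    simp

theorem clm (L : E →L[ℝ] F) (hs : 0 ≤ s) (hC : 0 ≤ C) (hx : ‖L x‖ ≤ C) (hL : ‖L‖ ≤ C) :
    GevreyAt s C 1 (fun y => L y) x := by
  refine of_fderiv hx L.contDiff.contDiffAt hs hC one_pos ?_
  have : fderiv ℝ (fun y => L y) = fun _ => L := by ext1 y; exact L.fderiv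
  rw [this]
  exact const L x (by simpa using hL) zero_le_one

/-- A discrete Gronwall inequality for the coefficients of the exponential of a power series. -/
theorem exp_coeff_le {a : ℕ → ℝ} {A β r : ℝ} (hA : 0 ≤ A) (hβ : 0 ≤ β) (hr : 0 ≤ r)
    (hr2 : r ≤ 1 / 2) (h0 : a 0 ≤ A)
    (hrec : ∀ k : ℕ, (k + 1) * a (k + 1)
      ≤ ∑ j ∈ Finset.range (k + 1), ((k + 1 - j : ℕ) : ℝ) * (β * r ^ (k + 1 - j)) * a j) (k : ℕ) :
    a k ≤ A * Real.exp (4 * β * r) := by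
  -- The majorant of `a` is `A` times the partial sums `u` of the exponential series of `K`: they
  -- increase and satisfy `K u_n ≤ (n+1) u_{n+1}`, which is the recursion once the weights are
  -- summed.
  set K := 4 * β * r with hK
  have hK0 : 0 ≤ K := by positivity
  set u : ℕ → ℝ := fun n => ∑ l ∈ Finset.range (n + 1), K ^ l / l.factorial with hu
  have hu0 : ∀ n, 0 ≤ u n := fun n => Finset.sum_nonneg fun _ _ => by positivity
  have humono : Monotone u := monotone_nat_of_le_succ fun n => by
    simp only [hu]
    rw [Finset.sum_range_succ _ (n + 1)]
    have : 0 ≤ K ^ (n + 1) / ((n + 1).factorial : ℝ) := by positivity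
    linarith
  have hstep : ∀ n : ℕ, K * u n ≤ (n + 1) * u (n + 1) := by
    intro n
    simp only [hu]
    rw [Finset.sum_range_succ' _ (n + 1), mul_add, Finset.mul_sum, Finset.mul_sum]
    have : ∑ i ∈ Finset.range (n + 1), K * (K ^ i / (i.factorial : ℝ))
        ≤ ∑ i ∈ Finset.range (n + 1), ((n : ℝ) + 1) * (K ^ (i + 1) / ((i + 1).factorial : ℝ)) := by
      refine Finset.sum_le_sum fun i hi => ?_
      have hi' : (i : ℝ) + 1 ≤ n + 1 := by exact_mod_cast Finset.mem_range.mp hi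
      have h1 : K * (K ^ i / (i.factorial : ℝ))
          = ((i : ℝ) + 1) * (K ^ (i + 1) / ((i + 1).factorial : ℝ)) := by
        rw [Nat.factorial_succ]
        push_cast
        field_simp
        ring
      rw [h1]
      gcongr
    have h2 : 0 ≤ ((n : ℝ) + 1) * (K ^ 0 / ((0 : ℕ).factorial : ℝ)) := by positivity
    linarith
  -- The full series is `r/(1-r)²`, at most `4r` because `r ≤ 1/2`; hence the `4` in `K`.
  have hgeo : ∀ n : ℕ, ∑ j ∈ Finset.range (n + 1), ((n + 1 - j : ℕ) : ℝ) * r ^ (n + 1 - j)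
      ≤ 4 * r := by
    intro n
    have h1 : ∑ j ∈ Finset.range (n + 1), ((n + 1 - j : ℕ) : ℝ) * r ^ (n + 1 - j)
        = ∑ i ∈ Finset.range (n + 1), ((i + 1 : ℕ) : ℝ) * r ^ (i + 1) := by
      rw [← Finset.sum_range_reflect]
      refine Finset.sum_congr rfl fun j hj => ?_
      have := Finset.mem_range.mp hj
      congr 2 <;> [congr 1; skip] <;> omega
    have h2 : ∑ i ∈ Finset.range (n + 1), ((i + 1 : ℕ) : ℝ) * r ^ (i + 1)
        ≤ ∑ i ∈ Finset.range (n + 2), (i : ℝ) * r ^ i := by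
      rw [Finset.sum_range_succ' _ (n + 1)]
      simp
    have h3 := hasSum_coe_mul_geometric_of_norm_lt_one (r := r)
      (by rw [Real.norm_of_nonneg hr]; linarith)
    have h4 : ∑ i ∈ Finset.range (n + 2), (i : ℝ) * r ^ i ≤ r / (1 - r) ^ 2 :=
      sum_le_hasSum _ (fun _ _ => by positivity) h3
    have h5 : r / (1 - r) ^ 2 ≤ 4 * r := by
      rw [div_le_iff₀ (by nlinarith)]
      nlinarith [mul_nonneg hr (mul_nonneg (by linarith : 0 ≤ 1 / 2 - r)
        (by linarith : 0 ≤ 3 / 2 - r))]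
    linarith
  have hmain : ∀ k, a k ≤ A * u k := by
    intro k
    induction k using Nat.strong_induction_on with
    | _ k ih =>
      rcases k with _ | k
      · simpa [hu] using h0
      · have h1 : ((k : ℝ) + 1) * a (k + 1) ≤ (k + 1) * (A * u (k + 1)) := by
          calc ((k : ℝ) + 1) * a (k + 1) ≤ _ := hrec k
            _ ≤ ∑ j ∈ Finset.range (k + 1),
                ((k + 1 - j : ℕ) : ℝ) * (β * r ^ (k + 1 - j)) * (A * u k) := by
              refine Finset.sum_le_sum fun j hj => ?_
              have hj' := Finset.mem_range.mp hj
              gcongr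
              exact (ih j hj').trans (mul_le_mul_of_nonneg_left
                (humono (Nat.lt_succ_iff.mp hj')) hA)
            _ = (β * (A * u k)) *
                ∑ j ∈ Finset.range (k + 1), ((k + 1 - j : ℕ) : ℝ) * r ^ (k + 1 - j) := by
              generalize u k = v
              rw [Finset.mul_sum]
              exact Finset.sum_congr rfl fun _ _ => by ring
            _ ≤ (β * (A * u k)) * (4 * r) := by
              have := hu0 k
              exact mul_le_mul_of_nonneg_left (hgeo k) (by positivity)
            _ = A * (K * u k) := by rw [hK]; ring
            _ ≤ A * ((k + 1) * u (k + 1)) := mul_le_mul_of_nonneg_left (hstep k) hA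
            _ = _ := by ring
        exact le_of_mul_le_mul_left h1 (by positivity)
  exact (hmain k).trans (mul_le_mul_of_nonneg_left (Real.sum_le_exp_of_nonneg hK0 _) hA)

/-- The Leibniz rule for `(e^q)' = e^q q'` gives the derivatives of `e^q`, divided by `h'^k (k!)^s`,
the recursion of `exp_coeff_le` with `β = C` and `r = h/h'`. The loss `4 C h/h'` in the exponent can
be made small by enlarging `h'`. -/
theorem cexp {q : E → ℂ} (hs : 1 ≤ s) (hC : 0 ≤ C) (hh : 0 ≤ h) (hH : 2 * h ≤ h') (hh' : 0 < h')
    (hq : GevreyAt s C h q x) :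
    GevreyAt s (Real.exp ((q x).re + 4 * C * (h / h'))) h' (fun y => Complex.exp (q y)) x := by
  have hE : ContDiffAt ℝ ∞ (fun y => Complex.exp (q y)) x := hq.1.cexp
  refine ⟨hE, fun k => ?_⟩
  set a : ℕ → ℝ := fun k =>
    ‖iteratedFDeriv ℝ k (fun y => Complex.exp (q y)) x‖ / (h' ^ k * (k.factorial : ℝ) ^ s) with ha
  have hpos : ∀ k : ℕ, 0 < h' ^ k * (k.factorial : ℝ) ^ s := fun k => by positivity
  have ha' : ∀ k, ‖iteratedFDeriv ℝ k (fun y => Complex.exp (q y)) x‖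
      = a k * (h' ^ k * (k.factorial : ℝ) ^ s) := fun k =>
    (div_eq_iff (hpos k).ne').mp rfl
  have hder : fderiv ℝ (fun y => Complex.exp (q y))
      =ᶠ[nhds x] fun y => Complex.exp (q y) • fderiv ℝ q y := by
    have hq1 : ContDiffAt ℝ 1 q x := hq.1.of_le (by exact_mod_cast le_top)
    filter_upwards [hq1.eventually (by simp)] with y hy
    exact ((hy.differentiableAt (by simp)).hasFDerivAt.cexp).fderiv
  have key : a k ≤ Real.exp (q x).re * Real.exp (4 * C * (h / h')) := by
    refine exp_coeff_le (Real.exp_nonneg _) hC (by positivity) ?_ ?_ (fun k => ?_) k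
    · rw [div_le_iff₀ hh']; linarith
    · simp [ha, Complex.norm_exp]
    · have h1 : ‖iteratedFDeriv ℝ (k + 1) (fun y => Complex.exp (q y)) x‖
          ≤ ∑ i ∈ Finset.range (k + 1), (k.choose i : ℝ) *
            ‖iteratedFDeriv ℝ i (fun y => Complex.exp (q y)) x‖ *
            ‖iteratedFDeriv ℝ (k - i) (fderiv ℝ q) x‖ := by
        rw [← norm_iteratedFDeriv_fderiv, (hder.iteratedFDeriv ℝ k).eq_of_nhds]
        refine (norm_iteratedFDeriv_bilinear_le
          (ContinuousLinearMap.lsmul ℝ ℂ : ℂ →L[ℝ] (E →L[ℝ] ℂ) →L[ℝ] (E →L[ℝ] ℂ)) hE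
          (hq.1.fderiv_right (by simp)) k).trans ?_
        exact mul_le_of_le_one_left (by positivity) ContinuousLinearMap.opNorm_lsmul_le
      have hpk := hpos (k + 1)
      have h2 : ((k : ℝ) + 1) * a (k + 1)
          = (k + 1) * ‖iteratedFDeriv ℝ (k + 1) (fun y => Complex.exp (q y)) x‖
            / (h' ^ (k + 1) * ((k + 1).factorial : ℝ) ^ s) := by
        simp only [ha]; rw [mul_div_assoc]
      rw [h2, div_le_iff₀ hpk]
      refine (mul_le_mul_of_nonneg_left h1 (by positivity)).trans ?_
      rw [Finset.mul_sum, Finset.sum_mul]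
      refine Finset.sum_le_sum fun j hj => ?_
      have hjk : j ≤ k := Nat.lt_succ_iff.mp (Finset.mem_range.mp hj)
      have haj : 0 ≤ a j := by simp only [ha]; positivity
      rw [ha' j, norm_iteratedFDeriv_fderiv]
      have h3 := hq.2 (k - j + 1)
      have hsub : k - j + 1 = k + 1 - j := by omega
      rw [hsub] at h3 ⊢
      have h4 := choose_mul_factorial_rpow_le hs (n := k + 1) (j := j) (by omega)
      -- Passing from binomials of order `k` to order `k + 1` produces the weight `k + 1 - j` of the
      -- recursion.
      have h5 : (k.choose j : ℝ) * (k + 1) = ((k + 1).choose j : ℝ) * ((k + 1 - j : ℕ) : ℝ) := by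
        exact_mod_cast Nat.choose_mul_succ_eq k j
      have h6 : h' ^ (k + 1) = h' ^ j * h' ^ (k + 1 - j) := by
        rw [← pow_add]; congr 1; omega
      calc ((k : ℝ) + 1) * ((k.choose j : ℝ) * (a j * (h' ^ j * (j.factorial : ℝ) ^ s))
            * ‖iteratedFDeriv ℝ (k + 1 - j) q x‖)
          ≤ ((k : ℝ) + 1) * ((k.choose j : ℝ) * (a j * (h' ^ j * (j.factorial : ℝ) ^ s))
            * (C * h ^ (k + 1 - j) * ((k + 1 - j).factorial : ℝ) ^ s)) := by
            gcongr
        _ = ((k.choose j : ℝ) * (k + 1)) * (a j * h' ^ j * C * h ^ (k + 1 - j))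
              * ((j.factorial : ℝ) ^ s * ((k + 1 - j).factorial : ℝ) ^ s) := by ring
        _ = ((k + 1 - j : ℕ) : ℝ) * (a j * h' ^ j * C * h ^ (k + 1 - j))
              * (((k + 1).choose j : ℝ) *
                ((j.factorial : ℝ) ^ s * ((k + 1 - j).factorial : ℝ) ^ s)) := by rw [h5]; ring
        _ ≤ ((k + 1 - j : ℕ) : ℝ) * (a j * h' ^ j * C * h ^ (k + 1 - j))
              * ((k + 1).factorial : ℝ) ^ s := by
            gcongr
        _ = _ := by
            rw [h6, div_pow]
            field_simp
  rw [← Real.exp_add] at key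
  rw [ha' k, mul_assoc]
  exact mul_le_mul_of_nonneg_right key (hpos k).le

end GevreyAt

end GevreyCalculus

/-! ### Gevrey bounds uniform over a family of functions and base points -/

section UniformGevrey

variable {ι κ E F G H : Type*} [NormedAddCommGroup E] [NormedSpace ℝ E]
  [NormedAddCommGroup F] [NormedSpace ℝ F] [NormedAddCommGroup G] [NormedSpace ℝ G]
  [NormedAddCommGroup H] [NormedSpace ℝ H]

/-- The functions `f i` satisfy Gevrey bounds at the points `P i`, uniformly in `i ∈ S`. -/
def UniformGevrey (s : ℝ) (S : Set ι) (P : ι → E) (f : ι → E → F) : Prop :=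
  ∃ C h : ℝ, 0 < C ∧ 0 < h ∧ ∀ i ∈ S, GevreyAt s C h (f i) (P i)

namespace UniformGevrey

variable {s : ℝ} {S : Set ι} {P : ι → E} {f g : ι → E → F}

theorem reindex (hf : UniformGevrey s S P f) (e : κ → ι) {S' : Set κ} (he : ∀ i ∈ S', e i ∈ S) :
    UniformGevrey s S' (fun i => P (e i)) fun i => f (e i) := by
  obtain ⟨C, h, hC, hh, hb⟩ := hf
  exact ⟨C, h, hC, hh, fun i hi => hb _ (he i hi)⟩

theorem congr (hf : UniformGevrey s S P f) (hfg : ∀ i ∈ S, f i =ᶠ[nhds (P i)] g i) :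
    UniformGevrey s S P g := by
  obtain ⟨C, h, hC, hh, hb⟩ := hf
  exact ⟨C, h, hC, hh, fun i hi => (hb i hi).congr (hfg i hi)⟩

theorem const_of_bound {c : ι → F} {C : ℝ} (hc : ∀ i ∈ S, ‖c i‖ ≤ C) :
    UniformGevrey s S P fun i _ => c i := by
  refine ⟨max C 1, 1, by positivity, one_pos, fun i hi => ?_⟩
  exact GevreyAt.const _ _ ((hc i hi).trans (le_max_left _ _)) zero_le_one

theorem const (c : F) : UniformGevrey s S P fun _ _ => c :=
  const_of_bound (C := ‖c‖) fun _ _ => le_rfl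

theorem clm (hs : 0 ≤ s) (L : E →L[ℝ] F) {B : ℝ} (hP : ∀ i ∈ S, ‖P i‖ ≤ B) :
    UniformGevrey s S P fun _ x => L x := by
  refine ⟨max (‖L‖ * B) (max ‖L‖ 1), 1, by positivity, one_pos, fun i hi => ?_⟩
  refine GevreyAt.clm L hs (by positivity) ((L.le_opNorm _).trans ?_) ?_
  · exact (mul_le_mul_of_nonneg_left (hP i hi) (norm_nonneg L)).trans (le_max_left _ _)
  · exact (le_max_left _ _).trans (le_max_right _ _)

theorem bilinear (hs : 1 ≤ s) {g : ι → E → G} (B : F →L[ℝ] G →L[ℝ] H) (hf : UniformGevrey s S P f)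
    (hg : UniformGevrey s S P g) : UniformGevrey s S P fun i x => B (f i x) (g i x) := by
  obtain ⟨C, h, hC, hh, hb⟩ := hf
  obtain ⟨C', h', hC', hh', hb'⟩ := hg
  refine ⟨‖B‖ * (C * C') + 1, h + h', by positivity, by positivity, fun i hi => ?_⟩
  exact (GevreyAt.bilinear hs B (hb i hi) (hb' i hi) hC.le hC'.le hh.le hh'.le).mono
    (by positivity) (by positivity) (by linarith) le_rfl

theorem mul (hs : 1 ≤ s) {f g : ι → E → ℂ} (hf : UniformGevrey s S P f)
    (hg : UniformGevrey s S P g) : UniformGevrey s S P fun i x => f i x * g i x :=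
  bilinear hs (ContinuousLinearMap.mul ℝ ℂ) hf hg

theorem add (hf : UniformGevrey s S P f) (hg : UniformGevrey s S P g) :
    UniformGevrey s S P fun i x => f i x + g i x := by
  obtain ⟨C, h, hC, hh, hb⟩ := hf
  obtain ⟨C', h', hC', hh', hb'⟩ := hg
  refine ⟨C + C', max h h', by positivity, by positivity, fun i hi => ?_⟩
  exact ((hb i hi).mono hh.le hC.le le_rfl (le_max_left _ _)).add
    ((hb' i hi).mono hh'.le hC'.le le_rfl (le_max_right _ _))

theorem clm_comp (L : F →L[ℝ] G) (hf : UniformGevrey s S P f) :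
    UniformGevrey s S P fun i x => L (f i x) := by
  obtain ⟨C, h, hC, hh, hb⟩ := hf
  refine ⟨‖L‖ * C + 1, h, by positivity, hh, fun i hi => ?_⟩
  exact ((hb i hi).clm_comp L).mono hh.le (by positivity) (by linarith) le_rfl

theorem neg (hf : UniformGevrey s S P f) : UniformGevrey s S P fun i x => - f i x :=
  hf.clm_comp (-ContinuousLinearMap.id ℝ F)

theorem sub (hf : UniformGevrey s S P f) (hg : UniformGevrey s S P g) :
    UniformGevrey s S P fun i x => f i x - g i x := by
  simpa only [sub_eq_add_neg] using hf.add hg.neg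

theorem sum {α : Type*} (A : Finset α) {f : α → ι → E → F}
    (hf : ∀ a ∈ A, UniformGevrey s S P (f a)) :
    UniformGevrey s S P fun i x => ∑ a ∈ A, f a i x := by
  classical
  induction A using Finset.induction_on with
  | empty => simpa using const 0
  | insert a A ha ih =>
    simp only [Finset.sum_insert ha]
    exact (hf a (by simp)).add (ih fun b hb => hf b (by simp [hb]))

theorem prod (hs : 1 ≤ s) {α : Type*} (A : Finset α) {f : α → ι → E → ℂ}
    (hf : ∀ a ∈ A, UniformGevrey s S P (f a)) :
    UniformGevrey s S P fun i x => ∏ a ∈ A, f a i x := by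
  classical
  induction A using Finset.induction_on with
  | empty => simpa using const 1
  | insert a A ha ih =>
    simp only [Finset.prod_insert ha]
    exact (hf a (by simp)).mul hs (ih fun b hb => hf b (by simp [hb]))

theorem det (hs : 1 ≤ s) {r : ℕ} {A : ι → E → Matrix (Fin r) (Fin r) ℂ}
    (hA : ∀ k l, UniformGevrey s S P fun i x => A i x k l) :
    UniformGevrey s S P fun i x => (A i x).det := by
  simp only [Matrix.det_apply']
  exact sum _ fun σ _ => (const _).mul hs (prod hs _ fun k _ => hA _ _)

theorem adjugate (hs : 1 ≤ s) {r : ℕ} {A : ι → E → Matrix (Fin r) (Fin r) ℂ}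
    (hA : ∀ k l, UniformGevrey s S P fun i x => A i x k l) (a b : Fin r) :
    UniformGevrey s S P fun i x => (A i x).adjugate a b := by
  simp only [Matrix.adjugate_apply]
  refine det hs fun k l => ?_
  by_cases h : k = b
  · subst h
    simpa only [Matrix.updateRow_self] using const _
  · simpa only [Matrix.updateRow_ne h] using hA k l

theorem fderiv_apply (hs : 0 ≤ s) (hf : UniformGevrey s S P f) (v : E) :
    UniformGevrey s S P fun i x => fderiv ℝ (f i) x v := by
  obtain ⟨C, h, hC, hh, hb⟩ := hf
  have : UniformGevrey s S P fun i x => fderiv ℝ (f i) x :=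
    ⟨C * h, h * 2 ^ s, by positivity, by positivity,
      fun i hi => (hb i hi).fderiv_right hs hC.le hh.le⟩
  exact this.clm_comp (ContinuousLinearMap.apply ℝ F v)

theorem comp_affine (hf : UniformGevrey s S P f) (A : ι → G →L[ℝ] E) (b : ι → E) {Q : ι → G}
    (hA : ∀ i ∈ S, ‖A i‖ ≤ 1) (hQ : ∀ i ∈ S, A i (Q i) + b i = P i) :
    UniformGevrey s S Q fun i x => f i (A i x + b i) := by
  obtain ⟨C, h, hC, hh, hb⟩ := hf
  refine ⟨C, h, hC, hh, fun i hi => GevreyAt.comp_affine (A i) (b i) ?_ (hA i hi)⟩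
  rw [hQ i hi]; exact hb i hi

/-- Multiplying `q` by `c` multiplies its Gevrey constant by `c`, so the loss in the exponent is `c
· 4Ch/H`, linear in `c`. The choice `H ≥ 4Ch/δ` keeps it below `cδ` for all `c` simultaneously. -/
theorem cexp (hs : 1 ≤ s) {q : ι → E → ℂ} (hq : UniformGevrey s S P q) {δ : ℝ} (hδ : 0 < δ) :
    ∃ H : ℝ, 0 < H ∧ ∀ i ∈ S, ∀ c : ℝ, 0 ≤ c →
      GevreyAt s (Real.exp (c * ((q i (P i)).re + δ))) H
        (fun x => Complex.exp ((c : ℂ) * q i x)) (P i) := by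
  obtain ⟨C, h, hC, hh, hb⟩ := hq
  refine ⟨max (2 * h) (4 * C * h / δ), by positivity, fun i hi c hc => ?_⟩
  set H := max (2 * h) (4 * C * h / δ)
  have hH : 0 < H := by positivity
  have h1 : GevreyAt s (c * C) h (fun x => (c : ℂ) * q i x) (P i) := by
    have := (hb i hi).clm_comp (c • ContinuousLinearMap.id ℝ ℂ)
    have h2 := this.mono (C' := c * C) hh.le (by positivity) (by
      refine mul_le_mul_of_nonneg_right ?_ hC.le
      rw [norm_smul, Real.norm_of_nonneg hc]
      exact mul_le_of_le_one_right hc ContinuousLinearMap.norm_id_le) le_rfl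
    simpa using h2
  refine (h1.cexp hs (by positivity) hh.le (le_max_left _ _) hH).mono hH.le
    (Real.exp_nonneg _) (Real.exp_le_exp.mpr ?_) le_rfl
  have h3 : 4 * C * h / H ≤ δ := by
    rw [div_le_comm₀ hH hδ]; exact le_max_right _ _
  have h4 : 4 * (c * C) * (h / H) = c * (4 * C * h / H) := by ring
  rw [h4, mul_add]
  simp only [Complex.mul_re, Complex.ofReal_re, Complex.ofReal_im, zero_mul, sub_zero]
  gcongr

theorem of_upToClosure {f : E → F} {W : Set E} (hW : IsOpen W) (hf : IsGevreyUpToClosure s f W)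
    (hP : ∀ i ∈ S, P i ∈ W) : UniformGevrey s S P fun _ => f := by
  obtain ⟨hd, h, hh, C, hb⟩ := hf
  refine ⟨max C 1, h, by positivity, hh, fun i hi =>
    ⟨hd.contDiffAt (hW.mem_nhds (hP i hi)), fun k => (hb k _ (hP i hi)).trans ?_⟩⟩
  gcongr
  exact le_max_left _ _

theorem of_isGevreyOn {f : E → F} {Ω K : Set E} (hΩ : IsOpen Ω) (hf : IsGevreyOn s f Ω)
    (hK : IsCompact K) (hKΩ : K ⊆ Ω) (hP : ∀ i ∈ S, P i ∈ K) : UniformGevrey s S P fun _ => f := by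
  obtain ⟨h, hh, C, hb⟩ := hf.2 K hKΩ hK
  refine ⟨max C 1, h, by positivity, hh, fun i hi =>
    ⟨hf.1.contDiffAt (hΩ.mem_nhds (hKΩ (hP i hi))), fun k => (hb k _ (hP i hi)).trans ?_⟩⟩
  gcongr
  exact le_max_left _ _

/-- Difference quotients of a function with uniform Gevrey bounds on a convex set. -/
theorem diffQuot (hs : 0 ≤ s) {V : Set E} (hV : Convex ℝ V) {f : E → F}
    (hf : UniformGevrey s V id fun _ => f) (y : ι → E) (hP : ∀ i ∈ S, P i ∈ V)
    (hy : ∀ i ∈ S, P i + y i ∈ V) :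
    UniformGevrey s S P fun i x => (‖y i‖⁻¹ : ℝ) • (f (x + y i) - f x) := by
  obtain ⟨C, h, hC, hh, hb⟩ := hf
  refine ⟨C * h, h * 2 ^ s, by positivity, by positivity, fun i hi => ?_⟩
  have hs1 : ContDiffAt ℝ ∞ (fun x => f (x + y i)) (P i) :=
    (hb _ (hy i hi)).1.comp (P i) (contDiffAt_id.add contDiffAt_const)
  have hs2 : ContDiffAt ℝ ∞ f (P i) := (hb _ (hP i hi)).1
  refine ⟨(hs1.sub hs2).const_smul _, fun k => ?_⟩
  have hk : ((k : ℕ) : ℕ∞ω) ≤ ∞ := by exact_mod_cast le_top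
  change ‖iteratedFDeriv ℝ k ((‖y i‖⁻¹ : ℝ) • (fun x => f (x + y i) - f x)) (P i)‖ ≤ _
  rw [iteratedFDeriv_const_smul_apply ((hs1.sub hs2).of_le hk),
    fun_iteratedFDeriv_sub_apply (hs1.of_le hk) (hs2.of_le hk), iteratedFDeriv_comp_add_right]
  -- The mean value inequality for the `k`-th derivative, along the segment inside the convex set
  -- `V`, with the bound of order `k + 1`.
  have hmv := hV.norm_image_sub_le_of_norm_fderiv_le (𝕜 := ℝ) (f := iteratedFDeriv ℝ k f)
    (C := C * h ^ (k + 1) * ((k + 1).factorial : ℝ) ^ s)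
    (fun x hx => (hb x hx).1.differentiableAt_iteratedFDeriv
      (by exact_mod_cast WithTop.coe_lt_top k))
    (fun x hx => by rw [norm_fderiv_iteratedFDeriv]; exact (hb x hx).2 (k + 1)) (hP i hi) (hy i hi)
  rw [add_sub_cancel_left] at hmv
  rw [norm_smul, norm_inv, norm_norm]
  have h1 : ‖y i‖⁻¹ * ‖iteratedFDeriv ℝ k f (P i + y i) - iteratedFDeriv ℝ k f (P i)‖
      ≤ C * h ^ (k + 1) * ((k + 1).factorial : ℝ) ^ s := by
    -- For `y i = 0` the convention `0⁻¹ = 0` makes the quotient vanish, so the bound persists down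
    -- to the diagonal.
    rcases eq_or_ne (‖y i‖) 0 with h0 | h0
    · rw [h0]; simp only [inv_zero, zero_mul]; positivity
    · rw [inv_mul_le_iff₀ (lt_of_le_of_ne (norm_nonneg _) h0.symm), mul_comm]; exact hmv
  refine h1.trans ?_
  calc _ ≤ C * h ^ (k + 1) * (((2 : ℝ) ^ s) ^ k * (k.factorial : ℝ) ^ s) := by
        gcongr
        exact GevreyAt.factorial_succ_rpow_le hs k
    _ = _ := by rw [mul_pow]; ring

end UniformGevrey

end UniformGevrey

set_option linter.unusedSectionVars false

/-! ### Differentiation under the integral sign to all orders -/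

section ParametricIntegral

theorem integral_linearIsometryEquiv_comp {A B Y : Type*} [NormedAddCommGroup A] [NormedSpace ℝ A]
    [NormedAddCommGroup B] [NormedSpace ℝ B] [MeasurableSpace Y] {μ : Measure Y} (L : A ≃ₗᵢ[ℝ] B)
    (g : Y → A) : ∫ y, L (g y) ∂μ = L (∫ y, g y ∂μ) :=
  L.toContinuousLinearEquiv.integral_comp_comm g

variable {E F Y : Type*} [NormedAddCommGroup E] [NormedSpace ℝ E] [FiniteDimensional ℝ E]
  [NormedAddCommGroup F] [NormedSpace ℝ F] [CompleteSpace F]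
  [NormedAddCommGroup Y] [NormedSpace ℝ Y] [MeasurableSpace Y] [BorelSpace Y]
  {μ : Measure Y} [IsFiniteMeasureOnCompacts μ]

theorem hasFDerivAt_setIntegral_of_continuousOn {O : Set E} {K : Set Y} (hO : IsOpen O)
    (hK : IsCompact K) {G : E → Y → F} {G' : E → Y → E →L[ℝ] F}
    (hG : ContinuousOn (Function.uncurry G) (O ×ˢ K))
    (hG' : ContinuousOn (Function.uncurry G') (O ×ˢ K))
    (hd : ∀ x ∈ O, ∀ y ∈ K, HasFDerivAt (fun x => G x y) (G' x y) x) {x : E} (hx : x ∈ O) :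
    HasFDerivAt (fun x => ∫ y in K, G x y ∂μ) (∫ y in K, G' x y ∂μ) x := by
  obtain ⟨r, hr, hrO⟩ := Metric.nhds_basis_closedBall.mem_iff.mp (hO.mem_nhds hx)
  -- Compactness of ball times `K` supplies a constant dominating function for the derivative.
  obtain ⟨C, hC⟩ := ((isCompact_closedBall x r).prod hK).exists_bound_of_continuousOn
    (hG'.mono (prod_mono hrO Subset.rfl))
  have hslice : ∀ x ∈ O, ContinuousOn (G x) K := fun x hx =>
    hG.comp (by fun_prop : ContinuousOn (fun y => (x, y)) K) fun y hy => ⟨hx, hy⟩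
  have hslice' : ContinuousOn (G' x) K :=
    hG'.comp (by fun_prop : ContinuousOn (fun y => (x, y)) K) fun y hy => ⟨hx, hy⟩
  have hmem : ∀ᵐ y ∂μ.restrict K, y ∈ K := ae_restrict_mem hK.measurableSet
  refine hasFDerivAt_integral_of_dominated_of_fderiv_le (Metric.closedBall_mem_nhds x hr)
    (bound := fun _ => C) ?_ ((hslice x hx).integrableOn_compact hK)
    ((hslice'.integrableOn_compact hK).aestronglyMeasurable) ?_ ?_ ?_
  · filter_upwards [hO.mem_nhds hx] with z hz
    exact ((hslice z hz).integrableOn_compact hK).aestronglyMeasurable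
  · filter_upwards [hmem] with y hy z hz
    exact hC (z, y) ⟨hz, hy⟩
  · exact integrableOn_const hK.measure_lt_top.ne
  · filter_upwards [hmem] with y hy z hz
    exact hd z (hrO hz) y hy

theorem contDiffAt_slice {O : Set E} {Y' : Set Y} (hO : IsOpen O) (hY' : IsOpen Y')
    {H : E → Y → F} (hH : ContDiffOn ℝ ∞ (Function.uncurry H) (O ×ˢ Y')) {x : E} {y : Y}
    (hx : x ∈ O) (hy : y ∈ Y') : ContDiffAt ℝ ∞ (fun x => H x y) x :=
  (hH.contDiffAt ((hO.prod hY').mem_nhds ⟨hx, hy⟩)).comp x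
    (contDiffAt_id.prodMk contDiffAt_const)

/-- The derivatives in the first variable are the joint derivatives restricted to the first factor,
and these are continuous in both variables. -/
theorem continuousOn_iteratedFDeriv_slice {O : Set E} {Y' : Set Y} (hO : IsOpen O)
    (hY' : IsOpen Y') {H : E → Y → F} (hH : ContDiffOn ℝ ∞ (Function.uncurry H) (O ×ˢ Y')) (k : ℕ) :
    ContinuousOn (fun w : E × Y => iteratedFDeriv ℝ k (fun x => H x w.2) w.1) (O ×ˢ Y') := by
  have hOY := hO.prod hY'
  have h1 : ContinuousOn (fun w : E × Y => (iteratedFDeriv ℝ k (Function.uncurry H) w)) (O ×ˢ Y') :=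
    (hH.continuousOn_iteratedFDerivWithin (m := k) (by exact_mod_cast le_top)
      hOY.uniqueDiffOn).congr fun w hw => (iteratedFDerivWithin_of_isOpen k hOY hw).symm
  have h2 := (ContinuousMultilinearMap.compContinuousLinearMapL (𝕜 := ℝ) (F := F)
    (fun _ : Fin k => ContinuousLinearMap.inl ℝ E Y)).continuous.comp_continuousOn h1
  refine h2.congr fun w hw => ?_
  have h3 := iteratedFDeriv_comp_affine (f := Function.uncurry H) (ContinuousLinearMap.inl ℝ E Y)
    (0, w.2) (x := w.1) (by
      simpa using hH.contDiffAt (hOY.mem_nhds hw)) k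
  simpa using h3

/-- Smoothness of integrals over compact sets of functions depending smoothly on a parameter. -/
theorem contDiffOn_setIntegral {O : Set E} {K Y' : Set Y} (hO : IsOpen O)
    (hK : IsCompact K) (hY' : IsOpen Y') (hKY : K ⊆ Y') {H : E → Y → F}
    (hH : ContDiffOn ℝ ∞ (Function.uncurry H) (O ×ˢ Y')) :
    ContDiffOn ℝ ∞ (fun x => ∫ y in K, H x y ∂μ) O ∧
      ∀ k : ℕ, ∀ x ∈ O, iteratedFDeriv ℝ k (fun x => ∫ y in K, H x y ∂μ) x
        = ∫ y in K, iteratedFDeriv ℝ k (fun x => H x y) x ∂μ := by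
  have hcont : ∀ k : ℕ, ContinuousOn
      (Function.uncurry fun x y => iteratedFDeriv ℝ k (fun x => H x y) x) (O ×ˢ K) := fun k =>
    (continuousOn_iteratedFDeriv_slice hO hY' hH k).mono (prod_mono Subset.rfl hKY)
  have hder : ∀ (k : ℕ) (x : E) (y : Y),
      fderiv ℝ (iteratedFDeriv ℝ k (fun x => H x y)) x
        = continuousMultilinearCurryLeftEquiv ℝ (fun _ : Fin (k + 1) => E) F
          (iteratedFDeriv ℝ (k + 1) (fun x => H x y) x) := fun k x y => by
    rw [iteratedFDeriv_succ_eq_comp_left]; simp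
  have hp : ∀ k : ℕ, ∀ x ∈ O,
      HasFDerivAt (fun x => ∫ y in K, iteratedFDeriv ℝ k (fun x => H x y) x ∂μ)
        (continuousMultilinearCurryLeftEquiv ℝ (fun _ : Fin (k + 1) => E) F
          (∫ y in K, iteratedFDeriv ℝ (k + 1) (fun x => H x y) x ∂μ)) x := by
    intro k x hx
    have h1 := hasFDerivAt_setIntegral_of_continuousOn (μ := μ) hO hK (hcont k)
      (G' := fun x y => fderiv ℝ (iteratedFDeriv ℝ k (fun x => H x y)) x) (by
        refine ((continuousMultilinearCurryLeftEquiv ℝ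
          (fun _ : Fin (k + 1) => E) F).continuous.comp_continuousOn (hcont (k + 1))).congr ?_
        rintro ⟨x, y⟩ _
        exact hder k x y)
      (fun x hx y hy => ((contDiffAt_slice hO hY' hH hx (hKY hy)).differentiableAt_iteratedFDeriv
        (by exact_mod_cast WithTop.coe_lt_top k)).hasFDerivAt) hx
    simp only [hder] at h1
    have h2 := integral_linearIsometryEquiv_comp (B := E →L[ℝ] E [×k]→L[ℝ] F)
      (μ := μ.restrict K) (continuousMultilinearCurryLeftEquiv ℝ (fun _ : Fin (k + 1) => E) F)
      fun y => iteratedFDeriv ℝ (k + 1) (fun x => H x y) x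
    exact h1.congr_fderiv h2
  -- The integrated derivatives form a Taylor series of the integral; smoothness and the formula for
  -- the derivatives both follow from this.
  have hT : HasFTaylorSeriesUpToOn ∞ (fun x => ∫ y in K, H x y ∂μ)
      (fun x k => ∫ y in K, iteratedFDeriv ℝ k (fun x => H x y) x ∂μ) O := by
    refine ⟨fun x hx => ?_, fun k _ x hx => (hp k x hx).hasFDerivWithinAt,
      fun k _ x hx => (hp k x hx).continuousAt.continuousWithinAt⟩
    have h2 := integral_linearIsometryEquiv_comp (B := F) (μ := μ.restrict K)
      (continuousMultilinearCurryFin0 ℝ E F) fun y => iteratedFDeriv ℝ 0 (fun x => H x y) x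
    refine Eq.trans h2.symm ?_
    simp
  refine ⟨fun x hx => hT.contDiffOn x hx, fun k x hx => ?_⟩
  rw [← iteratedFDerivWithin_of_isOpen k hO hx]
  exact (hT.eq_iteratedFDerivWithin_of_uniqueDiffOn (by exact_mod_cast le_top)
    hO.uniqueDiffOn hx).symm

end ParametricIntegral

/-! ### From uniform convergence and uniform Gevrey bounds to Gevrey convergence -/

section Interpolation

variable {E F : Type*} [NormedAddCommGroup E] [NormedSpace ℝ E] [FiniteDimensional ℝ E]
  [NormedAddCommGroup F] [NormedSpace ℝ F]

theorem norm_curryLeftEquiv_symm_sub (k : ℕ) (a b : E →L[ℝ] E [×k]→L[ℝ] F) :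
    ‖(continuousMultilinearCurryLeftEquiv ℝ (fun _ : Fin (k + 1) => E) F).symm a
      - (continuousMultilinearCurryLeftEquiv ℝ (fun _ : Fin (k + 1) => E) F).symm b‖ = ‖a - b‖ := by
  rw [← (continuousMultilinearCurryLeftEquiv ℝ (fun _ : Fin (k + 1) => E) F).symm.norm_map (a - b)]
  rfl

theorem norm_fderiv_iteratedFDeriv_sub {f : E → F} (k : ℕ) (z x : E) :
    ‖fderiv ℝ (iteratedFDeriv ℝ k f) z - fderiv ℝ (iteratedFDeriv ℝ k f) x‖
      = ‖iteratedFDeriv ℝ (k + 1) f z - iteratedFDeriv ℝ (k + 1) f x‖ := by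
  rw [iteratedFDeriv_succ_eq_comp_left, Function.comp_apply, Function.comp_apply,
    norm_curryLeftEquiv_symm_sub]

/-- Interpolation of Landau–Kolmogorov type: over a step of length `ρ` the increment of `H` is at
most `2η`, and it differs from its linear part by at most `Bρ²`; division by `ρ` gives the bound. -/
theorem norm_fderiv_le_of_small {H : E → F} {x : E} {ρ B η : ℝ} (hρ : 0 < ρ)
    (hd : ∀ z ∈ Metric.closedBall x ρ, DifferentiableAt ℝ H z)
    (hB : ∀ z ∈ Metric.closedBall x ρ, ‖fderiv ℝ H z - fderiv ℝ H x‖ ≤ B * ρ)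
    (hη : ∀ z ∈ Metric.closedBall x ρ, ‖H z‖ ≤ η) : ‖fderiv ℝ H x‖ ≤ 2 * η / ρ + B * ρ := by
  have hx : x ∈ Metric.closedBall x ρ := Metric.mem_closedBall_self hρ.le
  have hB0 : 0 ≤ B * ρ := (norm_nonneg _).trans (hB x hx)
  have hη0 : 0 ≤ η := (norm_nonneg _).trans (hη x hx)
  refine ContinuousLinearMap.opNorm_le_of_unit_norm (by positivity) fun v hv => ?_
  have hvρ : ‖ρ • v‖ = ρ := by rw [norm_smul, hv, mul_one, Real.norm_of_nonneg hρ.le]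
  have hz : x + ρ • v ∈ Metric.closedBall x ρ := by simp [hvρ]
  have h2 := (convex_closedBall x ρ).norm_image_sub_le_of_norm_fderiv_le' (𝕜 := ℝ) hd hB hx hz
  rw [add_sub_cancel_left, hvρ] at h2
  have h3 : ‖fderiv ℝ H x (ρ • v)‖ ≤ B * ρ * ρ + 2 * η := by
    have h4 : fderiv ℝ H x (ρ • v)
        = (H (x + ρ • v) - H x) - (H (x + ρ • v) - H x - fderiv ℝ H x (ρ • v)) := by abel
    rw [h4]
    refine (norm_sub_le _ _).trans ?_
    have := (norm_sub_le (H (x + ρ • v)) (H x)).trans (add_le_add (hη _ hz) (hη _ hx))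
    linarith
  rw [map_smul, norm_smul, Real.norm_of_nonneg hρ.le] at h3
  rw [div_add' _ _ _ hρ.ne', le_div_iff₀ hρ]
  linarith

/-- Uniform convergence together with bounds on all derivatives gives convergence of all
derivatives, uniformly on compact sets. -/
theorem eventually_norm_iteratedFDeriv_le {U : Set E} (hU : IsOpen U) {d : ℝ → E → F}
    (hd : ∀ τ : ℝ, 1 ≤ τ → ContDiffOn ℝ ∞ (d τ) U) {B : ℕ → ℝ}
    (hB : ∀ τ : ℝ, 1 ≤ τ → ∀ k : ℕ, ∀ x ∈ U, ‖iteratedFDeriv ℝ k (d τ) x‖ ≤ B k)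
    (h0 : ∀ ε : ℝ, 0 < ε → ∀ᶠ τ : ℝ in atTop, ∀ x ∈ U, ‖d τ x‖ ≤ ε) (k : ℕ) :
    ∀ K ⊆ U, IsCompact K → ∀ ε : ℝ, 0 < ε →
      ∀ᶠ τ : ℝ in atTop, ∀ x ∈ K, ‖iteratedFDeriv ℝ k (d τ) x‖ ≤ ε := by
  induction k with
  | zero =>
    intro K hKU hK ε hε
    filter_upwards [h0 ε hε] with τ hτ x hx
    simpa using hτ x (hKU hx)
  | succ k ih =>
    intro K hKU hK ε hε
    obtain ⟨r, hr, hrU⟩ := hK.exists_cthickening_subset_open hU hKU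
    have hK' : IsCompact (Metric.cthickening r K) := hK.cthickening
    set b := |B (k + 2)| + 1
    -- With `b` bounding the derivative of order `k + 2`, this `ρ` gives `bρ ≤ ε/2`. The induction
    -- hypothesis is then used with `ερ/4`, which makes the other term `2η/ρ` equal to `ε/2`.
    set ρ := min r (ε / (2 * b)) with hρ
    have hb : 0 < b := by positivity
    have hρ0 : 0 < ρ := by positivity
    filter_upwards [ih _ hrU hK' (ε * ρ / 4) (by positivity), eventually_ge_atTop 1] with τ hτ hτ1 x
      hx
    have hsub : Metric.closedBall x ρ ⊆ Metric.cthickening r K :=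
      (Metric.closedBall_subset_closedBall (min_le_left _ _)).trans
        (Metric.closedBall_subset_cthickening hx r)
    have hs : ∀ z ∈ Metric.closedBall x ρ, ContDiffAt ℝ ∞ (d τ) z := fun z hz =>
      (hd τ hτ1).contDiffAt (hU.mem_nhds (hrU (hsub hz)))
    rw [← norm_fderiv_iteratedFDeriv]
    refine (norm_fderiv_le_of_small (B := b) (η := ε * ρ / 4) hρ0 (fun z hz => ?_) (fun z hz => ?_)
      fun z hz => hτ z (hsub hz)).trans ?_
    · exact (hs z hz).differentiableAt_iteratedFDeriv (by exact_mod_cast WithTop.coe_lt_top k)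
    · have h1 : ‖fderiv ℝ (iteratedFDeriv ℝ k (d τ)) z - fderiv ℝ (iteratedFDeriv ℝ k (d τ)) x‖
          = ‖iteratedFDeriv ℝ (k + 1) (d τ) z - iteratedFDeriv ℝ (k + 1) (d τ) x‖ := by
        exact norm_fderiv_iteratedFDeriv_sub k _ _
      rw [h1]
      refine ((convex_closedBall x ρ).norm_image_sub_le_of_norm_fderiv_le (𝕜 := ℝ) (C := b)
        (fun w hw => (hs w hw).differentiableAt_iteratedFDeriv
          (by exact_mod_cast WithTop.coe_lt_top (k + 1)))
        (fun w hw => ?_) (Metric.mem_closedBall_self hρ0.le) hz).trans ?_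
      · rw [norm_fderiv_iteratedFDeriv]
        exact (hB τ hτ1 _ _ (hrU (hsub hw))).trans ((le_abs_self _).trans (by simp [b]))
      · rw [← dist_eq_norm]
        exact mul_le_mul_of_nonneg_left hz hb.le
    · have h1 : 2 * (ε * ρ / 4) / ρ = ε / 2 := by field_simp; norm_num
      have h2 : b * ρ ≤ ε / 2 := by
        calc b * ρ ≤ b * (ε / (2 * b)) := mul_le_mul_of_nonneg_left (min_le_right _ _) hb.le
          _ = ε / 2 := by field_simp
      linarith

/-- If all differences are bounded in the `h`-Gevrey norm by `C`, then in the `2h`-norm the order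
`k` gains a factor `2^{-k}`. Orders beyond some `N` are thus below `ε` for every `τ ≥ 1`, and the
finitely many remaining orders converge by interpolation. -/
theorem gevreyTendsto_of_uniform_bound {s : ℝ} {U : Set E} (hU : IsOpen U)
    {g : ℝ → E → F} {f : E → F} (hg : ∀ τ : ℝ, 0 < τ → IsGevreyOn s (g τ) U)
    (hf : IsGevreyUpToClosure s f U)
    (hb : ∃ C h : ℝ, 0 < C ∧ 0 < h ∧ ∀ τ : ℝ, 1 ≤ τ → ∀ x ∈ U, GevreyAt s C h (g τ) x)
    (h0 : ∀ ε : ℝ, 0 < ε → ∀ᶠ τ : ℝ in atTop, ∀ x ∈ U, ‖g τ x - f x‖ ≤ ε) :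
    GevreyTendsto s g f U := by
  obtain ⟨hfd, h₁, hh₁, C₁, hf1⟩ := id hf
  obtain ⟨C₂, h₂, hC₂, hh₂, hg2⟩ := hb
  refine ⟨hg, ⟨hfd, fun K hKU _ => ⟨h₁, hh₁, C₁, fun k x hx => hf1 k x (hKU hx)⟩⟩,
    fun K hKU hK => ?_⟩
  set h := max h₁ h₂ with hh
  have hh0 : 0 < h := by positivity
  set C := |C₁| + C₂ with hC
  have hC0 : 0 < C := by positivity
  have hsub : ∀ τ : ℝ, 1 ≤ τ → ∀ k : ℕ, ∀ x ∈ U, iteratedFDeriv ℝ k (fun x => g τ x - f x) x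
      = iteratedFDeriv ℝ k (g τ) x - iteratedFDeriv ℝ k f x := fun τ hτ k x hx =>
    fun_iteratedFDeriv_sub_apply ((hg2 τ hτ x hx).1.of_le (by exact_mod_cast le_top))
      ((hfd.contDiffAt (hU.mem_nhds hx)).of_le (by exact_mod_cast le_top))
  have hbd : ∀ τ : ℝ, 1 ≤ τ → ∀ k : ℕ, ∀ x ∈ U,
      ‖iteratedFDeriv ℝ k (fun x => g τ x - f x) x‖ ≤ C * h ^ k * (k.factorial : ℝ) ^ s := by
    intro τ hτ k x hx
    rw [hsub τ hτ k x hx]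
    refine (norm_sub_le _ _).trans ?_
    have e1 : ‖iteratedFDeriv ℝ k (g τ) x‖ ≤ C₂ * h ^ k * (k.factorial : ℝ) ^ s :=
      ((hg2 τ hτ x hx).2 k).trans (by gcongr; exact le_max_right _ _)
    have e2 : ‖iteratedFDeriv ℝ k f x‖ ≤ |C₁| * h ^ k * (k.factorial : ℝ) ^ s :=
      (hf1 k x hx).trans (by
        gcongr
        · exact le_abs_self _
        · exact le_max_left _ _)
    rw [hC, add_mul, add_mul]
    linarith
  have hcv := eventually_norm_iteratedFDeriv_le hU (d := fun τ x => g τ x - f x)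
    (fun τ hτ => (hg τ (by linarith)).1.sub hfd) hbd h0
  refine ⟨2 * h, by positivity, fun ε hε => ?_⟩
  obtain ⟨N, hN⟩ := exists_pow_lt_of_lt_one (div_pos hε hC0) (by norm_num : (1 / 2 : ℝ) < 1)
  have hfin : ∀ᶠ τ : ℝ in atTop, ∀ k ∈ Finset.range N, ∀ x ∈ K,
      ‖iteratedFDeriv ℝ k (fun x => g τ x - f x) x‖
        ≤ ε * (2 * h) ^ k * (k.factorial : ℝ) ^ s := by
    rw [Filter.eventually_all_finset]
    exact fun k _ => hcv k K hKU hK _ (by positivity)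
  filter_upwards [hfin, eventually_ge_atTop 1] with τ hτ hτ1 k x hx
  rw [← hsub τ hτ1 k x (hKU hx)]
  rcases lt_or_ge k N with hk | hk
  · exact hτ k (Finset.mem_range.mpr hk) x hx
  · refine (hbd τ hτ1 k x (hKU hx)).trans ?_
    have e1 : C ≤ ε * 2 ^ k := by
      have e2 : (1 / 2 : ℝ) ^ k ≤ ε / C :=
        (pow_le_pow_of_le_one (by norm_num) (by norm_num) hk).trans hN.le
      rw [one_div, inv_pow, le_div_iff₀ hC0, inv_mul_le_iff₀ (by positivity)] at e2
      linarith
    rw [mul_pow, ← mul_assoc]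
    gcongr

end Interpolation

/-! ### Derivatives of determinants and adjugates -/

section MatrixCalculus

variable {W : Type*} [NormedAddCommGroup W] [NormedSpace ℝ W] {m : ℕ}

/-- Jacobi's formula: the determinant is multilinear in the rows, and the determinant with row `a`
replaced is a Cramer expression in the adjugate. -/
theorem hasFDerivAt_det {A : W → Matrix (Fin m) (Fin m) ℂ} {w : W}
    (hA : ∀ k l, DifferentiableAt ℝ (fun w => A w k l) w) :
    DifferentiableAt ℝ (fun w => (A w).det) w ∧ ∀ v, fderiv ℝ (fun w => (A w).det) w v
      = ∑ b, ∑ a, (A w).adjugate b a * fderiv ℝ (fun w => A w a b) w v := by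
  let D : ContinuousMultilinearMap ℂ (fun _ : Fin m => Fin m → ℂ) ℂ :=
    ⟨(Matrix.detRowAlternating (R := ℂ) (n := Fin m)).toMultilinearMap,
      Continuous.matrix_det (A := fun A : Matrix (Fin m) (Fin m) ℂ => A) continuous_id⟩
  have h1 : HasFDerivAt (fun w => (fun k l => A w k l : Fin m → Fin m → ℂ))
      (ContinuousLinearMap.pi fun k => ContinuousLinearMap.pi fun l =>
        fderiv ℝ (fun w => A w k l) w) w :=
    hasFDerivAt_pi.mpr fun k => hasFDerivAt_pi.mpr fun l => (hA k l).hasFDerivAt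
  have h2 := ((D.hasFDerivAt (fun k l => A w k l)).restrictScalars ℝ).comp w h1
  have h3 : (fun w => (A w).det) = D ∘ fun w => (fun k l => A w k l : Fin m → Fin m → ℂ) := rfl
  rw [h3]
  refine ⟨h2.differentiableAt, fun v => ?_⟩
  rw [h2.fderiv, Finset.sum_comm]
  simp only [ContinuousLinearMap.coe_comp, Function.comp_apply,
    ContinuousLinearMap.coe_restrictScalars', ContinuousMultilinearMap.linearDeriv_apply]
  refine Finset.sum_congr rfl fun a _ => ?_
  have h4 : D (Function.update (fun k l => A w k l) a
      ((ContinuousLinearMap.pi fun k => ContinuousLinearMap.pi fun l =>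
        fderiv ℝ (fun w => A w k l) w) v a))
      = ((A w).updateRow a fun l => fderiv ℝ (fun w => A w a l) w v).det := rfl
  rw [h4, ← Matrix.cramer_transpose_apply, Matrix.cramer_eq_adjugate_mulVec, Matrix.mulVec,
    dotProduct]
  exact Finset.sum_congr rfl fun b _ => by rw [← Matrix.adjugate_transpose]; rfl

theorem contDiffAt_det {A : W → Matrix (Fin m) (Fin m) ℂ} {w : W} {N : ℕ∞ω}
    (hA : ∀ k l, ContDiffAt ℝ N (fun w => A w k l) w) :
    ContDiffAt ℝ N (fun w => (A w).det) w := by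
  simp only [Matrix.det_apply']
  exact ContDiffAt.sum fun σ _ => contDiffAt_const.mul (contDiffAt_prod fun k _ => hA _ _)

theorem contDiffAt_adjugate {A : W → Matrix (Fin m) (Fin m) ℂ} {w : W} {N : ℕ∞ω}
    (hA : ∀ k l, ContDiffAt ℝ N (fun w => A w k l) w) (a b : Fin m) :
    ContDiffAt ℝ N (fun w => (A w).adjugate a b) w := by
  simp only [Matrix.adjugate_apply]
  refine contDiffAt_det fun k l => ?_
  by_cases h : k = b
  · subst h
    simpa only [Matrix.updateRow_self] using contDiffAt_const
  · simpa only [Matrix.updateRow_ne h] using hA k l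

theorem contDiffOn_union_of_eq_zero {G : Type*} [NormedAddCommGroup G] [NormedSpace ℝ G]
    {S₁ S₂ : Set W} (h1 : IsOpen S₁) (h2 : IsOpen S₂) {f : W → G} (hf : ContDiffOn ℝ ∞ f S₁)
    (h0 : ∀ x ∈ S₂, f x = 0) : ContDiffOn ℝ ∞ f (S₁ ∪ S₂) := by
  rintro x (hx | hx)
  · exact (hf.contDiffAt (h1.mem_nhds hx)).contDiffWithinAt
  · have : f =ᶠ[nhds x] fun _ => 0 := by
      filter_upwards [h2.mem_nhds hx] with y hy using h0 y hy
    exact (contDiffAt_const.congr_of_eventuallyEq this).contDiffWithinAt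

end MatrixCalculus

/-! ### Stokes' formula for integrals of holomorphic functions of a complex frame -/

section Stokes

variable {P : Type*} [NormedAddCommGroup P] [NormedSpace ℝ P] {m : ℕ}

/-- The Jacobian matrix of `ζ` in the first variable. -/
def jac (ζ : EuclideanSpace ℝ (Fin m) × P → Fin m → ℂ) (w : EuclideanSpace ℝ (Fin m) × P) :
    Matrix (Fin m) (Fin m) ℂ :=
  Matrix.of fun k l => fderiv ℝ (fun w' => ζ w' k) w (EuclideanSpace.single l 1, 0)

/-- The coefficients of the lift of the direction `e` which is annihilated by `ζ`. -/
def liftCoeff (ζ : EuclideanSpace ℝ (Fin m) × P → Fin m → ℂ) (e : P)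
    (w : EuclideanSpace ℝ (Fin m) × P) : Fin m → ℂ :=
  (jac ζ w)⁻¹.mulVec fun k => fderiv ℝ (fun w' => ζ w' k) w (0, e)

/-- The derivative of `g` along the lift of `e` annihilating `ζ`. -/
def liftDeriv (ζ : EuclideanSpace ℝ (Fin m) × P → Fin m → ℂ) (e : P)
    (g : EuclideanSpace ℝ (Fin m) × P → ℂ) (w : EuclideanSpace ℝ (Fin m) × P) : ℂ :=
  fderiv ℝ g w (0, e) - ∑ k, liftCoeff ζ e w k * fderiv ℝ g w (EuclideanSpace.single k 1, 0)

variable {ζ : EuclideanSpace ℝ (Fin m) × P → Fin m → ℂ} {w : EuclideanSpace ℝ (Fin m) × P} {e : P}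

theorem contDiffAt_jac (hζ : ∀ k, ContDiffAt ℝ ∞ (fun w => ζ w k) w) (k l : Fin m) :
    ContDiffAt ℝ ∞ (fun w => jac ζ w k l) w :=
  ((hζ k).fderiv_right (m := ∞) (by simp)).clm_apply contDiffAt_const

theorem jac_mulVec_liftCoeff (hJ : (jac ζ w).det ≠ 0) (a : Fin m) :
    ∑ k, jac ζ w a k * liftCoeff ζ e w k = fderiv ℝ (fun w' => ζ w' a) w (0, e) := by
  have h : (jac ζ w).mulVec (liftCoeff ζ e w) = fun k => fderiv ℝ (fun w' => ζ w' k) w (0, e) := by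
    rw [liftCoeff, Matrix.mulVec_mulVec, Matrix.mul_nonsing_inv _ (isUnit_iff_ne_zero.mpr hJ),
      Matrix.one_mulVec]
  exact congrFun h a

theorem det_mul_liftCoeff (hJ : (jac ζ w).det ≠ 0) (k : Fin m) :
    (jac ζ w).det * liftCoeff ζ e w k
      = ∑ a, (jac ζ w).adjugate k a * fderiv ℝ (fun w' => ζ w' a) w (0, e) := by
  rw [liftCoeff, Matrix.inv_def, Ring.inverse_eq_inv', Matrix.smul_mulVec, Pi.smul_apply,
    smul_eq_mul, mul_inv_cancel_left₀ hJ]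
  rfl

theorem contDiffAt_liftCoeff (hζ : ∀ k, ContDiffAt ℝ ∞ (fun w => ζ w k) w)
    (hJ : (jac ζ w).det ≠ 0) (k : Fin m) : ContDiffAt ℝ ∞ (fun w => liftCoeff ζ e w k) w := by
  have hdet := contDiffAt_det (contDiffAt_jac hζ)
  have h1 : (fun w => liftCoeff ζ e w k) = fun w => ((jac ζ w).det)⁻¹ *
      ∑ a, (jac ζ w).adjugate k a * fderiv ℝ (fun w' => ζ w' a) w (0, e) := by
    ext w
    rw [liftCoeff, Matrix.inv_def, Ring.inverse_eq_inv', Matrix.smul_mulVec, Pi.smul_apply,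
      smul_eq_mul]
    rfl
  rw [h1]
  exact (hdet.inv hJ).mul (ContDiffAt.sum fun a _ =>
    (contDiffAt_adjugate (contDiffAt_jac hζ) k a).mul
      (((hζ a).fderiv_right (m := ∞) (by simp)).clm_apply contDiffAt_const))

theorem fderiv_holomorphic_comp {W : Type*} [NormedAddCommGroup W] [NormedSpace ℝ W]
    {ζ : W → Fin m → ℂ} {w : W} {F : (Fin m → ℂ) → ℂ} (hF : DifferentiableAt ℂ F (ζ w))
    (hζ : ∀ k, DifferentiableAt ℝ (fun w => ζ w k) w) :
    DifferentiableAt ℝ (fun w => F (ζ w)) w ∧ ∀ v, fderiv ℝ (fun w => F (ζ w)) w v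
      = ∑ l, fderiv ℂ F (ζ w) (Pi.single l 1) * fderiv ℝ (fun w => ζ w l) w v := by
  have h1 : HasFDerivAt ζ (ContinuousLinearMap.pi fun l => fderiv ℝ (fun w => ζ w l) w) w :=
    hasFDerivAt_pi.mpr fun l => (hζ l).hasFDerivAt
  have h2 := (hF.hasFDerivAt.restrictScalars ℝ).comp w h1
  refine ⟨h2.differentiableAt, fun v => ?_⟩
  have h3 : fderiv ℝ (fun w => F (ζ w)) w = _ := h2.fderiv
  rw [h3]
  simp only [ContinuousLinearMap.coe_comp, Function.comp_apply,
    ContinuousLinearMap.coe_restrictScalars']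
  rw [pi_eq_sum_univ' ((ContinuousLinearMap.pi fun l => fderiv ℝ (fun w => ζ w l) w) v), map_sum]
  refine Finset.sum_congr rfl fun l _ => ?_
  rw [map_smul, smul_eq_mul, mul_comm]
  rfl

/-- With `M` the lift coefficients, `J = jac ζ` and `L = ∂_e - ∑ M_k ∂_k`: `L(F ∘ ζ) = 0`, because
`F` is holomorphic and `L ζ = 0`; and `L(det J) = det J · div M`, by Jacobi's formula and the
symmetry of second derivatives. In the product rule for `F(ζ) ψ det J` the term with `div M` cancels
and only `L ψ` survives. Behind it is the vanishing of `d(F(ζ)) ∧ dζ₁ ∧ ⋯ ∧ dζ_m`. -/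
theorem divergence_identity {F : (Fin m → ℂ) → ℂ} {ψ : EuclideanSpace ℝ (Fin m) × P → ℂ}
    (hζ : ∀ k, ContDiffAt ℝ ∞ (fun w => ζ w k) w) (hJ : (jac ζ w).det ≠ 0)
    (hF : DifferentiableAt ℂ F (ζ w)) (hψ : DifferentiableAt ℝ ψ w) :
    fderiv ℝ (fun w => F (ζ w) * ψ w * (jac ζ w).det) w (0, e)
      - ∑ k, fderiv ℝ (fun w => F (ζ w) * ψ w * (jac ζ w).det * liftCoeff ζ e w k) w
        (EuclideanSpace.single k 1, 0)
      = F (ζ w) * (jac ζ w).det * liftDeriv ζ e ψ w := by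
  have hζ1 : ∀ k, DifferentiableAt ℝ (fun w => ζ w k) w := fun k =>
    (hζ k).differentiableAt (by simp)
  have hJ1 : ∀ k l, DifferentiableAt ℝ (fun w => jac ζ w k l) w := fun k l =>
    (contDiffAt_jac hζ k l).differentiableAt (by simp)
  have hM : ∀ k, DifferentiableAt ℝ (fun w => liftCoeff ζ e w k) w := fun k =>
    (contDiffAt_liftCoeff hζ hJ k).differentiableAt (by simp)
  obtain ⟨hFd, hFv⟩ := fderiv_holomorphic_comp hF hζ1
  obtain ⟨hDd, hDv⟩ := hasFDerivAt_det hJ1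
  set E : Fin m → EuclideanSpace ℝ (Fin m) × P := fun k => (EuclideanSpace.single k 1, 0) with hE
  set M := liftCoeff ζ e w with hMdef
  -- the first order relation for `F ∘ ζ`
  have h1 : fderiv ℝ (fun w => F (ζ w)) w (0, e)
      = ∑ k, M k * fderiv ℝ (fun w => F (ζ w)) w (E k) := by
    simp only [hFv, Finset.mul_sum]
    rw [Finset.sum_comm]
    refine Finset.sum_congr rfl fun l _ => ?_
    rw [← jac_mulVec_liftCoeff hJ l, Finset.mul_sum]
    refine Finset.sum_congr rfl fun k _ => ?_
    simp only [jac, Matrix.of_apply, hE, hMdef]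
    ring
  have hsymm : ∀ a (u v : EuclideanSpace ℝ (Fin m) × P),
      fderiv ℝ (fun w => fderiv ℝ (fun w' => ζ w' a) w u) w v
        = fderiv ℝ (fun w => fderiv ℝ (fun w' => ζ w' a) w v) w u := by
    intro a u v
    have hd : DifferentiableAt ℝ (fderiv ℝ (fun w' => ζ w' a)) w :=
      ((hζ a).fderiv_right (m := ∞) (by simp)).differentiableAt (by simp)
    have hs := ((hζ a).isSymmSndFDerivAt
      (by simpa using WithTop.coe_le_coe.mpr (le_top : (2 : ℕ∞) ≤ ⊤))).eq v u
    rw [fderiv_clm_apply hd (differentiableAt_const u),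
      fderiv_clm_apply hd (differentiableAt_const v)]
    simpa using hs
  -- The relation `J M = ∂_e ζ` holds near `w` and may be differentiated in `x_b`; second
  -- derivatives of `ζ` are then interchanged.
  have h2 : ∀ a b, fderiv ℝ (fun w => jac ζ w a b) w (0, e)
      = ∑ k, (M k * fderiv ℝ (fun w => jac ζ w a b) w (E k)
        + jac ζ w a k * fderiv ℝ (fun w => liftCoeff ζ e w k) w (E b)) := by
    intro a b
    have hev : (fun w => ∑ k, jac ζ w a k * liftCoeff ζ e w k)
        =ᶠ[nhds w] fun w => fderiv ℝ (fun w' => ζ w' a) w (0, e) := by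
      filter_upwards [hDd.continuousAt.eventually_ne hJ] with w' hw'
      exact jac_mulVec_liftCoeff hw' a
    have h3 : fderiv ℝ (fun w => jac ζ w a b) w (0, e)
        = fderiv ℝ (fun w => fderiv ℝ (fun w' => ζ w' a) w (0, e)) w (E b) := hsymm a (E b) (0, e)
    rw [h3, ← hev.fderiv_eq, fderiv_fun_sum fun k _ => (hJ1 a k).fun_mul (hM k),
      sum_apply]
    refine Finset.sum_congr rfl fun k _ => ?_
    have h4 : fderiv ℝ (fun w => jac ζ w a k) w (E b) = fderiv ℝ (fun w => jac ζ w a b) w (E k) :=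
      hsymm a (E k) (E b)
    rw [fderiv_fun_mul (hJ1 a k) (hM k)]
    simp only [add_apply, smul_apply, smul_eq_mul]
    rw [h4, ← hMdef]
    ring
  have h3 : fderiv ℝ (fun w => (jac ζ w).det) w (0, e)
      = ∑ k, (M k * fderiv ℝ (fun w => (jac ζ w).det) w (E k)
        + (jac ζ w).det * fderiv ℝ (fun w => liftCoeff ζ e w k) w (E k)) := by
    have hadj : ∀ b k, ∑ a, (jac ζ w).adjugate b a * jac ζ w a k
        = if b = k then (jac ζ w).det else 0 := by
      intro b k
      have := congrFun (congrFun (Matrix.adjugate_mul (jac ζ w)) b) k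
      rw [Matrix.mul_apply] at this
      rw [this, Matrix.smul_apply, Matrix.one_apply]
      simp
    simp only [hDv, h2, Finset.mul_sum, mul_add, Finset.sum_add_distrib]
    congr 1
    · have h5 : ∀ b : Fin m, (∑ a, ∑ k, (jac ζ w).adjugate b a
          * (M k * fderiv ℝ (fun w => jac ζ w a b) w (E k)))
          = ∑ k, ∑ a, M k * ((jac ζ w).adjugate b a * fderiv ℝ (fun w => jac ζ w a b) w (E k)) := by
        intro b
        rw [Finset.sum_comm]
        exact Finset.sum_congr rfl fun _ _ => Finset.sum_congr rfl fun _ _ => by ring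
      simp only [h5]
      rw [Finset.sum_comm]
    · refine Finset.sum_congr rfl fun b _ => ?_
      rw [Finset.sum_comm]
      have h5 : ∀ k, ∑ a, (jac ζ w).adjugate b a
          * (jac ζ w a k * fderiv ℝ (fun w => liftCoeff ζ e w k) w (E b))
          = (if b = k then (jac ζ w).det else 0)
            * fderiv ℝ (fun w => liftCoeff ζ e w k) w (E b) := by
        intro k
        rw [← hadj, Finset.sum_mul]
        exact Finset.sum_congr rfl fun _ _ => by ring
      simp [h5]
  have hFψ := hFd.fun_mul hψ
  have hFψD := hFψ.fun_mul hDd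
  have e1 : ∀ v, fderiv ℝ (fun w => F (ζ w) * ψ w * (jac ζ w).det) w v
      = fderiv ℝ (fun w => F (ζ w)) w v * (ψ w * (jac ζ w).det)
        + fderiv ℝ ψ w v * (F (ζ w) * (jac ζ w).det)
        + fderiv ℝ (fun w => (jac ζ w).det) w v * (F (ζ w) * ψ w) := by
    intro v
    rw [fderiv_fun_mul hFψ hDd, fderiv_fun_mul hFd hψ]
    simp only [add_apply, smul_apply, smul_eq_mul]
    ring
  have e2 : ∀ k, fderiv ℝ (fun w => F (ζ w) * ψ w * (jac ζ w).det * liftCoeff ζ e w k) w (E k)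
      = M k * fderiv ℝ (fun w => F (ζ w) * ψ w * (jac ζ w).det) w (E k)
        + F (ζ w) * ψ w * (jac ζ w).det * fderiv ℝ (fun w => liftCoeff ζ e w k) w (E k) := by
    intro k
    rw [fderiv_fun_mul hFψD (hM k)]
    simp only [add_apply, smul_apply, smul_eq_mul]
    ring
  have e3 : liftDeriv ζ e ψ w = fderiv ℝ ψ w (0, e) - ∑ k, M k * fderiv ℝ ψ w (E k) := rfl
  have e4 : ∑ k, (M k * fderiv ℝ (fun w => F (ζ w) * ψ w * (jac ζ w).det) w (E k)
        + F (ζ w) * ψ w * (jac ζ w).det * fderiv ℝ (fun w => liftCoeff ζ e w k) w (E k))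
      = (∑ k, M k * fderiv ℝ (fun w => F (ζ w)) w (E k)) * (ψ w * (jac ζ w).det)
        + (∑ k, M k * fderiv ℝ ψ w (E k)) * (F (ζ w) * (jac ζ w).det)
        + (∑ k, (M k * fderiv ℝ (fun w => (jac ζ w).det) w (E k)
          + (jac ζ w).det * fderiv ℝ (fun w => liftCoeff ζ e w k) w (E k))) * (F (ζ w) * ψ w) := by
    rw [Finset.sum_mul, Finset.sum_mul, Finset.sum_mul, ← Finset.sum_add_distrib,
      ← Finset.sum_add_distrib]
    refine Finset.sum_congr rfl fun k _ => ?_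
    rw [e1]
    ring
  rw [Finset.sum_congr rfl fun k _ => e2 k, e4, e3, e1, h1, h3]
  ring

theorem contDiff_of_eq_zero_off {G H : Type*} [NormedAddCommGroup G] [NormedSpace ℝ G]
    [NormedAddCommGroup H] [NormedSpace ℝ H] {K B : Set G} (hK : IsClosed K) (hB : IsOpen B)
    (hKB : K ⊆ B) {g : G → H} (hg : ContDiffOn ℝ ∞ g B) (h0 : ∀ x ∉ K, g x = 0) :
    ContDiff ℝ ∞ g := by
  have h := contDiffOn_union_of_eq_zero hB hK.isOpen_compl hg h0
  have hu : B ∪ Kᶜ = univ := by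
    rw [eq_univ_iff_forall]
    intro x
    by_cases hx : x ∈ K
    · exact Or.inl (hKB hx)
    · exact Or.inr hx
  rwa [hu, contDiffOn_univ] at h

/-- The function is smooth on the whole space with support in `K`, so it can be integrated by parts
against the constant `1`. -/
theorem setIntegral_fderiv_eq_zero {G : Type*} [NormedAddCommGroup G] [NormedSpace ℝ G]
    [FiniteDimensional ℝ G] [MeasurableSpace G] [BorelSpace G] {μ : Measure G} [μ.IsAddHaarMeasure]
    {K B : Set G} (hK : IsCompact K) (hB : IsOpen B) (hKB : K ⊆ B) {g : G → ℂ}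
    (hg : ContDiffOn ℝ ∞ g B) (h0 : ∀ x ∉ K, g x = 0) (v : G) :
    ∫ x in K, fderiv ℝ g x v ∂μ = 0 := by
  have hs := contDiff_of_eq_zero_off hK.isClosed hB hKB hg h0
  have hd0 : ∀ x ∉ K, fderiv ℝ g x v = 0 := by
    intro x hx
    have : g =ᶠ[nhds x] fun _ => 0 := by
      filter_upwards [hK.isClosed.isOpen_compl.mem_nhds hx] with y hy using h0 y hy
    rw [this.fderiv_eq]
    simp
  rw [setIntegral_eq_integral_of_forall_compl_eq_zero hd0]
  have hdc : Continuous fun x => fderiv ℝ g x v :=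
    (hs.continuous_fderiv (by simp)).clm_apply continuous_const
  have h1 := integral_mul_fderiv_eq_neg_fderiv_mul_of_integrable (μ := μ) (f := fun _ : G => (1 : ℂ))
    (g := g) (v := v) (by simp)
    (by simpa using hdc.integrable_of_hasCompactSupport (HasCompactSupport.intro hK hd0))
    (by simpa using hs.continuous.integrable_of_hasCompactSupport (HasCompactSupport.intro hK h0))
    (fun x _ => differentiableAt_const _) (fun x _ => hs.differentiable (by simp) x)
  simpa using h1

/-- Differentiation of `∫ F(ζ) ψ dζ₁ ∧ ⋯ ∧ dζ_m` with respect to a parameter. -/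
theorem fderiv_setIntegral_holomorphic {O : Set P} {K B : Set (EuclideanSpace ℝ (Fin m))}
    (hO : IsOpen O) (hK : IsCompact K) (hB : IsOpen B) (hKB : K ⊆ B) [FiniteDimensional ℝ P]
    (hζ : ∀ k, ContDiffOn ℝ ∞ (fun w => ζ w k) (B ×ˢ O)) (hJ : ∀ w ∈ B ×ˢ O, (jac ζ w).det ≠ 0)
    {F : (Fin m → ℂ) → ℂ} (hF : ContDiff ℂ ∞ F) {ψ : EuclideanSpace ℝ (Fin m) × P → ℂ}
    (hψ : ContDiffOn ℝ ∞ ψ (B ×ˢ O)) (h0 : ∀ x ∉ K, ∀ p ∈ O, ψ (x, p) = 0) {p : P} (hp : p ∈ O) :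
    HasFDerivAt (fun p => ∫ x in K, F (ζ (x, p)) * ψ (x, p) * (jac ζ (x, p)).det)
        (fderiv ℝ (fun p => ∫ x in K, F (ζ (x, p)) * ψ (x, p) * (jac ζ (x, p)).det) p) p ∧
      fderiv ℝ (fun p => ∫ x in K, F (ζ (x, p)) * ψ (x, p) * (jac ζ (x, p)).det) p e
        = ∫ x in K, F (ζ (x, p)) * (jac ζ (x, p)).det * liftDeriv ζ e ψ (x, p) := by
  have hBO := hB.prod hO
  have hζw : ∀ w ∈ B ×ˢ O, ∀ k, ContDiffAt ℝ ∞ (fun w => ζ w k) w := fun w hw k =>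
    (hζ k).contDiffAt (hBO.mem_nhds hw)
  have hψw : ∀ w ∈ B ×ˢ O, ContDiffAt ℝ ∞ ψ w := fun w hw => hψ.contDiffAt (hBO.mem_nhds hw)
  have hFr : ContDiff ℝ ∞ F := hF.restrict_scalars ℝ
  set Φ : EuclideanSpace ℝ (Fin m) × P → ℂ := fun w => F (ζ w) * ψ w * (jac ζ w).det with hΦdef
  have hΦ : ∀ w ∈ B ×ˢ O, ContDiffAt ℝ ∞ Φ w := fun w hw =>
    ((hFr.contDiffAt.comp w (contDiffAt_pi.mpr (hζw w hw))).mul (hψw w hw)).mul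
      (contDiffAt_det (contDiffAt_jac (hζw w hw)))
  have hsl : ∀ x ∈ B, ∀ q ∈ O, HasFDerivAt (fun p => Φ (x, p))
      ((fderiv ℝ Φ (x, q)).comp (ContinuousLinearMap.inr ℝ _ P)) q := fun x hx q hq =>
    HasFDerivAt.comp (f := fun p => (x, p)) q
      ((hΦ (x, q) ⟨hx, hq⟩).differentiableAt (by simp)).hasFDerivAt (hasFDerivAt_prodMk_right x q)
  have hcont : ContinuousOn (fun w : P × EuclideanSpace ℝ (Fin m) => (w.2, w.1)) (O ×ˢ K) := by
    fun_prop
  have hmaps : MapsTo (fun w : P × EuclideanSpace ℝ (Fin m) => (w.2, w.1)) (O ×ˢ K) (B ×ˢ O) :=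
    fun w hw => ⟨hKB hw.2, hw.1⟩
  have hΦc : ContinuousOn Φ (B ×ˢ O) := fun w hw => (hΦ w hw).continuousAt.continuousWithinAt
  have hΦ'c : ContinuousOn (fderiv ℝ Φ) (B ×ˢ O) := fun w hw =>
    ((hΦ w hw).fderiv_right (m := ∞) (by simp)).continuousAt.continuousWithinAt
  have h1 := hasFDerivAt_setIntegral_of_continuousOn (μ := volume) hO hK
    (G := fun p x => Φ (x, p))
    (G' := fun p x => (fderiv ℝ Φ (x, p)).comp (ContinuousLinearMap.inr ℝ _ P))
    (hΦc.comp hcont hmaps)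
    ((hΦ'c.comp hcont hmaps).clm_comp continuousOn_const)
    (fun q hq x hx => hsl x (hKB hx) q hq) hp
  refine ⟨h1.differentiableAt.hasFDerivAt, ?_⟩
  have hpx : ContinuousOn (fun x : EuclideanSpace ℝ (Fin m) => (x, p)) B := by fun_prop
  have hpm : MapsTo (fun x : EuclideanSpace ℝ (Fin m) => (x, p)) B (B ×ˢ O) := fun x hx => ⟨hx, hp⟩
  have hint : IntegrableOn
      (fun x => (fderiv ℝ Φ (x, p)).comp (ContinuousLinearMap.inr ℝ (EuclideanSpace ℝ (Fin m)) P))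
      K := (((hΦ'c.comp hpx hpm).mono hKB).clm_comp continuousOn_const).integrableOn_compact hK
  rw [h1.fderiv, ContinuousLinearMap.integral_apply hint]
  -- The integrand is the desired one plus an `x`-divergence. The factor `ψ`, which vanishes off
  -- `K`, makes each divergence term integrate to zero.
  have hdiv : ∀ x ∈ K, fderiv ℝ Φ (x, p) (0, e)
      = F (ζ (x, p)) * (jac ζ (x, p)).det * liftDeriv ζ e ψ (x, p)
        + ∑ k, fderiv ℝ (fun w => Φ w * liftCoeff ζ e w k) (x, p)
          (EuclideanSpace.single k 1, 0) := fun x hx => by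
    rw [← divergence_identity (hζw _ ⟨hKB hx, hp⟩) (hJ _ ⟨hKB hx, hp⟩) (hF.differentiable (by simp) _)
      ((hψw _ ⟨hKB hx, hp⟩).differentiableAt (by simp))]
    ring
  have hΦM : ∀ k, ∀ w ∈ B ×ˢ O, ContDiffAt ℝ ∞ (fun w => Φ w * liftCoeff ζ e w k) w :=
    fun k w hw => (hΦ w hw).mul (contDiffAt_liftCoeff (hζw w hw) (hJ w hw) k)
  have hslice : ∀ k, ∀ x ∈ B, fderiv ℝ (fun w => Φ w * liftCoeff ζ e w k) (x, p)
      (EuclideanSpace.single k 1, 0)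
      = fderiv ℝ (fun x => Φ (x, p) * liftCoeff ζ e (x, p) k) x (EuclideanSpace.single k 1) := by
    intro k x hx
    have := HasFDerivAt.comp (f := fun x => (x, p)) x
      ((hΦM k (x, p) ⟨hx, hp⟩).differentiableAt (by simp)).hasFDerivAt (hasFDerivAt_prodMk_left x p)
    have h2 : fderiv ℝ (fun x => Φ (x, p) * liftCoeff ζ e (x, p) k) x = _ := this.fderiv
    rw [h2]
    rfl
  have hzero : ∀ k, ∫ x in K, fderiv ℝ (fun w => Φ w * liftCoeff ζ e w k) (x, p)
      (EuclideanSpace.single k 1, 0) = 0 := by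
    intro k
    rw [setIntegral_congr_fun hK.measurableSet fun x hx => hslice k x (hKB hx)]
    refine setIntegral_fderiv_eq_zero hK hB hKB (fun x hx => ?_) (fun x hx => ?_) _
    · exact ((hΦM k (x, p) ⟨hx, hp⟩).comp x
        (contDiffAt_id.prodMk contDiffAt_const)).contDiffWithinAt
    · simp [hΦdef, h0 x hx p hp]
  have hdM : ∀ k, IntegrableOn (fun x => fderiv ℝ (fun w => Φ w * liftCoeff ζ e w k) (x, p)
      (EuclideanSpace.single k 1, 0)) K := by
    intro k
    refine ContinuousOn.integrableOn_compact hK fun x hx => ?_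
    have h3 := ((hΦM k (x, p) ⟨hKB hx, hp⟩).fderiv_right (m := ∞) (by simp)).continuousAt
    have h4 : ContinuousAt (fun x => fderiv ℝ (fun w => Φ w * liftCoeff ζ e w k) (x, p)) x :=
      h3.comp (f := fun x => (x, p)) (by fun_prop)
    exact (h4.clm_apply continuousAt_const).continuousWithinAt
  have hL : IntegrableOn
      (fun x => F (ζ (x, p)) * (jac ζ (x, p)).det * liftDeriv ζ e ψ (x, p)) K := by
    have h5 : IntegrableOn (fun x => fderiv ℝ Φ (x, p) (0, e)) K :=
      (((hΦ'c.comp hpx hpm).mono hKB).clm_apply continuousOn_const).integrableOn_compact hK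
    refine (h5.sub (integrable_finsetSum Finset.univ fun k _ => hdM k)).congr ?_
    filter_upwards [ae_restrict_mem hK.measurableSet] with x hx
    simp [hdiv x hx]
  have h6 : ∀ x ∈ K, ((fderiv ℝ Φ (x, p)).comp
      (ContinuousLinearMap.inr ℝ (EuclideanSpace ℝ (Fin m)) P)) e = _ := hdiv
  rw [setIntegral_congr_fun hK.measurableSet h6, integral_add hL
    (integrable_finsetSum _ fun k _ => hdM k), integral_finsetSum _ fun k _ => hdM k]
  simp [hzero]

end Stokes

/-! ### Boxes and the real part of the phase -/

section Box

variable {m n : ℕ} {R : ℝ}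

theorem isOpen_box (R T : ℝ) : IsOpen (box m n R T) := Metric.isOpen_ball.prod Metric.isOpen_ball

theorem convex_box (R T : ℝ) : Convex ℝ (box m n R T) := (convex_ball _ _).prod (convex_ball _ _)

theorem closure_box (hR : 0 < R) :
    closure (box m n R R) = Metric.closedBall 0 R ×ˢ Metric.closedBall 0 R := by
  rw [box, closure_prod_eq, closure_ball _ hR.ne', closure_ball _ hR.ne']

theorem box_subset_box {R' T T' : ℝ} (h1 : R ≤ R') (h2 : T ≤ T') :
    box m n R T ⊆ box m n R' T' :=
  prod_mono (Metric.ball_subset_ball h1) (Metric.ball_subset_ball h2)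

theorem re_sum_sq_Z_sub (φ : Pt m n → EuclideanSpace ℝ (Fin m)) (w w' : Pt m n) :
    (∑ k, (Z φ w k - Z φ w' k) ^ 2).re = ‖w.1 - w'.1‖ ^ 2 - ‖φ w - φ w'‖ ^ 2 := by
  rw [EuclideanSpace.real_norm_sq_eq, EuclideanSpace.real_norm_sq_eq, ← Finset.sum_sub_distrib,
    Complex.re_sum]
  refine Finset.sum_congr rfl fun k _ => ?_
  simp [Z, pow_two]

end Box

/-! ### Standing assumptions on the structure and on the cutoff -/

section Setup

variable {m n : ℕ} {s R : ℝ} {F : Type*} [NormedAddCommGroup F] [NormedSpace ℝ F]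

/-- Uniform Gevrey bounds on `box m n R R`. -/
def GevreyIn (s R : ℝ) (g : Pt m n → F) : Prop :=
  UniformGevrey s (box m n R R) id fun _ => g

theorem GevreyIn.contDiffAt {g : Pt m n → F} (hg : GevreyIn s R g) {w : Pt m n}
    (hw : w ∈ box m n R R) : ContDiffAt ℝ ∞ g w := by
  obtain ⟨C, h, _, _, hb⟩ := hg
  exact (hb w hw).1

theorem GevreyIn.contDiffOn {g : Pt m n → F} (hg : GevreyIn s R g) :
    ContDiffOn ℝ ∞ g (box m n R R) := fun _ hw => (hg.contDiffAt hw).contDiffWithinAt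

theorem UniformGevrey.exists_norm_le {ι E : Type*} [NormedAddCommGroup E] [NormedSpace ℝ E]
    {S : Set ι} {P : ι → E} {f : ι → E → F} (hf : UniformGevrey s S P f) :
    ∃ C : ℝ, 0 < C ∧ ∀ i ∈ S, ‖f i (P i)‖ ≤ C := by
  obtain ⟨C, h, hC, _, hb⟩ := hf
  exact ⟨C, hC, fun i hi => by simpa using (hb i hi).2 0⟩

theorem GevreyIn.exists_lipschitz (hs : 0 ≤ s) {g : Pt m n → F} (hg : GevreyIn s R g) :
    ∃ L : ℝ, 0 < L ∧ ∀ w ∈ box m n R R, ∀ w' ∈ box m n R R, ‖g w - g w'‖ ≤ L * ‖w - w'‖ := by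
  obtain ⟨L, hL, hb⟩ := (UniformGevrey.diffQuot (ι := Pt m n × Pt m n)
    (S := box m n R R ×ˢ box m n R R) (P := fun i => i.2) hs (convex_box R R) hg
    (fun i => i.1 - i.2) (fun i hi => hi.2) fun i hi => by simpa using hi.1).exists_norm_le
  refine ⟨L, hL, fun w hw w' hw' => ?_⟩
  have h := hb (w, w') ⟨hw, hw'⟩
  simp only [add_sub_cancel, norm_smul, norm_inv, norm_norm] at h
  rcases eq_or_ne w w' with rfl | hne
  · simp
  · rwa [inv_mul_le_iff₀ (norm_pos_iff.mpr (sub_ne_zero.mpr hne)), mul_comm] at h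

/-- The standing assumptions on the structure in `box m n R R`. -/
structure Setup (s : ℝ) (φ : Pt m n → EuclideanSpace ℝ (Fin m)) (R : ℝ) : Prop where
  one_le : 1 ≤ s
  R_pos : 0 < R
  gevrey : GevreyIn s R φ
  lipschitz : ∀ x y t, (x, t) ∈ box m n R R → (y, t) ∈ box m n R R →
    ‖φ (x, t) - φ (y, t)‖ ≤ 1 / 2 * ‖x - y‖
  det_ne_zero : ∀ w ∈ box m n R R, (Zx φ w).det ≠ 0

/-- The standing assumptions on the cutoff function. -/
structure Cutoff (s : ℝ) (χ : EuclideanSpace ℝ (Fin m) → ℂ) (R : ℝ) : Prop where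
  gevrey : UniformGevrey s univ id fun _ => χ
  isCompact : IsCompact (tsupport χ)
  subset : tsupport χ ⊆ Metric.ball 0 R
  eq_one : ∀ x ∈ Metric.ball (0 : EuclideanSpace ℝ (Fin m)) (R / 2), χ x = 1

variable {φ : Pt m n → EuclideanSpace ℝ (Fin m)} {χ : EuclideanSpace ℝ (Fin m) → ℂ}

theorem Setup.Z (h : Setup s φ R) (k : Fin m) : GevreyIn s R fun w => Z φ w k := by
  let L : Pt m n →L[ℝ] ℂ := Complex.ofRealCLM.comp
    ((EuclideanSpace.proj (𝕜 := ℝ) k).comp (ContinuousLinearMap.fst ℝ _ _))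
  have h1 : GevreyIn s R fun w : Pt m n => ((w.1 k : ℝ) : ℂ) :=
    UniformGevrey.clm (P := id) (by linarith [h.one_le]) L (B := R) fun w hw =>
      max_le (mem_ball_zero_iff.mp hw.1).le (mem_ball_zero_iff.mp hw.2).le
  have h2 : GevreyIn s R fun w : Pt m n => ((φ w k : ℝ) : ℂ) :=
    h.gevrey.clm_comp (Complex.ofRealCLM.comp (EuclideanSpace.proj (𝕜 := ℝ) k))
  exact h1.add ((UniformGevrey.const Complex.I).mul h.one_le h2)

theorem Setup.Zx (h : Setup s φ R) (k l : Fin m) : GevreyIn s R fun w => Zx φ w k l :=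
  (h.Z k).fderiv_apply (by linarith [h.one_le]) _

theorem Setup.Zt (h : Setup s φ R) (k : Fin m) (j : Fin n) : GevreyIn s R fun w => Zt φ w k j :=
  (h.Z k).fderiv_apply (by linarith [h.one_le]) _

theorem Setup.det (h : Setup s φ R) : GevreyIn s R fun w => (GevreyPoincare.Zx φ w).det :=
  UniformGevrey.det h.one_le h.Zx

theorem Cutoff.contDiff (hχ : Cutoff s χ R) : ContDiff ℝ ∞ χ := by
  obtain ⟨C, h, _, _, hb⟩ := hχ.gevrey
  exact contDiff_iff_contDiffAt.mpr fun x => (hb x (mem_univ x)).1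

theorem UniformGevrey.comp_fst {ι E E' : Type*} [NormedAddCommGroup E] [NormedSpace ℝ E]
    [NormedAddCommGroup E'] [NormedSpace ℝ E'] {S : Set ι} {P : ι → E × E'} {f : ι → E → F}
    (hf : UniformGevrey s S (fun i => (P i).1) f) :
    UniformGevrey s S P fun i w => f i w.1 := by
  simpa using hf.comp_affine (fun _ => ContinuousLinearMap.fst ℝ E E') (fun _ => 0) (Q := P)
    (fun i _ => ContinuousLinearMap.norm_fst_le ..) (fun i _ => by simp)

theorem Cutoff.gevreyIn (hχ : Cutoff s χ R) : GevreyIn s R fun w : Pt m n => χ w.1 :=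
  UniformGevrey.comp_fst (P := id) (hχ.gevrey.reindex (fun w : Pt m n => w.1) fun _ _ => mem_univ _)

theorem Cutoff.eq_zero (_ : Cutoff s χ R) {x : EuclideanSpace ℝ (Fin m)} (hx : x ∉ tsupport χ) :
    χ x = 0 := image_eq_zero_of_notMem_tsupport hx

end Setup

/-! ### Gevrey bounds for parametric integrals -/

section SetIntegral

variable {E F Y : Type*} [NormedAddCommGroup E] [NormedSpace ℝ E] [FiniteDimensional ℝ E]
  [NormedAddCommGroup F] [NormedSpace ℝ F] [CompleteSpace F]
  [NormedAddCommGroup Y] [NormedSpace ℝ Y] [MeasurableSpace Y] [BorelSpace Y]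
  {μ : Measure Y} [IsFiniteMeasureOnCompacts μ]

/-- The constant `b y` may vary with `y` while the radius `h` is common; a Gaussian weight in `b` is
thereby integrated rather than estimated by its maximum. -/
theorem gevreyAt_setIntegral {s h C : ℝ} (hh : 0 ≤ h) {O : Set E} {K Y' : Set Y} (hO : IsOpen O)
    (hK : IsCompact K) (hY' : IsOpen Y') (hKY : K ⊆ Y') {H : E → Y → F}
    (hH : ContDiffOn ℝ ∞ (Function.uncurry H) (O ×ˢ Y')) {x : E} (hx : x ∈ O) {b : Y → ℝ}
    (hb : IntegrableOn b K μ) (hbd : ∀ y ∈ K, GevreyAt s (b y) h (fun x => H x y) x)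
    (hC : ∫ y in K, b y ∂μ ≤ C) : GevreyAt s C h (fun x => ∫ y in K, H x y ∂μ) x := by
  obtain ⟨h1, h2⟩ := contDiffOn_setIntegral (μ := μ) hO hK hY' hKY hH
  refine ⟨h1.contDiffAt (hO.mem_nhds hx), fun k => ?_⟩
  rw [h2 k x hx]
  refine (norm_integral_le_of_norm_le ((hb.mul_const (h ^ k)).mul_const ((k.factorial : ℝ) ^ s))
    ?_).trans ?_
  · filter_upwards [ae_restrict_mem hK.measurableSet] with y hy using (hbd y hy).2 k
  · rw [integral_mul_const, integral_mul_const]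
    gcongr

end SetIntegral

/-! ### Normalised Gaussian integrals -/

section Gaussian

variable {m : ℕ}

/-- The normalising constant of the Gaussian. -/
def gaussConst (m : ℕ) (τ : ℝ) : ℝ := (τ / Real.pi) ^ ((m : ℝ) / 2)

theorem gaussConst_pos {τ : ℝ} (hτ : 0 < τ) : 0 < gaussConst m τ := by
  unfold gaussConst; positivity

theorem integrable_gaussian {a : ℝ} (ha : 0 < a) :
    Integrable fun y : EuclideanSpace ℝ (Fin m) => Real.exp (-a * ‖y‖ ^ 2) := by
  have h := GaussianFourier.integrable_cexp_neg_mul_sq_norm_add (V := EuclideanSpace ℝ (Fin m))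
    (b := (a : ℂ)) (by simpa using ha) 0 0
  have h2 := h.norm
  refine h2.congr (Eventually.of_forall fun y => ?_)
  simp only [Complex.norm_exp]
  congr 1
  norm_cast
  simp

/-- The powers of `τ` cancel. The value `a = 1` gives total mass one, and `a = 1/2` gives the
constant `2^{m/2}` of the estimates uniform in `τ`. -/
theorem gaussConst_mul_integral {τ a : ℝ} (hτ : 0 < τ) (ha : 0 < a) :
    gaussConst m τ * ∫ y : EuclideanSpace ℝ (Fin m), Real.exp (-(τ * a) * ‖y‖ ^ 2)
      = (a⁻¹) ^ ((m : ℝ) / 2) := by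
  rw [GaussianFourier.integral_rexp_neg_mul_sq_norm (by positivity), finrank_euclideanSpace_fin,
    gaussConst, ← Real.mul_rpow (by positivity) (by positivity)]
  congr 1
  field_simp

end Gaussian

/-! ### Gevrey bounds for the approximation operator, uniform in the large parameter -/

section MainTerm

variable {m n : ℕ} {s R : ℝ} {φ : Pt m n → EuclideanSpace ℝ (Fin m)}
  {χ : EuclideanSpace ℝ (Fin m) → ℂ} {u : Pt m n → ℂ}

/-- The density `χ u det Z_x`. -/
def density (φ : Pt m n → EuclideanSpace ℝ (Fin m)) (χ : EuclideanSpace ℝ (Fin m) → ℂ)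
    (u : Pt m n → ℂ) (w : Pt m n) : ℂ := χ w.1 * u w * (Zx φ w).det

theorem gevreyIn_density (h : Setup s φ R) (hχ : Cutoff s χ R) (hu : GevreyIn s R u) :
    GevreyIn s R (density φ χ u) :=
  (hχ.gevreyIn.mul h.one_le hu).mul h.one_le h.det

theorem density_eq_zero (hχ : Cutoff s χ R) {w : Pt m n} (hw : w.1 ∉ tsupport χ) :
    density φ χ u w = 0 := by
  simp [density, hχ.eq_zero hw]

theorem calG_eq_setIntegral (hχ : Cutoff s χ R) (τ : ℝ) (z : Fin m → ℂ)
    (t : EuclideanSpace ℝ (Fin n)) :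
    calG φ χ τ u z t = (gaussConst m τ : ℂ) * ∫ x' in tsupport χ,
      Complex.exp (-(τ : ℂ) * ∑ k, (z k - Z φ (x', t) k) ^ 2) * density φ χ u (x', t) := by
  rw [setIntegral_eq_integral_of_forall_compl_eq_zero
    fun x hx => by rw [density_eq_zero hχ hx, mul_zero]]
  simp only [calG, gaussConst, density, mul_assoc]

/-- Recentring by `x' = x + y` makes the phase a quadratic expression in increments of `Z` over the
fixed step `y`, so differentiation in `(x,t)` produces no negative powers of `|y|`. The radius `2R`
covers all `y` with `x` in the ball and `x + y` in the support of `χ`. -/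
theorem calG_Z_eq (hχ : Cutoff s χ R) (τ : ℝ) {w : Pt m n} (hw : w.1 ∈ Metric.ball 0 R) :
    calG φ χ τ u (Z φ w) w.2 = (gaussConst m τ : ℂ) *
      ∫ y in Metric.closedBall (0 : EuclideanSpace ℝ (Fin m)) (2 * R),
        Complex.exp (-(τ : ℂ) * ∑ k, (Z φ w k - Z φ (w + (y, 0)) k) ^ 2)
          * density φ χ u (w + (y, 0)) := by
  rw [setIntegral_eq_integral_of_forall_compl_eq_zero fun y hy => by
    rw [density_eq_zero hχ, mul_zero]
    intro hy'
    refine hy ?_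
    have h1 := hχ.subset hy'
    rw [mem_ball_zero_iff] at h1 hw
    rw [mem_closedBall_zero_iff]
    have h2 : y = (w + (y, 0)).1 - w.1 := by simp
    rw [h2]
    exact (norm_sub_le _ _).trans (by linarith)]
  simp only [calG, gaussConst]
  rw [← integral_add_left_eq_self _ w.1]
  congr 1
  refine integral_congr_ae (Eventually.of_forall fun y => ?_)
  have h3 : w + (y, 0) = (w.1 + y, w.2) := by ext <;> simp
  simp only [h3, density, mul_assoc]

/-- `φ` and `u` are controlled only on the box. Where `x + y` is outside the support of `χ` the
density vanishes identically, and the two open regions cover the domain. -/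
theorem mainTerm_smooth (h : Setup s φ R) (hχ : Cutoff s χ R) (hu : GevreyIn s R u) (τ : ℝ) :
    ContDiffOn ℝ ∞ (Function.uncurry fun (w : Pt m n) (y : EuclideanSpace ℝ (Fin m)) =>
        Complex.exp (-(τ : ℂ) * ∑ k, (Z φ w k - Z φ (w + (y, 0)) k) ^ 2)
          * density φ χ u (w + (y, 0))) (box m n R R ×ˢ univ) := by
  have hadd : Continuous fun p : Pt m n × EuclideanSpace ℝ (Fin m) => p.1 + (p.2, 0) := by fun_prop
  set S₁ : Set (Pt m n × EuclideanSpace ℝ (Fin m)) :=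
    (box m n R R ×ˢ univ) ∩ (fun p => p.1 + (p.2, 0)) ⁻¹' box m n R R
  set S₂ : Set (Pt m n × EuclideanSpace ℝ (Fin m)) :=
    (fun p => (p.1 + (p.2, 0)).1) ⁻¹' (tsupport χ)ᶜ
  have hS₁ : IsOpen S₁ :=
    ((isOpen_box R R).prod isOpen_univ).inter ((isOpen_box R R).preimage hadd)
  have hS₂ : IsOpen S₂ := (isClosed_tsupport χ).isOpen_compl.preimage (continuous_fst.comp hadd)
  refine (contDiffOn_union_of_eq_zero hS₁ hS₂ ?_ ?_).mono ?_
  · rintro p ⟨⟨hp1, -⟩, hp2⟩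
    have hA : ContDiffAt ℝ ∞ (fun p : Pt m n × EuclideanSpace ℝ (Fin m) => p.1 + (p.2, 0)) p := by
      fun_prop
    have hfst : ContDiffAt ℝ ∞ (fun p : Pt m n × EuclideanSpace ℝ (Fin m) => p.1) p :=
      contDiffAt_fst
    have h1 : ∀ k, ContDiffAt ℝ ∞ (fun p : Pt m n × EuclideanSpace ℝ (Fin m) =>
        Z φ p.1 k - Z φ (p.1 + (p.2, 0)) k) p := fun k =>
      (((h.Z k).contDiffAt hp1).comp p hfst).sub
        (ContDiffAt.comp (f := fun p : Pt m n × EuclideanSpace ℝ (Fin m) => p.1 + (p.2, 0)) p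
          ((h.Z k).contDiffAt hp2) hA)
    have h2 := ContDiffAt.comp (f := fun p : Pt m n × EuclideanSpace ℝ (Fin m) => p.1 + (p.2, 0)) p
      ((gevreyIn_density h hχ hu).contDiffAt hp2) hA
    exact ((contDiffAt_const.mul (ContDiffAt.sum fun k _ => (h1 k).pow 2)).cexp.mul
      h2).contDiffWithinAt
  · rintro ⟨w, y⟩ hp
    simp only [Function.uncurry]
    rw [density_eq_zero hχ hp, mul_zero]
  · rintro ⟨w, y⟩ ⟨hw, -⟩
    by_cases hy : (w + (y, 0)).1 ∈ tsupport χ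
    · refine Or.inl ⟨⟨hw, mem_univ _⟩, hχ.subset hy, ?_⟩
      simpa using hw.2
    · exact Or.inr hy

/-- The functions `𝒢_τ[u](Z(x,t),t)` satisfy Gevrey bounds uniformly in `τ`. -/
theorem exists_gevreyAt_calG (h : Setup s φ R) (hχ : Cutoff s χ R) (hu : GevreyIn s R u) :
    ∃ C H : ℝ, 0 < C ∧ 0 < H ∧ ∀ τ : ℝ, 0 < τ → ∀ w ∈ box m n R R,
      GevreyAt s C H (fun w => calG φ χ τ u (Z φ w) w.2) w := by
  have hs0 : 0 ≤ s := by linarith [h.one_le]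
  set S : Set (Pt m n × EuclideanSpace ℝ (Fin m)) :=
    {i | i.1 ∈ box m n R R ∧ i.1 + (i.2, 0) ∈ box m n R R} with hS
  have hquot : ∀ k, UniformGevrey s S (fun i => i.1) fun i w =>
      (‖i.2‖⁻¹ : ℝ) • (Z φ (w + (i.2, 0)) k - Z φ w k) := fun k => by
    have := UniformGevrey.diffQuot (S := S) (P := fun i => i.1) hs0 (convex_box R R) (h.Z k)
      (fun i => (i.2, 0)) (fun i hi => hi.1) (fun i hi => hi.2)
    simpa [Prod.norm_def] using this
  -- For this `q` the exponent is `τ‖y‖² q`, and `q` is Gevrey uniformly in `y`.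
  have hq : UniformGevrey s S (fun i => i.1) fun i w =>
      -∑ k, ((‖i.2‖⁻¹ : ℝ) • (Z φ (w + (i.2, 0)) k - Z φ w k))
        * ((‖i.2‖⁻¹ : ℝ) • (Z φ (w + (i.2, 0)) k - Z φ w k)) :=
    (UniformGevrey.sum _ fun k _ => (hquot k).mul h.one_le (hquot k)).neg
  -- The Lipschitz constant `1/2` of `φ` in `x` gives `Re q ≤ -3/4` for `y ≠ 0`; the loss `1/4`
  -- leaves the decay `exp(-τ‖y‖²/2)`.
  obtain ⟨H₁, hH₁, hexp⟩ := hq.cexp h.one_le (δ := 1 / 4) (by norm_num)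
  have hd : UniformGevrey s S (fun i => i.1) fun i w => density φ χ u (w + (i.2, 0)) := by
    have h1 : UniformGevrey s S (fun i => i.1 + (i.2, 0)) fun _ => density φ χ u :=
      UniformGevrey.reindex (gevreyIn_density h hχ hu)
        (fun i : Pt m n × EuclideanSpace ℝ (Fin m) => i.1 + (i.2, 0)) fun i hi => hi.2
    exact h1.comp_affine (fun _ => ContinuousLinearMap.id ℝ _) (fun i => (i.2, 0))
      (fun _ _ => ContinuousLinearMap.norm_id_le) fun _ _ => rfl
  obtain ⟨C₂, H₂, hC₂, hH₂, hdens⟩ := hd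
  refine ⟨C₂ * 2 ^ ((m : ℝ) / 2), H₁ + H₂, by positivity, by positivity, fun τ hτ w hw => ?_⟩
  have hbd : ∀ y : EuclideanSpace ℝ (Fin m),
      GevreyAt s (Real.exp (-(τ * (1 / 2)) * ‖y‖ ^ 2) * C₂) (H₁ + H₂) (fun w =>
        Complex.exp (-(τ : ℂ) * ∑ k, (Z φ w k - Z φ (w + (y, 0)) k) ^ 2)
          * density φ χ u (w + (y, 0))) w := by
    intro y
    by_cases hy : (w + (y, 0)).1 ∈ tsupport χ
    · have hi : (w, y) ∈ S := ⟨hw, hχ.subset hy, by simpa using hw.2⟩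
      have h1 := hexp (w, y) hi (τ * ‖y‖ ^ 2) (by positivity)
      have h2 : GevreyAt s (Real.exp (-(τ * (1 / 2)) * ‖y‖ ^ 2)) H₁ (fun w =>
          Complex.exp (-(τ : ℂ) * ∑ k, (Z φ w k - Z φ (w + (y, 0)) k) ^ 2)) w := by
        refine (h1.mono hH₁.le (Real.exp_nonneg _) (Real.exp_le_exp.mpr ?_) le_rfl).congr
          (Eventually.of_forall fun v => ?_)
        · rcases eq_or_ne y 0 with rfl | hy0
          · simp
          · have hny : 0 < ‖y‖ := norm_pos_iff.mpr hy0
            have h3 := re_sum_sq_Z_sub φ (w + (y, 0)) w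
            have h4 := h.lipschitz (w.1 + y) w.1 w.2
              ⟨hχ.subset hy, hw.2⟩ hw
            have h5 : w + (y, 0) = (w.1 + y, w.2) := by ext <;> simp
            have h6 : (-∑ k, ((‖y‖⁻¹ : ℝ) • (Z φ (w + (y, 0)) k - Z φ w k))
                * ((‖y‖⁻¹ : ℝ) • (Z φ (w + (y, 0)) k - Z φ w k))).re
                = -(‖y‖⁻¹ ^ 2 * (∑ k, (Z φ (w + (y, 0)) k - Z φ w k) ^ 2).re) := by
              rw [Complex.neg_re, ← Complex.re_ofReal_mul, Finset.mul_sum]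
              congr 2
              refine Finset.sum_congr rfl fun k _ => ?_
              simp only [Complex.real_smul]
              push_cast
              ring
            simp only [h6, h3]
            rw [h5] at *
            simp only [add_sub_cancel_left] at h4 ⊢
            have h7 : ‖φ (w.1 + y, w.2) - φ w‖ ^ 2 ≤ 1 / 4 * ‖y‖ ^ 2 := by
              have := mul_self_le_mul_self (norm_nonneg _) h4
              calc _ = ‖φ (w.1 + y, w.2) - φ (w.1, w.2)‖ * ‖φ (w.1 + y, w.2) - φ (w.1, w.2)‖ :=
                    pow_two _
                _ ≤ _ := this
                _ = _ := by ring
            have h8 : τ * ‖y‖ ^ 2 * (-(‖y‖⁻¹ ^ 2 * (‖y‖ ^ 2 - ‖φ (w.1 + y, w.2) - φ w‖ ^ 2)) + 1 / 4)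
                = τ * (-(‖y‖ ^ 2 - ‖φ (w.1 + y, w.2) - φ w‖ ^ 2) + 1 / 4 * ‖y‖ ^ 2) := by
              field_simp
            rw [h8, show -(τ * (1 / 2)) * ‖y‖ ^ 2 = τ * (-(1 / 2) * ‖y‖ ^ 2) by ring]
            exact mul_le_mul_of_nonneg_left (by linarith) hτ.le
        · dsimp only
          congr 1
          rw [neg_mul, Finset.mul_sum, mul_neg, Finset.mul_sum, neg_inj]
          refine Finset.sum_congr rfl fun k _ => ?_
          rcases eq_or_ne y 0 with rfl | hy0
          · simp [show v + ((0 : EuclideanSpace ℝ (Fin m)), (0 : EuclideanSpace ℝ (Fin n))) = v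
              from add_zero v]
          · have hny : (‖y‖ : ℂ) ≠ 0 := by
              exact_mod_cast (norm_pos_iff.mpr hy0).ne'
            simp only [Complex.real_smul]
            push_cast
            field_simp
            ring
      exact h2.mul h.one_le (hdens (w, y) hi) (Real.exp_nonneg _) hC₂.le hH₁.le hH₂.le
    · refine GevreyAt.of_eventuallyEq_zero ?_ (by positivity) (by positivity)
      have hcont : Continuous fun w : Pt m n => (w + (y, 0)).1 := by fun_prop
      filter_upwards [((isClosed_tsupport χ).isOpen_compl.preimage hcont).mem_nhds hy] with v hv
      rw [density_eq_zero hχ hv, mul_zero]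
      rfl
  have hint : IntegrableOn (fun y : EuclideanSpace ℝ (Fin m) =>
      Real.exp (-(τ * (1 / 2)) * ‖y‖ ^ 2) * C₂) (Metric.closedBall 0 (2 * R)) :=
    ((integrable_gaussian (by positivity)).mul_const C₂).integrableOn
  have hle : ∫ y in Metric.closedBall (0 : EuclideanSpace ℝ (Fin m)) (2 * R),
      Real.exp (-(τ * (1 / 2)) * ‖y‖ ^ 2) * C₂
      ≤ (gaussConst m τ)⁻¹ * (C₂ * 2 ^ ((m : ℝ) / 2)) := by
    refine (setIntegral_le_integral ((integrable_gaussian (by positivity)).mul_const C₂)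
      (Eventually.of_forall fun y => by positivity)).trans ?_
    have h9 := gaussConst_mul_integral (m := m) hτ (a := 1 / 2) (by norm_num)
    rw [show ((1 / 2 : ℝ))⁻¹ = 2 by norm_num] at h9
    rw [integral_mul_const, ← h9, le_inv_mul_iff₀ (gaussConst_pos hτ)]
    exact le_of_eq (by ring)
  have hmain := gevreyAt_setIntegral (μ := volume) (by positivity : 0 ≤ H₁ + H₂) (isOpen_box R R)
    (isCompact_closedBall (0 : EuclideanSpace ℝ (Fin m)) (2 * R)) isOpen_univ (subset_univ _)
    (mainTerm_smooth h hχ hu τ) hw hint (fun y _ => hbd y) hle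
  have hfin := (hmain.clm_comp (gaussConst m τ • ContinuousLinearMap.id ℝ ℂ)).mono
    (C' := C₂ * 2 ^ ((m : ℝ) / 2)) (by positivity) (by positivity) (by
      rw [norm_smul, Real.norm_of_nonneg (gaussConst_pos hτ).le]
      have := gaussConst_pos (m := m) hτ
      refine (mul_le_mul_of_nonneg_right (mul_le_of_le_one_right this.le
        ContinuousLinearMap.norm_id_le) (by positivity)).trans ?_
      rw [mul_inv_cancel_left₀ this.ne']) le_rfl
  refine hfin.congr ?_
  filter_upwards [(isOpen_box R R).mem_nhds hw] with v hv
  rw [calG_Z_eq hχ τ hv.1]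
  simp

end MainTerm

/-! ### Deformation of the complex contour to the real one -/

section Deformation

variable {m n : ℕ} {s R : ℝ} {φ : Pt m n → EuclideanSpace ℝ (Fin m)}
  {χ : EuclideanSpace ℝ (Fin m) → ℂ} {u : Pt m n → ℂ}

/-- A kernel vector `a + ib` satisfies `a = θ A b` and `b = -θ A a`. Both maps contract by `|θ|/2 <
1`, so `a = b = 0`. The range `|θ| < 2` is an open neighbourhood of `[0,1]`, as differentiation in
`θ` requires. -/
theorem det_one_add_I_smul_ne_zero
    (A : EuclideanSpace ℝ (Fin m) →L[ℝ] EuclideanSpace ℝ (Fin m)) (hA : ‖A‖ ≤ 1 / 2) {θ : ℝ}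
    (hθ : |θ| < 2) :
    (Matrix.of fun k l : Fin m => (if k = l then (1 : ℂ) else 0)
      + Complex.I * θ * ((A (EuclideanSpace.single l 1) k : ℝ) : ℂ)).det ≠ 0 := by
  intro hdet
  obtain ⟨v, hv, hv0⟩ := Matrix.exists_mulVec_eq_zero_iff.mpr hdet
  set a : EuclideanSpace ℝ (Fin m) := WithLp.toLp 2 fun k => (v k).re with ha
  set b : EuclideanSpace ℝ (Fin m) := WithLp.toLp 2 fun k => (v k).im with hb
  have hexp : ∀ c : EuclideanSpace ℝ (Fin m), ∀ k,
      A c k = ∑ l, A (EuclideanSpace.single l 1) k * c l := by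
    intro c k
    have h1 : c = ∑ l, c l • EuclideanSpace.single l (1 : ℝ) := by
      ext j
      simp [Finset.sum_apply, Pi.single_apply]
    conv_lhs => rw [h1]
    simp [map_sum, mul_comm]
  have hk : ∀ k, v k + Complex.I * θ *
      ∑ l, ((A (EuclideanSpace.single l 1) k : ℝ) : ℂ) * v l = 0 := by
    intro k
    have := congrFun hv0 k
    simp only [Matrix.mulVec, dotProduct, Matrix.of_apply, add_mul, Finset.sum_add_distrib,
      ite_mul, one_mul, zero_mul, Finset.sum_ite_eq, Finset.mem_univ, if_true,
      Pi.zero_apply] at this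
    rw [← this, Finset.mul_sum]
    congr 1
    exact Finset.sum_congr rfl fun l _ => by ring
  have hre : a = θ • A b := by
    ext k
    have := congrArg Complex.re (hk k)
    simp [Complex.add_re, Complex.mul_re, Complex.im_sum, Complex.mul_im] at this
    rw [PiLp.smul_apply, smul_eq_mul, hexp b k]
    simp only [ha, hb]
    linarith
  have him : b = -(θ • A a) := by
    ext k
    have := congrArg Complex.im (hk k)
    simp [Complex.add_im, Complex.mul_im, Complex.re_sum, Complex.mul_re] at this
    rw [PiLp.neg_apply, PiLp.smul_apply, smul_eq_mul, hexp a k]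
    simp only [ha, hb]
    linarith
  have hna : ‖a‖ ≤ |θ| * (1 / 2 * ‖b‖) := by
    conv_lhs => rw [hre]
    rw [norm_smul, Real.norm_eq_abs]
    gcongr
    exact A.le_of_opNorm_le hA b
  have hnb : ‖b‖ ≤ |θ| * (1 / 2 * ‖a‖) := by
    conv_lhs => rw [him]
    rw [norm_neg, norm_smul, Real.norm_eq_abs]
    gcongr
    exact A.le_of_opNorm_le hA a
  have hsum : ‖a‖ + ‖b‖ ≤ 0 := by
    by_contra hlt
    push Not at hlt
    nlinarith
  have ha0 : a = 0 := norm_eq_zero.mp (by linarith [norm_nonneg a, norm_nonneg b])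
  have hb0 : b = 0 := norm_eq_zero.mp (by linarith [norm_nonneg a, norm_nonneg b])
  refine hv (funext fun k => Complex.ext ?_ ?_)
  · exact congrArg (fun c : EuclideanSpace ℝ (Fin m) => c k) ha0
  · exact congrArg (fun c : EuclideanSpace ℝ (Fin m) => c k) hb0

theorem Setup.norm_fderiv_le (h : Setup s φ R) {w : Pt m n} (hw : w ∈ box m n R R) :
    ‖(fderiv ℝ φ w).comp (ContinuousLinearMap.inl ℝ _ _)‖ ≤ 1 / 2 := by
  have h1 : HasFDerivAt (fun x => φ (x, w.2))
      ((fderiv ℝ φ w).comp (ContinuousLinearMap.inl ℝ _ _)) w.1 :=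
    HasFDerivAt.comp (f := fun x => (x, w.2)) w.1
      ((h.gevrey.contDiffAt hw).differentiableAt (by simp)).hasFDerivAt
      (hasFDerivAt_prodMk_left w.1 w.2)
  have h2 : LipschitzOnWith (1 / 2) (fun x => φ (x, w.2)) (Metric.ball 0 R) := by
    refine LipschitzOnWith.of_dist_le_mul fun x hx y hy => ?_
    rw [dist_eq_norm, dist_eq_norm]
    simpa using h.lipschitz x y w.2 ⟨hx, hw.2⟩ ⟨hy, hw.2⟩
  have h3 := norm_fderiv_le_of_lipschitzOn ℝ (Metric.isOpen_ball.mem_nhds hw.1) h2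
  rw [h1.fderiv] at h3
  simpa using h3

/-- The Jacobian matrix of `x' ↦ x' + i θ φ(x', t)`. -/
def deformMatrix (φ : Pt m n → EuclideanSpace ℝ (Fin m)) (θ : ℝ) (w : Pt m n) :
    Matrix (Fin m) (Fin m) ℂ :=
  Matrix.of fun k l : Fin m => (if k = l then (1 : ℂ) else 0)
    + Complex.I * θ * ((fderiv ℝ φ w (ex l) k : ℝ) : ℂ)

theorem Setup.det_deformMatrix_ne_zero (h : Setup s φ R) {w : Pt m n} (hw : w ∈ box m n R R)
    {θ : ℝ} (hθ : |θ| < 2) : (deformMatrix φ θ w).det ≠ 0 :=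
  det_one_add_I_smul_ne_zero _ (h.norm_fderiv_le hw) hθ

/-- The deformation from `x' - x` to `Z(x', t) - Z(x, t)`. -/
def deform (φ : Pt m n → EuclideanSpace ℝ (Fin m)) (w : Pt m n)
    (q : EuclideanSpace ℝ (Fin m) × ℝ) (k : Fin m) : ℂ :=
  ((q.1 k : ℝ) - (w.1 k : ℝ) : ℂ) + Complex.I * q.2 * ((φ (q.1, w.2) k : ℝ) - (φ w k : ℝ) : ℂ)

theorem contDiffAt_deform (h : Setup s φ R) {w : Pt m n} (hw : w.2 ∈ Metric.ball 0 R)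
    {q : EuclideanSpace ℝ (Fin m) × ℝ} (hq : q.1 ∈ Metric.ball 0 R) (k : Fin m) :
    ContDiffAt ℝ ∞ (fun q => deform φ w q k) q := by
  have h1 : ContDiffAt ℝ ∞ (fun q : EuclideanSpace ℝ (Fin m) × ℝ => φ (q.1, w.2)) q :=
    ContDiffAt.comp (f := fun q : EuclideanSpace ℝ (Fin m) × ℝ => (q.1, w.2)) q
      (h.gevrey.contDiffAt ⟨hq, hw⟩) (contDiffAt_fst.prodMk contDiffAt_const)
  have h2 : ContDiffAt ℝ ∞ (fun q : EuclideanSpace ℝ (Fin m) × ℝ => ((φ (q.1, w.2) k : ℝ) : ℂ)) q :=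
    (Complex.ofRealCLM.comp (EuclideanSpace.proj (𝕜 := ℝ) k)).contDiff.contDiffAt.comp q h1
  have h3 : ContDiffAt ℝ ∞ (fun q : EuclideanSpace ℝ (Fin m) × ℝ => ((q.1 k : ℝ) : ℂ)) q :=
    (Complex.ofRealCLM.comp (EuclideanSpace.proj (𝕜 := ℝ) k)).contDiff.contDiffAt.comp q
      contDiffAt_fst
  have h4 : ContDiffAt ℝ ∞ (fun q : EuclideanSpace ℝ (Fin m) × ℝ => ((q.2 : ℝ) : ℂ)) q :=
    Complex.ofRealCLM.contDiff.contDiffAt.comp q contDiffAt_snd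
  exact (h3.sub contDiffAt_const).add ((contDiffAt_const.mul h4).mul (h2.sub contDiffAt_const))

theorem hasFDerivAt_deform (h : Setup s φ R) {w : Pt m n} (hw : w.2 ∈ Metric.ball 0 R)
    {q : EuclideanSpace ℝ (Fin m) × ℝ} (hq : q.1 ∈ Metric.ball 0 R) (k : Fin m)
    (v : EuclideanSpace ℝ (Fin m) × ℝ) :
    fderiv ℝ (fun q => deform φ w q k) q v = ((v.1 k : ℝ) : ℂ)
      + (Complex.I * v.2 * ((φ (q.1, w.2) k : ℝ) - (φ w k : ℝ) : ℂ)
        + Complex.I * q.2 * ((fderiv ℝ φ (q.1, w.2) (v.1, 0) k : ℝ) : ℂ)) := by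
  let p : EuclideanSpace ℝ (Fin m) →L[ℝ] ℂ :=
    Complex.ofRealCLM.comp (EuclideanSpace.proj (𝕜 := ℝ) k)
  have h1 : HasFDerivAt (fun q : EuclideanSpace ℝ (Fin m) × ℝ => p (φ (q.1, w.2)))
      (p.comp ((fderiv ℝ φ (q.1, w.2)).comp ((ContinuousLinearMap.inl ℝ _ _).comp
        (ContinuousLinearMap.fst ℝ _ _)))) q :=
    p.hasFDerivAt.comp q (HasFDerivAt.comp (f := fun q : EuclideanSpace ℝ (Fin m) × ℝ => (q.1, w.2))
      q ((h.gevrey.contDiffAt (w := (q.1, w.2)) ⟨hq, hw⟩).differentiableAt (by simp)).hasFDerivAt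
      (HasFDerivAt.comp (g := fun x => (x, w.2)) (f := Prod.fst) q
        (hasFDerivAt_prodMk_left q.1 w.2) hasFDerivAt_fst))
  have h3 : HasFDerivAt (fun q : EuclideanSpace ℝ (Fin m) × ℝ => p q.1)
      (p.comp (ContinuousLinearMap.fst ℝ _ _)) q := p.hasFDerivAt.comp q hasFDerivAt_fst
  have h4 : HasFDerivAt (fun q : EuclideanSpace ℝ (Fin m) × ℝ => ((q.2 : ℝ) : ℂ))
      (Complex.ofRealCLM.comp (ContinuousLinearMap.snd ℝ _ _)) q :=
    Complex.ofRealCLM.hasFDerivAt.comp q hasFDerivAt_snd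
  have h5 := (h3.sub_const ((w.1 k : ℝ) : ℂ)).add
    ((h4.const_mul Complex.I).mul (h1.sub_const ((φ w k : ℝ) : ℂ)))
  have h6 : fderiv ℝ (fun q => deform φ w q k) q = _ := h5.fderiv
  rw [h6]
  simp [p]
  ring

theorem jac_deform (h : Setup s φ R) {w : Pt m n} (hw : w.2 ∈ Metric.ball 0 R)
    {q : EuclideanSpace ℝ (Fin m) × ℝ} (hq : q.1 ∈ Metric.ball 0 R) :
    jac (deform φ w) q = deformMatrix φ q.2 (q.1, w.2) := by
  ext k l
  simp only [jac, deformMatrix, Matrix.of_apply, hasFDerivAt_deform h hw hq, ex]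
  simp
  split_ifs <;> simp

theorem Zx_eq_deformMatrix (h : Setup s φ R) {w : Pt m n} (hw : w ∈ box m n R R) :
    Zx φ w = deformMatrix φ 1 w := by
  ext k l
  let p : EuclideanSpace ℝ (Fin m) →L[ℝ] ℂ :=
    Complex.ofRealCLM.comp (EuclideanSpace.proj (𝕜 := ℝ) k)
  have h1 : HasFDerivAt (fun w => p (φ w)) (p.comp (fderiv ℝ φ w)) w :=
    p.hasFDerivAt.comp w ((h.gevrey.contDiffAt hw).differentiableAt (by simp)).hasFDerivAt
  have h3 : HasFDerivAt (fun w : Pt m n => p w.1) (p.comp (ContinuousLinearMap.fst ℝ _ _)) w :=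
    p.hasFDerivAt.comp w hasFDerivAt_fst
  have h5 : fderiv ℝ (fun w => Z φ w k) w = _ := (h3.add (h1.const_mul Complex.I)).fderiv
  simp only [Zx, Matrix.of_apply, h5, deformMatrix]
  simp [p, ex]
  split_ifs <;> simp

theorem re_sum_deform_sq (φ : Pt m n → EuclideanSpace ℝ (Fin m)) (w : Pt m n)
    (q : EuclideanSpace ℝ (Fin m) × ℝ) :
    (∑ k, deform φ w q k ^ 2).re = ‖q.1 - w.1‖ ^ 2 - q.2 ^ 2 * ‖φ (q.1, w.2) - φ w‖ ^ 2 := by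
  rw [EuclideanSpace.real_norm_sq_eq, EuclideanSpace.real_norm_sq_eq, Finset.mul_sum,
    ← Finset.sum_sub_distrib, Complex.re_sum]
  refine Finset.sum_congr rfl fun k _ => ?_
  simp [deform, pow_two]
  ring

/-- Throughout the deformation the imaginary part of the contour costs at most a quarter of `|x' -
x|²`. -/
theorem norm_cexp_deform_le (h : Setup s φ R) {w : Pt m n} (hw : w ∈ box m n R R)
    {q : EuclideanSpace ℝ (Fin m) × ℝ} (hq : q.1 ∈ Metric.ball 0 R) (hθ : q.2 ∈ Icc (0 : ℝ) 1)
    {τ : ℝ} (hτ : 0 < τ) :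
    ‖Complex.exp (-(τ : ℂ) * ∑ k, deform φ w q k ^ 2)‖
      ≤ Real.exp (-(τ * (3 / 4)) * ‖q.1 - w.1‖ ^ 2) := by
  rw [Complex.norm_exp, neg_mul, Complex.neg_re, Complex.re_ofReal_mul, re_sum_deform_sq,
    Real.exp_le_exp]
  have h1 := h.lipschitz q.1 w.1 w.2 ⟨hq, hw.2⟩ hw
  have h2 : ‖φ (q.1, w.2) - φ w‖ ^ 2 ≤ 1 / 4 * ‖q.1 - w.1‖ ^ 2 := by
    have := pow_le_pow_left₀ (norm_nonneg _) h1 2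
    calc _ ≤ _ := this
      _ = _ := by ring
  have h3 : q.2 ^ 2 * ‖φ (q.1, w.2) - φ w‖ ^ 2 ≤ 1 / 4 * ‖q.1 - w.1‖ ^ 2 :=
    (mul_le_of_le_one_left (by positivity) (pow_le_one₀ hθ.1 hθ.2)).trans h2
  have h4 : 0 ≤ τ * (1 / 4 * ‖q.1 - w.1‖ ^ 2 - q.2 ^ 2 * ‖φ (q.1, w.2) - φ w‖ ^ 2) :=
    mul_nonneg hτ.le (by linarith)
  nlinarith

/-- A factor `r = |x' - x|` is worth `τ^{-1/2}`: `√τ r ≤ exp(τ r²/4)`, and the quarter is taken from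
the exponent `3/4`, leaving an integrable Gaussian with `1/2`. -/
theorem gaussConst_mul_norm_setIntegral_le {τ C : ℝ} (hτ : 0 < τ) (hC : 0 ≤ C)
    {K : Set (EuclideanSpace ℝ (Fin m))} (hK : MeasurableSet K) {x : EuclideanSpace ℝ (Fin m)}
    {f : EuclideanSpace ℝ (Fin m) → ℂ}
    (hf : ∀ x' ∈ K, ‖f x'‖ ≤ C * ‖x' - x‖ * Real.exp (-(τ * (3 / 4)) * ‖x' - x‖ ^ 2)) :
    gaussConst m τ * ‖∫ x' in K, f x'‖ ≤ C * 2 ^ ((m : ℝ) / 2) * (√τ)⁻¹ := by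
  have hsq : 0 < √τ := Real.sqrt_pos.mpr hτ
  have hint : Integrable fun x' : EuclideanSpace ℝ (Fin m) =>
      C * (√τ)⁻¹ * Real.exp (-(τ * (1 / 2)) * ‖x' - x‖ ^ 2) :=
    ((integrable_gaussian (by positivity)).comp_sub_right x).const_mul _
  have hpt : ∀ x' ∈ K, ‖f x'‖ ≤ C * (√τ)⁻¹ * Real.exp (-(τ * (1 / 2)) * ‖x' - x‖ ^ 2) := by
    intro x' hx'
    refine (hf x' hx').trans ?_
    set r := ‖x' - x‖
    have h1 : r ≤ (√τ)⁻¹ * Real.exp (τ * (1 / 4) * r ^ 2) := by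
      rw [le_inv_mul_iff₀ hsq]
      have h2 := Real.add_one_le_exp (τ * (1 / 4) * r ^ 2)
      have h3 : τ * r ^ 2 = (√τ * r) ^ 2 := by rw [mul_pow, Real.sq_sqrt hτ.le]
      -- With `X = √τ r`, this is `X ≤ 1 + X²/4 ≤ exp(X²/4)`.
      nlinarith [sq_nonneg (√τ * r - 2)]
    have h4 : Real.exp (-(τ * (1 / 2)) * r ^ 2)
        = Real.exp (τ * (1 / 4) * r ^ 2) * Real.exp (-(τ * (3 / 4)) * r ^ 2) := by
      rw [← Real.exp_add]; congr 1; ring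
    rw [h4, mul_assoc, mul_assoc, ← mul_assoc (√τ)⁻¹]
    gcongr
  have h5 : ‖∫ x' in K, f x'‖ ≤ ∫ x' : EuclideanSpace ℝ (Fin m),
      C * (√τ)⁻¹ * Real.exp (-(τ * (1 / 2)) * ‖x' - x‖ ^ 2) := by
    refine (norm_integral_le_of_norm_le hint.integrableOn ?_).trans
      (setIntegral_le_integral hint (Eventually.of_forall fun _ => by positivity))
    filter_upwards [ae_restrict_mem hK] with x' hx' using hpt x' hx'
  have h6 := gaussConst_mul_integral (m := m) hτ (a := 1 / 2) (by norm_num)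
  rw [show ((1 / 2 : ℝ))⁻¹ = 2 by norm_num] at h6
  rw [integral_const_mul, integral_sub_right_eq_self (fun y : EuclideanSpace ℝ (Fin m) =>
    Real.exp (-(τ * (1 / 2)) * ‖y‖ ^ 2)) x] at h5
  calc _ ≤ gaussConst m τ * (C * (√τ)⁻¹ * ∫ y : EuclideanSpace ℝ (Fin m),
        Real.exp (-(τ * (1 / 2)) * ‖y‖ ^ 2)) :=
        mul_le_mul_of_nonneg_left h5 (gaussConst_pos hτ).le
    _ = C * (√τ)⁻¹ * (gaussConst m τ * ∫ y : EuclideanSpace ℝ (Fin m),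
        Real.exp (-(τ * (1 / 2)) * ‖y‖ ^ 2)) := by ring
    _ = _ := by rw [h6]; ring

end Deformation

/-! ### Uniform convergence of the approximation operator -/

section Pointwise

variable {m n : ℕ} {s R : ℝ} {φ : Pt m n → EuclideanSpace ℝ (Fin m)}
  {χ : EuclideanSpace ℝ (Fin m) → ℂ} {u : Pt m n → ℂ}

theorem Setup.exists_norm_adjugate_le (h : Setup s φ R) :
    ∃ C : ℝ, 0 < C ∧ ∀ w ∈ box m n R R, ∀ θ ∈ Icc (0 : ℝ) 1, ∀ a b,
      ‖(deformMatrix φ θ w).adjugate a b‖ ≤ C := by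
  -- The entries are regarded as constant functions of a dummy real variable, so that the Gevrey
  -- calculus for adjugates yields plain boundedness.
  have hA : ∀ a b, UniformGevrey s (box m n R R ×ˢ Icc (0 : ℝ) 1) (fun _ => (0 : ℝ))
      fun i _ => deformMatrix φ i.2 i.1 a b := fun a b => by
    refine UniformGevrey.const_of_bound (C := 2) fun i hi => ?_
    have h1 := (h.norm_fderiv_le hi.1)
    have h2 : ‖fderiv ℝ φ i.1 (ex b)‖ ≤ 1 / 2 := by
      have := ((fderiv ℝ φ i.1).comp (ContinuousLinearMap.inl ℝ _ _)).le_of_opNorm_le h1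
        (EuclideanSpace.single b (1 : ℝ))
      simpa [ex] using this
    have h3 : |fderiv ℝ φ i.1 (ex b) a| ≤ 1 / 2 :=
      (PiLp.norm_apply_le (fderiv ℝ φ i.1 (ex b)) a).trans h2
    have h4 : |i.2| ≤ 1 := abs_le.mpr ⟨by linarith [hi.2.1], hi.2.2⟩
    refine (norm_add_le _ _).trans ?_
    have h5 : ‖(if a = b then (1 : ℂ) else 0)‖ ≤ 1 := by split_ifs <;> simp
    have h6 : ‖Complex.I * (i.2 : ℂ) * ((fderiv ℝ φ i.1 (ex b) a : ℝ) : ℂ)‖ ≤ 1 * (1 / 2) := by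
      simp only [norm_mul, Complex.norm_I, one_mul, Complex.norm_real]
      exact mul_le_mul h4 (by simpa using h3) (norm_nonneg _) zero_le_one
    linarith
  choose C hC hb using fun a b => (UniformGevrey.adjugate h.one_le hA a b).exists_norm_le
  refine ⟨1 + ∑ a, ∑ b, C a b, ?_, fun w hw θ hθ a b => ?_⟩
  · have : 0 ≤ ∑ a, ∑ b, C a b :=
      Finset.sum_nonneg fun a _ => Finset.sum_nonneg fun b _ => (hC a b).le
    linarith
  · have h1 := Finset.single_le_sum (f := fun b => C a b) (fun b _ => (hC a b).le)
      (Finset.mem_univ b)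
    have h2 := Finset.single_le_sum (f := fun a => ∑ b, C a b)
      (fun a _ => Finset.sum_nonneg fun b _ => (hC a b).le) (Finset.mem_univ a)
    have h3 := hb a b (w, θ) ⟨hw, hθ⟩
    dsimp only at h1 h2 h3
    linarith

theorem Cutoff.exists_norm_fderiv_le (hs : 0 ≤ s) (hχ : Cutoff s χ R) :
    ∃ C : ℝ, 0 < C ∧ ∀ x, ∀ k, ‖fderiv ℝ χ x (EuclideanSpace.single k 1)‖ ≤ C := by
  choose C hC hb using fun k : Fin m =>
    (hχ.gevrey.fderiv_apply hs (EuclideanSpace.single k (1 : ℝ))).exists_norm_le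
  refine ⟨1 + ∑ k, C k, ?_, fun x k => ?_⟩
  · have : 0 ≤ ∑ k, C k := Finset.sum_nonneg fun k _ => (hC k).le
    linarith
  · have h1 := Finset.single_le_sum (f := C) (fun b _ => (hC b).le) (Finset.mem_univ k)
    have h3 := hb k x (mem_univ _)
    simp only [id] at h3
    linarith

theorem fderiv_deform_apply_one (h : Setup s φ R) {w : Pt m n} (hw : w.2 ∈ Metric.ball 0 R)
    {q : EuclideanSpace ℝ (Fin m) × ℝ} (hq : q.1 ∈ Metric.ball 0 R) (k : Fin m) :
    fderiv ℝ (fun q => deform φ w q k) q (0, 1)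
      = Complex.I * ((φ (q.1, w.2) k : ℝ) - (φ w k : ℝ) : ℂ) := by
  rw [hasFDerivAt_deform h hw hq]
  have : ((0 : EuclideanSpace ℝ (Fin m)), (0 : EuclideanSpace ℝ (Fin n))) = 0 := rfl
  simp [this]

/-- `χ` does not depend on `θ`, so its lifted derivative contains only `∂χ` times lift coefficients.
These are linear in the `θ`-derivative `i(φ(x',t) - φ(x,t))`, which is `O(|x' - x|)`; the
determinant clears the inverse matrix. -/
theorem exists_norm_det_mul_liftDeriv_le (h : Setup s φ R) (hχ : Cutoff s χ R) :
    ∃ C : ℝ, 0 < C ∧ ∀ w ∈ box m n R R, ∀ q : EuclideanSpace ℝ (Fin m) × ℝ,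
      q.1 ∈ Metric.ball 0 R → q.2 ∈ Icc (0 : ℝ) 1 →
      ‖(jac (deform φ w) q).det * liftDeriv (deform φ w) 1 (fun q => χ q.1) q‖
        ≤ C * ‖q.1 - w.1‖ := by
  obtain ⟨C₁, hC₁, hadj⟩ := h.exists_norm_adjugate_le
  obtain ⟨C₂, hC₂, hdχ⟩ := hχ.exists_norm_fderiv_le (by linarith [h.one_le])
  refine ⟨1 + ∑ _k : Fin m, (∑ _a : Fin m, C₁ * (1 / 2)) * C₂, by positivity,
    fun w hw q hq hθ => ?_⟩
  have hqw : (q.1, w.2) ∈ box m n R R := ⟨hq, hw.2⟩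
  have hdet : (jac (deform φ w) q).det ≠ 0 := by
    rw [jac_deform h hw.2 hq]
    exact h.det_deformMatrix_ne_zero hqw (abs_lt.mpr ⟨by linarith [hθ.1], by linarith [hθ.2]⟩)
  have hd : HasFDerivAt (fun q : EuclideanSpace ℝ (Fin m) × ℝ => χ q.1)
      ((fderiv ℝ χ q.1).comp (ContinuousLinearMap.fst ℝ _ _)) q :=
    HasFDerivAt.comp (f := Prod.fst) q
      (hχ.contDiff.differentiable (by simp) q.1).hasFDerivAt hasFDerivAt_fst
  have h1 : (jac (deform φ w) q).det * liftDeriv (deform φ w) 1 (fun q => χ q.1) q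
      = -∑ k, (∑ a, (jac (deform φ w) q).adjugate k a
        * (Complex.I * ((φ (q.1, w.2) a : ℝ) - (φ w a : ℝ) : ℂ)))
        * fderiv ℝ χ q.1 (EuclideanSpace.single k 1) := by
    rw [liftDeriv, hd.fderiv]
    have e1 : ∀ v, ((fderiv ℝ χ q.1).comp (ContinuousLinearMap.fst ℝ _ ℝ)) v
        = fderiv ℝ χ q.1 v.1 := fun _ => rfl
    simp only [e1, map_zero, zero_sub, mul_neg, Finset.mul_sum, ← mul_assoc,
      det_mul_liftCoeff hdet, fderiv_deform_apply_one h hw.2 hq]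
  have h2 : ∀ a, ‖Complex.I * ((φ (q.1, w.2) a : ℝ) - (φ w a : ℝ) : ℂ)‖
      ≤ 1 / 2 * ‖q.1 - w.1‖ := by
    intro a
    rw [norm_mul, Complex.norm_I, one_mul, ← Complex.ofReal_sub, Complex.norm_real]
    exact (PiLp.norm_apply_le (φ (q.1, w.2) - φ w) a).trans (h.lipschitz q.1 w.1 w.2 hqw hw)
  rw [h1, norm_neg, add_mul, Finset.sum_mul]
  refine (norm_sum_le _ _).trans (le_add_of_nonneg_of_le (by positivity)
    (Finset.sum_le_sum fun k _ => ?_))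
  rw [norm_mul, mul_right_comm, Finset.sum_mul]
  refine mul_le_mul ((norm_sum_le _ _).trans (Finset.sum_le_sum fun a _ => ?_)) (hdχ _ _)
    (norm_nonneg _) (by positivity)
  rw [norm_mul, mul_assoc]
  refine mul_le_mul ?_ (h2 a) (norm_nonneg _) hC₁.le
  rw [jac_deform h hw.2 hq]
  exact hadj _ hqw _ hθ _ _

/-- The integral interpolating between the Gaussian and the kernel of `calG`. -/
def deformIntegral (φ : Pt m n → EuclideanSpace ℝ (Fin m)) (χ : EuclideanSpace ℝ (Fin m) → ℂ)
    (τ : ℝ) (w : Pt m n) (θ : ℝ) : ℂ :=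
  ∫ x' in tsupport χ, Complex.exp (-(τ : ℂ) * ∑ k, deform φ w (x', θ) k ^ 2) * χ x'
    * (jac (deform φ w) (x', θ)).det

theorem contDiff_gaussian (τ : ℝ) :
    ContDiff ℂ ∞ fun z : Fin m → ℂ => Complex.exp (-(τ : ℂ) * ∑ k, z k ^ 2) :=
  (contDiff_const.mul (ContDiff.sum fun k _ => (contDiff_apply ℂ ℂ k).pow 2)).cexp

/-- Stokes' formula with `θ ∈ (-2,2)` as the parameter: the Gaussian is entire in the deformed
coordinates, so the derivative falls on `χ` alone. -/
theorem hasDerivAt_deformIntegral (h : Setup s φ R) (hχ : Cutoff s χ R) (τ : ℝ) {w : Pt m n}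
    (hw : w ∈ box m n R R) {θ : ℝ} (hθ : |θ| < 2) :
    HasDerivAt (deformIntegral φ χ τ w)
      (∫ x' in tsupport χ, Complex.exp (-(τ : ℂ) * ∑ k, deform φ w (x', θ) k ^ 2)
        * (jac (deform φ w) (x', θ)).det * liftDeriv (deform φ w) 1 (fun q => χ q.1) (x', θ)) θ := by
  have hζ : ∀ k, ContDiffOn ℝ ∞ (fun q => deform φ w q k) (Metric.ball 0 R ×ˢ Ioo (-2) 2) :=
    fun k q hq => (contDiffAt_deform h hw.2 hq.1 k).contDiffWithinAt
  have hJ : ∀ q ∈ Metric.ball (0 : EuclideanSpace ℝ (Fin m)) R ×ˢ Ioo (-2 : ℝ) 2,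
      (jac (deform φ w) q).det ≠ 0 := fun q hq => by
    rw [jac_deform h hw.2 hq.1]
    exact h.det_deformMatrix_ne_zero (w := (q.1, w.2)) ⟨hq.1, hw.2⟩ (abs_lt.mpr hq.2)
  have hψ : ContDiffOn ℝ ∞ (fun q : EuclideanSpace ℝ (Fin m) × ℝ => χ q.1)
      (Metric.ball 0 R ×ˢ Ioo (-2) 2) := (hχ.contDiff.comp contDiff_fst).contDiffOn
  obtain ⟨h1, h2⟩ := fderiv_setIntegral_holomorphic (e := (1 : ℝ)) isOpen_Ioo hχ.isCompact
    Metric.isOpen_ball hχ.subset hζ hJ (contDiff_gaussian τ) hψ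
    (fun x hx p _ => hχ.eq_zero hx) (abs_lt.mp hθ)
  have h3 := h1.hasDerivAt
  rwa [h2] at h3

theorem exists_norm_deformIntegral_sub_le (h : Setup s φ R) (hχ : Cutoff s χ R) :
    ∃ C : ℝ, 0 < C ∧ ∀ τ : ℝ, 0 < τ → ∀ w ∈ box m n R R,
      gaussConst m τ * ‖deformIntegral φ χ τ w 1 - deformIntegral φ χ τ w 0‖ ≤ C * (√τ)⁻¹ := by
  obtain ⟨C, hC, hb⟩ := exists_norm_det_mul_liftDeriv_le h hχ
  refine ⟨C * 2 ^ ((m : ℝ) / 2), by positivity, fun τ hτ w hw => ?_⟩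
  have hg := gaussConst_pos (m := m) hτ
  have hlt : ∀ θ ∈ Icc (0 : ℝ) 1, |θ| < 2 := fun θ hθ =>
    abs_lt.mpr ⟨by linarith [hθ.1], by linarith [hθ.2]⟩
  rw [← le_inv_mul_iff₀ hg]
  refine norm_image_sub_le_of_norm_deriv_le_segment_01'
    (fun θ hθ => (hasDerivAt_deformIntegral h hχ τ hw (hlt θ hθ)).hasDerivWithinAt)
    fun θ hθ => ?_
  rw [le_inv_mul_iff₀ hg]
  refine gaussConst_mul_norm_setIntegral_le hτ hC.le hχ.isCompact.measurableSet (x := w.1)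
    fun x' hx' => ?_
  have hθ' := Ico_subset_Icc_self hθ
  rw [mul_assoc, norm_mul, mul_comm]
  exact mul_le_mul (hb w hw (x', θ) (hχ.subset hx') hθ')
    (norm_cexp_deform_le h hw (q := (x', θ)) (hχ.subset hx') hθ' hτ) (norm_nonneg _) (by positivity)

theorem deformIntegral_zero (h : Setup s φ R) (hχ : Cutoff s χ R) (τ : ℝ) {w : Pt m n}
    (hw : w ∈ box m n R R) :
    deformIntegral φ χ τ w 0
      = ∫ x', χ x' * (Real.exp (-(τ * 1) * ‖x' - w.1‖ ^ 2) : ℂ) := by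
  rw [← setIntegral_eq_integral_of_forall_compl_eq_zero (s := tsupport χ)
    fun x hx => by rw [hχ.eq_zero hx, zero_mul]]
  refine setIntegral_congr_fun hχ.isCompact.measurableSet fun x' hx' => ?_
  have h1 : (jac (deform φ w) (x', (0 : ℝ))).det = 1 := by
    rw [jac_deform h hw.2 (hχ.subset hx')]
    have : deformMatrix φ 0 (x', w.2) = 1 := by
      ext k l
      simp [deformMatrix, Matrix.one_apply]
    rw [this, Matrix.det_one]
  have h2 : ∑ k, deform φ w (x', (0 : ℝ)) k ^ 2 = ((‖x' - w.1‖ ^ 2 : ℝ) : ℂ) := by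
    rw [EuclideanSpace.real_norm_sq_eq]
    simp [deform]
  simp only [h1, h2, mul_one]
  rw [mul_comm]
  push_cast
  rfl

/-- The Gaussian has mass one, so the difference is the integral of `χ - 1`, which vanishes within
distance `R/4` of `x`. There `|χ - 1|` is bounded by a multiple of `|x' - x|`, which is cruder than
the true exponential decay but enough for the rate `τ^{-1/2}`. -/
theorem exists_norm_deformIntegral_zero_sub_one_le (h : Setup s φ R) (hχ : Cutoff s χ R) :
    ∃ C : ℝ, 0 < C ∧ ∀ τ : ℝ, 0 < τ → ∀ w ∈ box m n (R / 4) R,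
      ‖(gaussConst m τ : ℂ) * deformIntegral φ χ τ w 0 - 1‖ ≤ C * (√τ)⁻¹ := by
  obtain ⟨C, hC, hb⟩ := hχ.gevrey.exists_norm_le
  have hR := h.R_pos
  refine ⟨(C + 1) * (4 / R) * 2 ^ ((m : ℝ) / 2), by positivity, fun τ hτ w hw => ?_⟩
  have hw' : w ∈ box m n R R := box_subset_box (by linarith) le_rfl hw
  have hg := gaussConst_pos (m := m) hτ
  have hone := gaussConst_mul_integral (m := m) hτ (a := 1) zero_lt_one
  rw [inv_one, Real.one_rpow, ← integral_sub_right_eq_self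
    (fun y : EuclideanSpace ℝ (Fin m) => Real.exp (-(τ * 1) * ‖y‖ ^ 2)) w.1] at hone
  have hE : Integrable fun x' : EuclideanSpace ℝ (Fin m) =>
      (Real.exp (-(τ * 1) * ‖x' - w.1‖ ^ 2) : ℂ) :=
    ((integrable_gaussian (a := τ * 1) (by positivity)).comp_sub_right w.1).ofReal
  have h1 : (gaussConst m τ : ℂ) * deformIntegral φ χ τ w 0 - 1 = (gaussConst m τ : ℂ) *
      ∫ x' in univ, (χ x' - 1) * (Real.exp (-(τ * 1) * ‖x' - w.1‖ ^ 2) : ℂ) := by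
    have h2 : (1 : ℂ) = (gaussConst m τ : ℂ) *
        ∫ x' : EuclideanSpace ℝ (Fin m), (Real.exp (-(τ * 1) * ‖x' - w.1‖ ^ 2) : ℂ) := by
      rw [integral_complex_ofReal, ← Complex.ofReal_mul, hone, Complex.ofReal_one]
    conv_lhs => rw [h2]
    rw [deformIntegral_zero h hχ τ hw', ← mul_sub, setIntegral_univ, ← integral_sub _ hE]
    · simp only [sub_mul, one_mul]
    · exact hE.bdd_mul (c := C) hχ.contDiff.continuous.aestronglyMeasurable
        (Eventually.of_forall fun x => hb x (mem_univ x))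
  rw [h1, norm_mul, Complex.norm_real, Real.norm_of_nonneg hg.le]
  refine gaussConst_mul_norm_setIntegral_le hτ (by positivity) MeasurableSet.univ (x := w.1)
    fun x' _ => ?_
  rw [norm_mul, Complex.norm_real, Real.norm_of_nonneg (Real.exp_nonneg _)]
  refine mul_le_mul ?_ (Real.exp_le_exp.mpr ?_) (Real.exp_nonneg _) (by positivity)
  · by_cases hx : x' ∈ Metric.ball (0 : EuclideanSpace ℝ (Fin m)) (R / 2)
    · rw [hχ.eq_one x' hx, sub_self, norm_zero]
      positivity
    · have h3 : R / 4 ≤ ‖x' - w.1‖ := by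
        have h4 := norm_sub_norm_le x' w.1
        rw [mem_ball_zero_iff, not_lt] at hx
        have h5 := mem_ball_zero_iff.mp hw.1
        linarith
      have h6 : 1 ≤ 4 / R * ‖x' - w.1‖ := by
        rw [div_mul_eq_mul_div, one_le_div hR]
        linarith
      calc ‖χ x' - 1‖ ≤ ‖χ x'‖ + ‖(1 : ℂ)‖ := norm_sub_le _ _
        _ ≤ (C + 1) * 1 := by
          have := hb x' (mem_univ _)
          simp only [id] at this
          simpa using this
        _ ≤ _ := by rw [mul_assoc]; gcongr
  · have : 0 ≤ τ * ‖x' - w.1‖ ^ 2 := by positivity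
    linarith

/-- `u(x',t)` is split into its increment from `u(x,t)`, of size `O(|x' - x|)` by the Lipschitz
bound, and the constant `u(x,t)`. The latter multiplies the integral at `θ = 1`, which is compared
with `θ = 0` and then with `1`. -/
theorem exists_norm_calG_sub_le (h : Setup s φ R) (hχ : Cutoff s χ R) (hu : GevreyIn s R u) :
    ∃ C : ℝ, 0 < C ∧ ∀ τ : ℝ, 0 < τ → ∀ w ∈ box m n (R / 4) R,
      ‖calG φ χ τ u (Z φ w) w.2 - u w‖ ≤ C * (√τ)⁻¹ := by
  have hs0 : 0 ≤ s := by linarith [h.one_le]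
  have hR := h.R_pos
  obtain ⟨C₁, hC₁, hb₁⟩ := exists_norm_deformIntegral_sub_le h hχ
  obtain ⟨C₂, hC₂, hb₂⟩ := exists_norm_deformIntegral_zero_sub_one_le h hχ
  obtain ⟨L, hL, hLip⟩ := hu.exists_lipschitz hs0
  obtain ⟨Cu, hCu, hub⟩ := hu.exists_norm_le
  obtain ⟨Cd, hCd, hdb⟩ := (hχ.gevreyIn.mul h.one_le h.det).exists_norm_le
  refine ⟨Cd * L * 2 ^ ((m : ℝ) / 2) + Cu * (C₁ + C₂), by positivity, fun τ hτ w hw => ?_⟩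
  have hw' : w ∈ box m n R R := box_subset_box (by linarith) le_rfl hw
  have hg := gaussConst_pos (m := m) hτ
  have hpt : ∀ x' ∈ tsupport χ, ∀ k, Z φ w k - Z φ (x', w.2) k = -deform φ w (x', 1) k := by
    intro x' _ k
    simp only [Z, deform, Complex.ofReal_one]
    ring
  have hJ : ∀ x' ∈ tsupport χ, (jac (deform φ w) (x', (1 : ℝ))).det = (Zx φ (x', w.2)).det := by
    intro x' hx'
    rw [jac_deform h hw'.2 (hχ.subset hx'), Zx_eq_deformMatrix h (w := (x', w.2)) ⟨hχ.subset hx', hw'.2⟩]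
  have hcont : ContinuousOn (fun x' : EuclideanSpace ℝ (Fin m) => (x', w.2)) (tsupport χ) := by
    fun_prop
  have hmaps : MapsTo (fun x' : EuclideanSpace ℝ (Fin m) => (x', w.2)) (tsupport χ)
      (box m n R R) := fun x' hx' => ⟨hχ.subset hx', hw'.2⟩
  have hexpc : ContinuousOn (fun x' : EuclideanSpace ℝ (Fin m) =>
      Complex.exp (-(τ : ℂ) * ∑ k, deform φ w (x', (1 : ℝ)) k ^ 2)) (tsupport χ) := by
    refine (continuousOn_const.mul (continuousOn_finsetSum _ fun k _ => ?_)).cexp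
    refine ContinuousOn.pow (fun x' hx' => ContinuousAt.continuousWithinAt ?_) 2
    exact ContinuousAt.comp (f := fun x' : EuclideanSpace ℝ (Fin m) => (x', (1 : ℝ)))
      (contDiffAt_deform h hw'.2 (q := (x', 1)) (hχ.subset hx') k).continuousAt (by fun_prop)
  have hdc : ContinuousOn (fun x' : EuclideanSpace ℝ (Fin m) => χ x' * (Zx φ (x', w.2)).det)
      (tsupport χ) := hχ.contDiff.continuous.continuousOn.mul
    (h.det.contDiffOn.continuousOn.comp hcont hmaps)
  have huc : ContinuousOn (fun x' : EuclideanSpace ℝ (Fin m) => u (x', w.2)) (tsupport χ) :=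
    hu.contDiffOn.continuousOn.comp hcont hmaps
  have hsplit : calG φ χ τ u (Z φ w) w.2 - u w
      = (gaussConst m τ : ℂ) * (∫ x' in tsupport χ,
          Complex.exp (-(τ : ℂ) * ∑ k, deform φ w (x', (1 : ℝ)) k ^ 2)
            * ((χ x' * (Zx φ (x', w.2)).det) * (u (x', w.2) - u w)))
        + u w * ((gaussConst m τ : ℂ) * (deformIntegral φ χ τ w 1 - deformIntegral φ χ τ w 0)
          + ((gaussConst m τ : ℂ) * deformIntegral φ χ τ w 0 - 1)) := by
    have e1 : calG φ χ τ u (Z φ w) w.2 = (gaussConst m τ : ℂ) * ∫ x' in tsupport χ,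
        (Complex.exp (-(τ : ℂ) * ∑ k, deform φ w (x', (1 : ℝ)) k ^ 2)
            * ((χ x' * (Zx φ (x', w.2)).det) * (u (x', w.2) - u w))
          + Complex.exp (-(τ : ℂ) * ∑ k, deform φ w (x', (1 : ℝ)) k ^ 2) * χ x'
            * (jac (deform φ w) (x', (1 : ℝ))).det * u w) := by
      rw [calG_eq_setIntegral hχ]
      congr 1
      refine setIntegral_congr_fun hχ.isCompact.measurableSet fun x' hx' => ?_
      rw [hJ x' hx']
      simp only [hpt x' hx', neg_sq, density]
      ring
    rw [e1, integral_add, integral_mul_const, ← deformIntegral]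
    · ring
    · exact (hexpc.mul (hdc.mul (huc.sub continuousOn_const))).integrableOn_compact hχ.isCompact
    · refine ContinuousOn.integrableOn_compact hχ.isCompact (ContinuousOn.congr
        ((hexpc.mul hdc).mul (continuousOn_const (c := u w))) fun x' hx' => ?_)
      rw [hJ x' hx', mul_assoc (Complex.exp _)]
      rfl
  have hA : gaussConst m τ * ‖∫ x' in tsupport χ,
      Complex.exp (-(τ : ℂ) * ∑ k, deform φ w (x', (1 : ℝ)) k ^ 2)
        * ((χ x' * (Zx φ (x', w.2)).det) * (u (x', w.2) - u w))‖
      ≤ Cd * L * 2 ^ ((m : ℝ) / 2) * (√τ)⁻¹ := by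
    refine gaussConst_mul_norm_setIntegral_le hτ (by positivity) hχ.isCompact.measurableSet
      (x := w.1) fun x' hx' => ?_
    rw [norm_mul, mul_comm]
    refine mul_le_mul ?_ (norm_cexp_deform_le h hw' (q := (x', 1)) (hχ.subset hx')
      ⟨zero_le_one, le_rfl⟩ hτ) (norm_nonneg _) (by positivity)
    rw [norm_mul, mul_assoc]
    refine mul_le_mul (hdb (x', w.2) (hmaps hx')) ?_ (norm_nonneg _) hCd.le
    have := hLip (x', w.2) (hmaps hx') w hw'
    have e2 : ((x', w.2) : Pt m n) - w = (x' - w.1, 0) := by ext <;> simp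
    simpa [e2, Prod.norm_def] using this
  rw [hsplit]
  refine (norm_add_le _ _).trans ?_
  rw [add_mul]
  refine add_le_add ?_ ?_
  · rwa [norm_mul, Complex.norm_real, Real.norm_of_nonneg hg.le]
  · rw [norm_mul, mul_assoc]
    refine mul_le_mul (hub w hw') ((norm_add_le _ _).trans ?_) (norm_nonneg _) hCu.le
    rw [add_mul]
    refine add_le_add ?_ (hb₂ τ hτ w hw)
    rw [norm_mul, Complex.norm_real, Real.norm_of_nonneg hg.le]
    exact hb₁ τ hτ w hw'

end Pointwise

/-! ### The vector fields `L_j` on Gevrey functions and on integrals -/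

section Lv

variable {m n : ℕ} {s R : ℝ} {φ : Pt m n → EuclideanSpace ℝ (Fin m)} {u : Pt m n → ℂ}

theorem jac_Z (φ : Pt m n → EuclideanSpace ℝ (Fin m)) (w : Pt m n) : jac (Z φ) w = Zx φ w := rfl

theorem liftDeriv_Z (φ : Pt m n → EuclideanSpace ℝ (Fin m)) (j : Fin n) (g : Pt m n → ℂ)
    (w : Pt m n) : liftDeriv (Z φ) (EuclideanSpace.single j 1) g w = Lv φ j g w := rfl

/-- The vector field `L_j` multiplied by `det Z_x`. -/
def detLv (φ : Pt m n → EuclideanSpace ℝ (Fin m)) (j : Fin n) (g : Pt m n → ℂ) (w : Pt m n) : ℂ :=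
  (Zx φ w).det * Lv φ j g w

/-- The determinant replaces the inverse of `Z_x` by its adjugate, so the coefficients become
polynomials in derivatives of `Z`; no Gevrey bound for an inverse is needed. -/
theorem detLv_eq {w : Pt m n} (hw : (Zx φ w).det ≠ 0) (j : Fin n) (g : Pt m n → ℂ) :
    detLv φ j g w = (Zx φ w).det * fderiv ℝ g w (et j)
      - ∑ k, (∑ a, (Zx φ w).adjugate k a * Zt φ w a j) * fderiv ℝ g w (ex k) := by
  have h1 : ∀ k, (Zx φ w).det * ((Zx φ w)⁻¹ * Zt φ w) k j
      = ∑ a, (Zx φ w).adjugate k a * Zt φ w a j := fun k => by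
    rw [Matrix.inv_def, Ring.inverse_eq_inv', Matrix.smul_mul, Matrix.smul_apply, smul_eq_mul,
      mul_inv_cancel_left₀ hw, Matrix.mul_apply]
  rw [detLv, Lv, mul_sub, Finset.mul_sum]
  simp only [← mul_assoc, h1]

theorem gevreyIn_detLv (h : Setup s φ R) (j : Fin n) (hu : GevreyIn s R u) :
    GevreyIn s R (detLv φ j u) := by
  have hs0 : 0 ≤ s := by linarith [h.one_le]
  have h1 := (h.det.mul h.one_le (hu.fderiv_apply hs0 (et j))).sub
    (UniformGevrey.sum Finset.univ fun k _ =>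
      (UniformGevrey.sum Finset.univ fun a _ =>
        (UniformGevrey.adjugate h.one_le h.Zx k a).mul h.one_le (h.Zt a j)).mul h.one_le
        (hu.fderiv_apply hs0 (ex k)))
  refine UniformGevrey.congr h1 fun w hw => ?_
  filter_upwards [(isOpen_box R R).mem_nhds hw] with v hv
  exact (detLv_eq (h.det_ne_zero v hv) j u).symm

theorem Lv_mul {w : Pt m n} {f g : Pt m n → ℂ} (hf : DifferentiableAt ℝ f w)
    (hg : DifferentiableAt ℝ g w) (j : Fin n) :
    Lv φ j (fun w => f w * g w) w = f w * Lv φ j g w + Lv φ j f w * g w := by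
  simp only [Lv, fderiv_fun_mul hf hg, add_apply, smul_apply, smul_eq_mul]
  simp only [mul_sub, sub_mul, Finset.mul_sum, Finset.sum_mul, mul_add, Finset.sum_add_distrib]
  have h1 : ∀ k, ((Zx φ w)⁻¹ * Zt φ w) k j * (g w * fderiv ℝ f w (ex k))
      = ((Zx φ w)⁻¹ * Zt φ w) k j * fderiv ℝ f w (ex k) * g w := fun k => by ring
  have h2 : ∀ k, ((Zx φ w)⁻¹ * Zt φ w) k j * (f w * fderiv ℝ g w (ex k))
      = f w * (((Zx φ w)⁻¹ * Zt φ w) k j * fderiv ℝ g w (ex k)) := fun k => by ring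
  simp only [h1, h2]
  ring

theorem Lv_setIntegral {Y : Type*} [NormedAddCommGroup Y] [NormedSpace ℝ Y] [MeasurableSpace Y]
    [BorelSpace Y] {μ : Measure Y} [IsFiniteMeasureOnCompacts μ] {O : Set (Pt m n)} {K Y' : Set Y}
    (hO : IsOpen O) (hK : IsCompact K) (hY' : IsOpen Y') (hKY : K ⊆ Y') {H : Pt m n → Y → ℂ}
    (hH : ContDiffOn ℝ ∞ (Function.uncurry H) (O ×ˢ Y')) {w : Pt m n} (hw : w ∈ O) (j : Fin n) :
    Lv φ j (fun w => ∫ y in K, H w y ∂μ) w = ∫ y in K, Lv φ j (fun w => H w y) w ∂μ := by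
  have hat : ∀ p ∈ O ×ˢ Y', ContDiffAt ℝ ∞ (Function.uncurry H) p := fun p hp =>
    hH.contDiffAt ((hO.prod hY').mem_nhds hp)
  have hd : ∀ v ∈ O, ∀ y ∈ K, HasFDerivAt (fun w => H w y)
      ((fderiv ℝ (Function.uncurry H) (v, y)).comp (ContinuousLinearMap.inl ℝ _ Y)) v :=
    fun v hv y hy => HasFDerivAt.comp (g := Function.uncurry H) (f := fun w => (w, y)) v
      ((hat (v, y) ⟨hv, hKY hy⟩).differentiableAt (by simp)).hasFDerivAt
      (hasFDerivAt_prodMk_left v y)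
  have hc : ContinuousOn (fderiv ℝ (Function.uncurry H)) (O ×ˢ K) := fun p hp =>
    ((hat p ⟨hp.1, hKY hp.2⟩).fderiv_right (m := ∞) (by simp)).continuousAt.continuousWithinAt
  have hG' : ContinuousOn (fun p : Pt m n × Y =>
      (fderiv ℝ (Function.uncurry H) p).comp (ContinuousLinearMap.inl ℝ (Pt m n) Y)) (O ×ˢ K) :=
    hc.clm_comp continuousOn_const
  have h1 := hasFDerivAt_setIntegral_of_continuousOn (μ := μ) hO hK (G := H)
    (G' := fun v y => (fderiv ℝ (Function.uncurry H) (v, y)).comp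
      (ContinuousLinearMap.inl ℝ (Pt m n) Y)) (hH.continuousOn.mono (prod_mono_right hKY)) hG' hd hw
  have hint : IntegrableOn (fun y => (fderiv ℝ (Function.uncurry H) (w, y)).comp
      (ContinuousLinearMap.inl ℝ (Pt m n) Y)) K μ :=
    ContinuousOn.integrableOn_compact hK
      (hG'.comp (f := fun y => (w, y)) (by fun_prop) fun y hy => ⟨hw, hy⟩)
  have hval : ∀ v, fderiv ℝ (fun w => ∫ y in K, H w y ∂μ) w v
      = ∫ y in K, fderiv ℝ (fun w => H w y) w v ∂μ := fun v => by
    rw [h1.fderiv, ContinuousLinearMap.integral_apply hint]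
    exact setIntegral_congr_fun hK.measurableSet fun y hy => by rw [(hd w hw y hy).fderiv]
  have hi : ∀ v, IntegrableOn (fun y => fderiv ℝ (fun w => H w y) w v) K μ := fun v =>
    (hint.apply_continuousLinearMap v).congr (by
      filter_upwards [ae_restrict_mem hK.measurableSet] with y hy
      rw [(hd w hw y hy).fderiv])
  simp only [Lv, hval]
  rw [integral_sub (hi _) (integrable_finsetSum _ fun k _ => (hi _).const_mul _),
    integral_finsetSum _ fun k _ => (hi _).const_mul _]
  simp only [integral_const_mul]

end Lv

/-! ### The kernel integral with `z` frozen and its radial primitive -/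

section Kernel

variable {m n : ℕ} {s R : ℝ} {φ : Pt m n → EuclideanSpace ℝ (Fin m)}
  {χ : EuclideanSpace ℝ (Fin m) → ℂ} {u ψ : Pt m n → ℂ} {K : Set (EuclideanSpace ℝ (Fin m))}

/-- The integral of the density `ψ` against the kernel of `calG`. -/
def kernelIntegral (φ : Pt m n → EuclideanSpace ℝ (Fin m)) (K : Set (EuclideanSpace ℝ (Fin m)))
    (τ : ℝ) (ψ : Pt m n → ℂ) (z : Fin m → ℂ) (t : EuclideanSpace ℝ (Fin n)) : ℂ :=
  ∫ x' in K, Complex.exp (-(τ : ℂ) * ∑ k, (z k - Z φ (x', t) k) ^ 2) * ψ (x', t)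

theorem contDiffAt_gaussian_comp {W : Type*} [NormedAddCommGroup W] [NormedSpace ℝ W] {τ : ℝ}
    {ζ : W → Fin m → ℂ} {w : W} (hζ : ∀ k, ContDiffAt ℝ ∞ (fun w => ζ w k) w) :
    ContDiffAt ℝ ∞ (fun w => Complex.exp (-(τ : ℂ) * ∑ k, ζ w k ^ 2)) w :=
  (contDiffAt_const.mul (ContDiffAt.sum fun k _ => (hζ k).pow 2)).cexp

theorem contDiffAt_kernel (h : Setup s φ R) (hψ : GevreyIn s R ψ) (τ : ℝ) (z : Fin m → ℂ)
    {w : Pt m n} (hw : w ∈ box m n R R) : ContDiffAt ℝ ∞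
      (fun w => Complex.exp (-(τ : ℂ) * ∑ k, (z k - Z φ w k) ^ 2) * ψ w) w :=
  (contDiffAt_gaussian_comp fun k => contDiffAt_const.sub ((h.Z k).contDiffAt hw)).mul
    (hψ.contDiffAt hw)

theorem continuousOn_kernel (h : Setup s φ R) (hKR : K ⊆ Metric.ball 0 R)
    (hψ : GevreyIn s R ψ) (τ : ℝ) (z : Fin m → ℂ) {t : EuclideanSpace ℝ (Fin n)}
    (ht : t ∈ Metric.ball 0 R) : ContinuousOn (fun x' : EuclideanSpace ℝ (Fin m) =>
      Complex.exp (-(τ : ℂ) * ∑ k, (z k - Z φ (x', t) k) ^ 2) * ψ (x', t)) K := fun x hx =>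
  (ContinuousAt.comp (f := fun x' : EuclideanSpace ℝ (Fin m) => (x', t))
    (contDiffAt_kernel h hψ τ z (w := (x, t)) ⟨hKR hx, ht⟩).continuousAt
    (by fun_prop)).continuousWithinAt

theorem contDiffOn_kernelIntegral (h : Setup s φ R) (hK : IsCompact K) (hKR : K ⊆ Metric.ball 0 R)
    (hψ : GevreyIn s R ψ) (τ : ℝ) (z : Fin m → ℂ) :
    ContDiffOn ℝ ∞ (kernelIntegral φ K τ ψ z) (Metric.ball 0 R) := by
  refine (contDiffOn_setIntegral (μ := volume) Metric.isOpen_ball hK Metric.isOpen_ball hKR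
    (H := fun t x' => Complex.exp (-(τ : ℂ) * ∑ k, (z k - Z φ (x', t) k) ^ 2) * ψ (x', t))
    ?_).1
  rintro ⟨t, x⟩ ⟨ht, hx⟩
  exact (ContDiffAt.comp (f := fun p : EuclideanSpace ℝ (Fin n) × EuclideanSpace ℝ (Fin m) =>
    (p.2, p.1)) (t, x) (contDiffAt_kernel h hψ τ z (w := (x, t)) ⟨hx, ht⟩)
    (contDiffAt_snd.prodMk contDiffAt_fst)).contDiffWithinAt

theorem kernelIntegral_sum (h : Setup s φ R) (hK : IsCompact K) (hKR : K ⊆ Metric.ball 0 R)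
    (τ : ℝ) (z : Fin m → ℂ) {t : EuclideanSpace ℝ (Fin n)} (ht : t ∈ Metric.ball 0 R) {α : Type*}
    (A : Finset α) (c : α → ℂ) {ψ : α → Pt m n → ℂ} (hψ : ∀ a ∈ A, GevreyIn s R (ψ a)) :
    kernelIntegral φ K τ (fun w => ∑ a ∈ A, c a * ψ a w) z t
      = ∑ a ∈ A, c a * kernelIntegral φ K τ (ψ a) z t := by
  simp only [kernelIntegral, ← integral_const_mul]
  rw [← integral_finsetSum _ fun a ha =>
    ((continuousOn_kernel h hKR (hψ a ha) τ z ht).integrableOn_compact hK).const_mul _]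
  congr 1
  ext x'
  rw [Finset.mul_sum]
  exact Finset.sum_congr rfl fun a _ => by ring

/-- With `z` frozen the Gaussian is an entire function of `Z(x',t)`, so Stokes' formula with `ζ = Z`
turns `∂/∂t_j` of the integral into `L_j` acting on `χ u`. -/
theorem fderiv_kernelIntegral (h : Setup s φ R) (hχ : Cutoff s χ R) (hu : GevreyIn s R u) (τ : ℝ)
    (z : Fin m → ℂ) {t : EuclideanSpace ℝ (Fin n)} (ht : t ∈ Metric.ball 0 R) (j : Fin n) :
    fderiv ℝ (kernelIntegral φ (tsupport χ) τ (density φ χ u) z) t (EuclideanSpace.single j 1)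
      = kernelIntegral φ (tsupport χ) τ (detLv φ j fun w => χ w.1 * u w) z t := by
  have hF : ContDiff ℂ ∞ fun ζ : Fin m → ℂ =>
      Complex.exp (-(τ : ℂ) * ∑ k, (z k - ζ k) ^ 2) :=
    (contDiff_const.mul (ContDiff.sum fun k _ =>
      (contDiff_const.sub (contDiff_apply ℂ ℂ k)).pow 2)).cexp
  have hχu : GevreyIn s R fun w => χ w.1 * u w := hχ.gevreyIn.mul h.one_le hu
  have h1 := (fderiv_setIntegral_holomorphic (e := EuclideanSpace.single j 1) (ζ := Z φ)
    Metric.isOpen_ball hχ.isCompact Metric.isOpen_ball hχ.subset (fun k => (h.Z k).contDiffOn)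
    h.det_ne_zero hF hχu.contDiffOn
    (fun x hx p _ => by simp [hχ.eq_zero hx]) ht).2
  simp only [liftDeriv_Z, jac_Z] at h1
  have h2 : kernelIntegral φ (tsupport χ) τ (density φ χ u) z = fun p => ∫ x in tsupport χ,
      Complex.exp (-(τ : ℂ) * ∑ k, (z k - Z φ (x, p) k) ^ 2) * (χ x * u (x, p))
        * (Zx φ (x, p)).det := by
    ext p
    simp only [kernelIntegral, density, mul_assoc]
  rw [h2]
  refine h1.trans ?_
  simp only [kernelIntegral, detLv, mul_assoc]

/-- The integral of `kernelIntegral` over the segment from `0` to `t`. -/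
def coneIntegral (φ : Pt m n → EuclideanSpace ℝ (Fin m)) (K : Set (EuclideanSpace ℝ (Fin m)))
    (τ : ℝ) (ψ : Pt m n → ℂ) (r : ℕ) (z : Fin m → ℂ) (t : EuclideanSpace ℝ (Fin n)) : ℂ :=
  ∫ σ in (0 : ℝ)..1, kernelIntegral φ K τ ψ z (σ • t) * (σ : ℂ) ^ r

theorem smul_mem_ball {t : EuclideanSpace ℝ (Fin n)} (ht : t ∈ Metric.ball 0 R) {σ : ℝ}
    (hσ : σ ∈ Icc (0 : ℝ) 1) : σ • t ∈ Metric.ball 0 R := by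
  rw [mem_ball_zero_iff] at *
  rw [norm_smul, Real.norm_of_nonneg hσ.1]
  exact (mul_le_of_le_one_left (norm_nonneg _) hσ.2).trans_lt ht

theorem continuousOn_kernelIntegral_smul (h : Setup s φ R) (hK : IsCompact K)
    (hKR : K ⊆ Metric.ball 0 R) (hψ : GevreyIn s R ψ) (τ : ℝ) (z : Fin m → ℂ)
    {t : EuclideanSpace ℝ (Fin n)} (ht : t ∈ Metric.ball 0 R) :
    ContinuousOn (fun σ : ℝ => kernelIntegral φ K τ ψ z (σ • t)) (Icc 0 1) :=
  (contDiffOn_kernelIntegral h hK hKR hψ τ z).continuousOn.comp (by fun_prop)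
    fun _ hσ => smul_mem_ball ht hσ

theorem intervalIntegrable_cone (h : Setup s φ R) (hK : IsCompact K)
    (hKR : K ⊆ Metric.ball 0 R) (hψ : GevreyIn s R ψ) (τ : ℝ) (r : ℕ) (z : Fin m → ℂ)
    {t : EuclideanSpace ℝ (Fin n)} (ht : t ∈ Metric.ball 0 R) :
    IntervalIntegrable (fun σ : ℝ => kernelIntegral φ K τ ψ z (σ • t) * (σ : ℂ) ^ r)
      volume 0 1 := by
  refine ContinuousOn.intervalIntegrable ?_
  rw [uIcc_of_le zero_le_one]
  exact (continuousOn_kernelIntegral_smul h hK hKR hψ τ z ht).mul (by fun_prop)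

theorem coneIntegral_sum (h : Setup s φ R) (hK : IsCompact K) (hKR : K ⊆ Metric.ball 0 R)
    (τ : ℝ) (r : ℕ) (z : Fin m → ℂ) {t : EuclideanSpace ℝ (Fin n)} (ht : t ∈ Metric.ball 0 R)
    {α : Type*} (A : Finset α) (c : α → ℂ) {ψ : α → Pt m n → ℂ}
    (hψ : ∀ a ∈ A, GevreyIn s R (ψ a)) :
    coneIntegral φ K τ (fun w => ∑ a ∈ A, c a * ψ a w) r z t
      = ∑ a ∈ A, c a * coneIntegral φ K τ (ψ a) r z t := by
  simp only [coneIntegral, ← intervalIntegral.integral_const_mul]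
  rw [← intervalIntegral.integral_finsetSum fun a ha =>
    (intervalIntegrable_cone h hK hKR (hψ a ha) τ r z ht).const_mul _]
  refine intervalIntegral.integral_congr fun σ hσ => ?_
  rw [uIcc_of_le zero_le_one] at hσ
  rw [kernelIntegral_sum h hK hKR τ z (smul_mem_ball ht hσ) A c hψ, Finset.sum_mul]
  exact Finset.sum_congr rfl fun a _ => by ring

/-- The radial homotopy formula. -/
theorem kernelIntegral_eq_coneIntegral (h : Setup s φ R) (hχ : Cutoff s χ R) (hu : GevreyIn s R u)
    (τ : ℝ) (r : ℕ) (z : Fin m → ℂ) {t : EuclideanSpace ℝ (Fin n)} (ht : t ∈ Metric.ball 0 R) :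
    kernelIntegral φ (tsupport χ) τ (density φ χ u) z t
      = (r + 1) * coneIntegral φ (tsupport χ) τ (density φ χ u) r z t
        + ∑ j, (t j : ℂ) * coneIntegral φ (tsupport χ) τ (detLv φ j fun w => χ w.1 * u w)
          (r + 1) z t := by
  set k := kernelIntegral φ (tsupport χ) τ (density φ χ u) z with hk
  have hdens := gevreyIn_density h hχ hu
  have hdL : ∀ j, GevreyIn s R (detLv φ j fun w => χ w.1 * u w) := fun j =>
    gevreyIn_detLv h j (hχ.gevreyIn.mul h.one_le hu)
  -- The product with `σ^(r+1)` is integrated over `[0,1]`; the exponent is positive even for `r =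
  -- 0`, so the endpoint `σ = 0` contributes nothing.
  have hder : ∀ σ ∈ Icc (0 : ℝ) 1, HasDerivAt (fun σ : ℝ => k (σ • t) * (σ : ℂ) ^ (r + 1))
      ((r + 1) * (k (σ • t) * (σ : ℂ) ^ r) + ∑ j, (t j : ℂ) *
        (kernelIntegral φ (tsupport χ) τ (detLv φ j fun w => χ w.1 * u w) z (σ • t)
          * (σ : ℂ) ^ (r + 1))) σ := by
    intro σ hσ
    have hσt := smul_mem_ball ht hσ
    have h1 : HasFDerivAt k (fderiv ℝ k (σ • t)) (σ • t) :=
      (((contDiffOn_kernelIntegral h hχ.isCompact hχ.subset hdens τ z).contDiffAt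
        (Metric.isOpen_ball.mem_nhds hσt)).differentiableAt (by simp)).hasFDerivAt
    have h2 : HasDerivAt (fun σ : ℝ => σ • t) t σ := by
      simpa using (hasDerivAt_id σ).smul_const t
    have h3 : HasDerivAt (fun σ : ℝ => k (σ • t)) (fderiv ℝ k (σ • t) t) σ :=
      HasFDerivAt.comp_hasDerivAt (f := fun σ : ℝ => σ • t) σ h1 h2
    have h4 : HasDerivAt (fun σ : ℝ => (σ : ℂ) ^ (r + 1)) (((r + 1 : ℕ) : ℂ) * (σ : ℂ) ^ r) σ := by
      simpa using (hasDerivAt_pow (r + 1) (σ : ℂ)).comp_ofReal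
    have h5 : fderiv ℝ k (σ • t) t = ∑ j, (t j : ℂ) *
        kernelIntegral φ (tsupport χ) τ (detLv φ j fun w => χ w.1 * u w) z (σ • t) := by
      have h6 : t = ∑ j, t j • EuclideanSpace.single j (1 : ℝ) := by
        ext i
        simp [Finset.sum_apply, Pi.single_apply]
      conv_lhs => rw [h6, map_sum]
      rw [← h6]
      refine Finset.sum_congr rfl fun j _ => ?_
      rw [map_smul, fderiv_kernelIntegral h hχ hu τ z hσt j, Complex.real_smul]
    refine (h3.mul h4).congr_deriv ?_
    rw [h5, Finset.sum_mul]
    push_cast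
    rw [add_comm]
    congr 1
    · ring
    · exact Finset.sum_congr rfl fun j _ => by ring
  have hi1 := (intervalIntegrable_cone h hχ.isCompact hχ.subset hdens τ r z ht).const_mul
    ((r : ℂ) + 1)
  have hi2 : ∀ j, IntervalIntegrable (fun σ : ℝ => (t j : ℂ) *
      (kernelIntegral φ (tsupport χ) τ (detLv φ j fun w => χ w.1 * u w) z (σ • t)
        * (σ : ℂ) ^ (r + 1))) volume 0 1 := fun j =>
    (intervalIntegrable_cone h hχ.isCompact hχ.subset (hdL j) τ (r + 1) z ht).const_mul _
  have hi3 := IntervalIntegrable.sum Finset.univ fun j _ => hi2 j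
  rw [Finset.sum_fn] at hi3
  have hftc := intervalIntegral.integral_eq_sub_of_hasDerivAt (a := (0 : ℝ)) (b := 1)
    (fun σ hσ => hder σ (by rwa [uIcc_of_le zero_le_one] at hσ)) (hi1.add hi3)
  rw [intervalIntegral.integral_add hi1 hi3,
    intervalIntegral.integral_finsetSum fun j _ => hi2 j] at hftc
  simp only [intervalIntegral.integral_const_mul] at hftc
  simpa [coneIntegral] using hftc.symm

end Kernel

/-! ### The radial primitive along the structure: `L_j` and Gevrey bounds -/

section Cone

variable {m n : ℕ} {s R : ℝ} {φ : Pt m n → EuclideanSpace ℝ (Fin m)}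
  {χ : EuclideanSpace ℝ (Fin m) → ℂ} {u ψ : Pt m n → ℂ} {K : Set (EuclideanSpace ℝ (Fin m))}

/-- The integrand of `coneIntegral` along the structure. -/
def coneKernel (φ : Pt m n → EuclideanSpace ℝ (Fin m)) (τ : ℝ) (ψ : Pt m n → ℂ) (r : ℕ)
    (p : Pt m n × ℝ) (x' : EuclideanSpace ℝ (Fin m)) : ℂ :=
  Complex.exp (-(τ : ℂ) * ∑ k, (Z φ p.1 k - Z φ (x', p.2 • p.1.2) k) ^ 2) * ψ (x', p.2 • p.1.2)
    * (p.2 : ℂ) ^ r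

/-- Halving the radius in `t` allows `σ` to range over an open interval containing `[0,1]`, where
joint smoothness is available. -/
theorem smul_mem_ball_of_abs_lt_two {t : EuclideanSpace ℝ (Fin n)}
    (ht : t ∈ Metric.ball 0 (R / 2)) {σ : ℝ} (hσ : σ ∈ Ioo (-2 : ℝ) 2) :
    σ • t ∈ Metric.ball 0 R := by
  rw [mem_ball_zero_iff] at *
  rw [norm_smul, Real.norm_eq_abs]
  have := mul_le_mul_of_nonneg_right (abs_lt.mpr hσ).le (norm_nonneg t)
  linarith

theorem contDiffAt_coneKernel (h : Setup s φ R) (hψ : GevreyIn s R ψ) (τ : ℝ) (r : ℕ)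
    {p : (Pt m n × ℝ) × EuclideanSpace ℝ (Fin m)} (hp1 : p.1.1 ∈ box m n R (R / 2))
    (hp2 : p.1.2 ∈ Ioo (-2 : ℝ) 2) (hp3 : p.2 ∈ Metric.ball 0 R) :
    ContDiffAt ℝ ∞ (Function.uncurry (coneKernel φ τ ψ r)) p := by
  have hR := h.R_pos
  have hA : ContDiffAt ℝ ∞ (fun p : (Pt m n × ℝ) × EuclideanSpace ℝ (Fin m) => p.1.1) p := by
    fun_prop
  have hB : ContDiffAt ℝ ∞ (fun p : (Pt m n × ℝ) × EuclideanSpace ℝ (Fin m) =>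
      (p.2, p.1.2 • p.1.1.2)) p := by fun_prop
  have hσ : ContDiffAt ℝ ∞ (fun p : (Pt m n × ℝ) × EuclideanSpace ℝ (Fin m) =>
      ((p.1.2 : ℝ) : ℂ)) p := Complex.ofRealCLM.contDiff.contDiffAt.comp p (by fun_prop)
  have hw : p.1.1 ∈ box m n R R := box_subset_box le_rfl (by linarith) hp1
  have hw' : (p.2, p.1.2 • p.1.1.2) ∈ box m n R R :=
    ⟨hp3, smul_mem_ball_of_abs_lt_two hp1.2 hp2⟩
  have h1 : ∀ k, ContDiffAt ℝ ∞ (fun p : (Pt m n × ℝ) × EuclideanSpace ℝ (Fin m) =>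
      Z φ p.1.1 k - Z φ (p.2, p.1.2 • p.1.1.2) k) p := fun k =>
    (((h.Z k).contDiffAt hw).comp p hA).sub
      (ContDiffAt.comp (f := fun p : (Pt m n × ℝ) × EuclideanSpace ℝ (Fin m) =>
        (p.2, p.1.2 • p.1.1.2)) p ((h.Z k).contDiffAt hw') hB)
  have h2 := ContDiffAt.comp (f := fun p : (Pt m n × ℝ) × EuclideanSpace ℝ (Fin m) =>
    (p.2, p.1.2 • p.1.1.2)) p (hψ.contDiffAt hw') hB
  exact ((contDiffAt_gaussian_comp h1).mul h2).mul (hσ.pow r)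

theorem coneIntegral_eq (τ : ℝ) (r : ℕ) (w : Pt m n) :
    coneIntegral φ K τ ψ r (Z φ w) w.2
      = ∫ σ in Icc (0 : ℝ) 1, ∫ x' in K, coneKernel φ τ ψ r (w, σ) x' := by
  rw [coneIntegral, intervalIntegral.integral_of_le zero_le_one, integral_Icc_eq_integral_Ioc]
  simp only [coneKernel, integral_mul_const, kernelIntegral]

theorem contDiffOn_integral_coneKernel (h : Setup s φ R) (hK : IsCompact K)
    (hKR : K ⊆ Metric.ball 0 R) (hψ : GevreyIn s R ψ) (τ : ℝ) (r : ℕ) :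
    ContDiffOn ℝ ∞ (fun p => ∫ x' in K, coneKernel φ τ ψ r p x')
      (box m n R (R / 2) ×ˢ Ioo (-2) 2) :=
  (contDiffOn_setIntegral (μ := volume) ((isOpen_box R (R / 2)).prod isOpen_Ioo) hK
    Metric.isOpen_ball hKR fun _ hp =>
      (contDiffAt_coneKernel h hψ τ r hp.1.1 hp.1.2 hp.2).contDiffWithinAt).1

theorem Icc_subset_Ioo_two : Icc (0 : ℝ) 1 ⊆ Ioo (-2) 2 := fun σ hσ =>
  ⟨by linarith [hσ.1], by linarith [hσ.2]⟩

theorem contDiffOn_coneIntegral (h : Setup s φ R) (hK : IsCompact K)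
    (hKR : K ⊆ Metric.ball 0 R) (hψ : GevreyIn s R ψ) (τ : ℝ) (r : ℕ) :
    ContDiffOn ℝ ∞ (fun w => coneIntegral φ K τ ψ r (Z φ w) w.2) (box m n R (R / 2)) := by
  simp only [coneIntegral_eq]
  exact (contDiffOn_setIntegral (μ := volume) (isOpen_box R (R / 2)) isCompact_Icc isOpen_Ioo
    Icc_subset_Ioo_two (contDiffOn_integral_coneKernel h hK hKR hψ τ r)).1

/-- The kernel depends on `w` through `Z(w)`, which `L_j` annihilates, and through `σ t`, on which
`L_j` acts as `σ ∂/∂t_j`. This extra `σ` raises the power from `r` to `r + 1`. -/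
theorem Lv_coneKernel (h : Setup s φ R) (hψ : GevreyIn s R ψ) (τ : ℝ) (r : ℕ) {w : Pt m n}
    (hw : w ∈ box m n R (R / 2)) {σ : ℝ} (hσ : σ ∈ Ioo (-2 : ℝ) 2)
    {x' : EuclideanSpace ℝ (Fin m)} (hx' : x' ∈ Metric.ball 0 R) (j : Fin n) :
    Lv φ j (fun w => coneKernel φ τ ψ r (w, σ) x') w
      = fderiv ℝ (fun t => Complex.exp (-(τ : ℂ) * ∑ k, (Z φ w k - Z φ (x', t) k) ^ 2)
          * ψ (x', t)) (σ • w.2) (EuclideanSpace.single j 1) * (σ : ℂ) ^ (r + 1) := by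
  have hR := h.R_pos
  have hw' : w ∈ box m n R R := box_subset_box le_rfl (by linarith) hw
  have hp : (x', σ • w.2) ∈ box m n R R := ⟨hx', smul_mem_ball_of_abs_lt_two hw.2 hσ⟩
  set F : (Fin m → ℂ) → ℂ := fun ζ => Complex.exp (-(τ : ℂ) * ∑ k, ζ k ^ 2) with hFdef
  have hF : ∀ ζ, DifferentiableAt ℂ F ζ := fun ζ =>
    (contDiff_gaussian τ).differentiable (by simp) ζ
  have hsl : ∀ g : Pt m n → ℂ, ContDiffAt ℝ ∞ g (x', σ • w.2) →
      HasFDerivAt (fun t => g (x', t)) (fderiv ℝ (fun t => g (x', t)) (σ • w.2)) (σ • w.2) :=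
    fun g hg => ((hg.comp (f := fun t => (x', t)) (σ • w.2)
      (contDiffAt_const.prodMk contDiffAt_id)).differentiableAt (by simp)).hasFDerivAt
  have hsm : HasFDerivAt (fun w : Pt m n => σ • w.2)
      (σ • ContinuousLinearMap.snd ℝ (EuclideanSpace ℝ (Fin m)) (EuclideanSpace ℝ (Fin n))) w :=
    hasFDerivAt_snd.const_smul σ
  have ha := fun k => hsl (fun w => Z φ w k) ((h.Z k).contDiffAt hp)
  have hb := hsl ψ (hψ.contDiffAt hp)
  have hZ : ∀ k, DifferentiableAt ℝ (fun w => Z φ w k) w := fun k =>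
    ((h.Z k).contDiffAt hw').differentiableAt (by simp)
  have ha' := fun k => HasFDerivAt.comp (g := fun t => Z φ (x', t) k)
    (f := fun w : Pt m n => σ • w.2) w (ha k) hsm
  have hb' := HasFDerivAt.comp (g := fun t => ψ (x', t)) (f := fun w : Pt m n => σ • w.2) w hb hsm
  have hζ : ∀ k, HasFDerivAt (fun v : Pt m n => Z φ v k - Z φ (x', σ • v.2) k) _ w := fun k =>
    (hZ k).hasFDerivAt.sub (ha' k)
  have hη : ∀ k, HasFDerivAt (fun t => Z φ w k - Z φ (x', t) k) _ (σ • w.2) := fun k =>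
    (ha k).const_sub (Z φ w k)
  obtain ⟨hd1, hv1⟩ := fderiv_holomorphic_comp (F := F)
    (ζ := fun v k => Z φ v k - Z φ (x', σ • v.2) k) (hF _) fun k => (hζ k).differentiableAt
  obtain ⟨hd2, hv2⟩ := fderiv_holomorphic_comp (F := F)
    (ζ := fun t k => Z φ w k - Z φ (x', t) k) (hF _) fun k => (hη k).differentiableAt
  set c : Fin m → ℂ := fun l => fderiv ℂ F (fun k => Z φ w k - Z φ (x', σ • w.2) k) (Pi.single l 1)
  set D := fderiv ℝ (fun t => F (fun k => Z φ w k - Z φ (x', t) k) * ψ (x', t)) (σ • w.2) with hD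
  have hDv : ∀ e, D e = F (fun k => Z φ w k - Z φ (x', σ • w.2) k)
        * fderiv ℝ (fun t => ψ (x', t)) (σ • w.2) e
      - (∑ l, c l * fderiv ℝ (fun t => Z φ (x', t) l) (σ • w.2) e) * ψ (x', σ • w.2) := by
    intro e
    rw [hD, fderiv_fun_mul hd2 hb.differentiableAt]
    simp only [add_apply, smul_apply, smul_eq_mul, hv2, (hη _).fderiv, neg_apply, mul_neg,
      Finset.sum_neg_distrib]
    ring
  -- The first term collects the derivative through `Z(w)`, the second the derivative through `σ t`
  -- with `z = Z(w)` frozen.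
  have hkey : ∀ v, fderiv ℝ (fun w => coneKernel φ τ ψ r (w, σ) x') w v
      = (∑ l, c l * fderiv ℝ (fun w => Z φ w l) w v) * (ψ (x', σ • w.2) * (σ : ℂ) ^ r)
        + D v.2 * (σ : ℂ) ^ (r + 1) := by
    intro v
    have h1 : (fun w => coneKernel φ τ ψ r (w, σ) x') = fun v : Pt m n =>
        F (fun k => Z φ v k - Z φ (x', σ • v.2) k) * ψ (x', σ • v.2) * (σ : ℂ) ^ r := rfl
    have hb'' : HasFDerivAt (fun v : Pt m n => ψ (x', σ • v.2)) _ w := hb'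
    rw [h1, fderiv_mul_const (hd1.fun_mul hb''.differentiableAt),
      fderiv_fun_mul hd1 hb''.differentiableAt, hDv, hb''.fderiv]
    simp only [add_apply, smul_apply, smul_eq_mul, hv1, (hζ _).fderiv, sub_apply, mul_sub,
      Finset.sum_sub_distrib, ContinuousLinearMap.coe_comp, Function.comp_apply,
      ContinuousLinearMap.coe_snd', map_smul, Complex.real_smul]
    have h2 : ∑ l, c l * ((σ : ℂ) * fderiv ℝ (fun t => Z φ (x', t) l) (σ • w.2) v.2)
        = (σ : ℂ) * ∑ l, c l * fderiv ℝ (fun t => Z φ (x', t) l) (σ • w.2) v.2 := by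
      rw [Finset.mul_sum]
      exact Finset.sum_congr rfl fun l _ => by ring
    rw [h2]
    ring
  have hLZ : ∑ l, c l * Lv φ j (fun w => Z φ w l) w = 0 :=
    Finset.sum_eq_zero fun l _ => by rw [Lv_Z φ w (h.det_ne_zero w hw') j l, mul_zero]
  have hex : ∀ k : Fin m, (ex k : Pt m n).2 = 0 := fun _ => rfl
  have het : (et j : Pt m n).2 = EuclideanSpace.single j 1 := rfl
  rw [Lv]
  simp only [hkey, hex, het, map_zero, zero_mul, add_zero]
  simp only [Lv, mul_sub, Finset.sum_sub_distrib, Finset.mul_sum] at hLZ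
  rw [Finset.sum_comm, sub_eq_zero] at hLZ
  rw [hLZ]
  have h3 : ∑ k, ((Zx φ w)⁻¹ * Zt φ w) k j * ((∑ l, c l * fderiv ℝ (fun w => Z φ w l) w (ex k))
        * (ψ (x', σ • w.2) * (σ : ℂ) ^ r))
      = (∑ k, ∑ l, c l * (((Zx φ w)⁻¹ * Zt φ w) k j * fderiv ℝ (fun w => Z φ w l) w (ex k)))
        * (ψ (x', σ • w.2) * (σ : ℂ) ^ r) := by
    rw [Finset.sum_mul]
    refine Finset.sum_congr rfl fun k _ => ?_
    rw [← mul_assoc, Finset.mul_sum]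
    congr 1
    exact Finset.sum_congr rfl fun l _ => by ring
  rw [h3]
  ring

theorem fderiv_kernelIntegral_eq (h : Setup s φ R) (hK : IsCompact K)
    (hKR : K ⊆ Metric.ball 0 R) (hψ : GevreyIn s R ψ) (τ : ℝ) (z : Fin m → ℂ)
    {t : EuclideanSpace ℝ (Fin n)} (ht : t ∈ Metric.ball 0 R) (e : EuclideanSpace ℝ (Fin n)) :
    fderiv ℝ (kernelIntegral φ K τ ψ z) t e = ∫ x' in K,
      fderiv ℝ (fun t => Complex.exp (-(τ : ℂ) * ∑ k, (z k - Z φ (x', t) k) ^ 2) * ψ (x', t))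
        t e := by
  set g : Pt m n → ℂ := fun w => Complex.exp (-(τ : ℂ) * ∑ k, (z k - Z φ w k) ^ 2) * ψ w with hg
  have hat : ∀ w ∈ box m n R R, ContDiffAt ℝ ∞ g w := fun w hw => contDiffAt_kernel h hψ τ z hw
  have hd : ∀ t ∈ Metric.ball 0 R, ∀ x ∈ K, HasFDerivAt (fun t => g (x, t))
      ((fderiv ℝ g (x, t)).comp (ContinuousLinearMap.inr ℝ _ _)) t := fun t ht x hx =>
    HasFDerivAt.comp (f := fun t => (x, t)) t
      ((hat (x, t) ⟨hKR hx, ht⟩).differentiableAt (by simp)).hasFDerivAt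
      (hasFDerivAt_prodMk_right x t)
  have hsw : ContinuousOn (fun p : EuclideanSpace ℝ (Fin n) × EuclideanSpace ℝ (Fin m) =>
      (p.2, p.1)) (Metric.ball 0 R ×ˢ K) := by fun_prop
  have hmaps : MapsTo (fun p : EuclideanSpace ℝ (Fin n) × EuclideanSpace ℝ (Fin m) =>
      (p.2, p.1)) (Metric.ball 0 R ×ˢ K) (box m n R R) := fun p hp => ⟨hKR hp.2, hp.1⟩
  have hgc : ContinuousOn g (box m n R R) := fun w hw => (hat w hw).continuousAt.continuousWithinAt
  have hgc' : ContinuousOn (fderiv ℝ g) (box m n R R) := fun w hw =>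
    ((hat w hw).fderiv_right (m := ∞) (by simp)).continuousAt.continuousWithinAt
  have hG' := (hgc'.comp hsw hmaps).clm_comp
    (continuousOn_const (c := ContinuousLinearMap.inr ℝ (EuclideanSpace ℝ (Fin m))
      (EuclideanSpace ℝ (Fin n))))
  have h1 := hasFDerivAt_setIntegral_of_continuousOn (μ := volume) Metric.isOpen_ball hK
    (G := fun t x => g (x, t))
    (G' := fun t x => (fderiv ℝ g (x, t)).comp (ContinuousLinearMap.inr ℝ _ _))
    (hgc.comp hsw hmaps) hG' hd ht
  have hint : IntegrableOn (fun x => (fderiv ℝ g (x, t)).comp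
      (ContinuousLinearMap.inr ℝ (EuclideanSpace ℝ (Fin m)) (EuclideanSpace ℝ (Fin n)))) K :=
    ContinuousOn.integrableOn_compact hK
      (hG'.comp (f := fun x => (t, x)) (by fun_prop) fun x hx => ⟨ht, hx⟩)
  have h2 : fderiv ℝ (kernelIntegral φ K τ ψ z) t = _ := h1.fderiv
  rw [h2, ContinuousLinearMap.integral_apply hint]
  exact setIntegral_congr_fun hK.measurableSet fun x hx => by
    have h3 : fderiv ℝ (fun t => g (x, t)) t = _ := (hd t ht x hx).fderiv
    rw [← h3]

/-- `L_j` passes under both integrals and becomes `σ ∂/∂t_j` with `z` frozen at `Z(w)`; the inner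
integral is then a `t`-derivative to which Stokes' formula applies. -/
theorem Lv_coneIntegral (h : Setup s φ R) (hχ : Cutoff s χ R) (hu : GevreyIn s R u) (τ : ℝ)
    (r : ℕ) {w : Pt m n} (hw : w ∈ box m n R (R / 2)) (j : Fin n) :
    Lv φ j (fun w => coneIntegral φ (tsupport χ) τ (density φ χ u) r (Z φ w) w.2) w
      = coneIntegral φ (tsupport χ) τ (detLv φ j fun w => χ w.1 * u w) (r + 1) (Z φ w) w.2 := by
  have hdens := gevreyIn_density h hχ hu
  simp only [coneIntegral_eq (ψ := density φ χ u)]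
  rw [Lv_setIntegral (isOpen_box R (R / 2)) isCompact_Icc isOpen_Ioo Icc_subset_Ioo_two
    (H := fun w σ => ∫ x' in tsupport χ, coneKernel φ τ (density φ χ u) r (w, σ) x')
    (contDiffOn_integral_coneKernel h hχ.isCompact hχ.subset hdens τ r) hw j,
    coneIntegral, intervalIntegral.integral_of_le zero_le_one, ← integral_Icc_eq_integral_Ioc]
  refine setIntegral_congr_fun measurableSet_Icc fun σ hσ => ?_
  have hσ' := Icc_subset_Ioo_two hσ
  have hσt := smul_mem_ball_of_abs_lt_two hw.2 hσ'
  have hsm : ContDiffOn ℝ ∞ (Function.uncurry fun (w : Pt m n) (x' : EuclideanSpace ℝ (Fin m)) =>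
      coneKernel φ τ (density φ χ u) r (w, σ) x') (box m n R (R / 2) ×ˢ Metric.ball 0 R) := by
    rintro ⟨v, x⟩ ⟨hv, hx⟩
    exact (ContDiffAt.comp (g := Function.uncurry (coneKernel φ τ (density φ χ u) r))
      (f := fun p : Pt m n × EuclideanSpace ℝ (Fin m) => ((p.1, σ), p.2)) (v, x)
      (contDiffAt_coneKernel h hdens τ r hv hσ' hx) (by fun_prop)).contDiffWithinAt
  rw [Lv_setIntegral (isOpen_box R (R / 2)) hχ.isCompact Metric.isOpen_ball hχ.subset hsm hw j,
    ← fderiv_kernelIntegral h hχ hu τ (Z φ w) hσt j,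
    fderiv_kernelIntegral_eq h hχ.isCompact hχ.subset hdens τ (Z φ w) hσt, ← integral_mul_const]
  exact setIntegral_congr_fun hχ.isCompact.measurableSet fun x hx =>
    Lv_coneKernel h hdens τ r hw hσ' (hχ.subset hx) j

theorem norm_inr_smul_snd_le {σ : ℝ} (hσ : σ ∈ Icc (0 : ℝ) 1) :
    ‖(ContinuousLinearMap.inr ℝ (EuclideanSpace ℝ (Fin m)) (EuclideanSpace ℝ (Fin n))).comp
      (σ • ContinuousLinearMap.snd ℝ (EuclideanSpace ℝ (Fin m)) (EuclideanSpace ℝ (Fin n)))‖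
      ≤ 1 := by
  refine ContinuousLinearMap.opNorm_le_bound _ zero_le_one fun v => ?_
  have h1 : ‖σ • v.2‖ ≤ 1 * ‖v‖ := by
    rw [norm_smul, Real.norm_of_nonneg hσ.1]
    exact mul_le_mul hσ.2 (norm_snd_le v) (norm_nonneg _) zero_le_one
  simpa [Prod.norm_def] using h1

/-- The phase is Gevrey uniformly in `(w, σ, x')`, so `UniformGevrey.cexp` with the factor `τ` loses
only `δ` from the lower bound `c` of its real part on `K`. Decay results if `c > δ`; a negative `c`
is allowed and gives bounds for each fixed `τ`. -/
theorem exists_gevreyAt_coneIntegral (h : Setup s φ R) (hK : IsCompact K)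
    (hKR : K ⊆ Metric.ball 0 R) (hψ : GevreyIn s R ψ) (r : ℕ) {B : Set (Pt m n)}
    (hB : B ⊆ box m n R (R / 2)) {c δ : ℝ} (hδ : 0 < δ)
    (hc : ∀ w ∈ B, ∀ x' ∈ K, ∀ σ ∈ Icc (0 : ℝ) 1,
      c ≤ (∑ k, (Z φ w k - Z φ (x', σ • w.2) k) ^ 2).re) :
    ∃ C H : ℝ, 0 < C ∧ 0 < H ∧ ∀ τ : ℝ, 0 < τ → ∀ w ∈ B,
      GevreyAt s (C * Real.exp (τ * (δ - c))) H
        (fun w => coneIntegral φ K τ ψ r (Z φ w) w.2) w := by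
  have hR := h.R_pos
  set S : Set (Pt m n × (ℝ × EuclideanSpace ℝ (Fin m))) := B ×ˢ (Icc 0 1 ×ˢ K) with hS
  have hBR : B ⊆ box m n R R := hB.trans (box_subset_box le_rfl (by linarith))
  -- The map `w ↦ (x', σ t)` is affine with linear part of norm at most one, so composition
  -- preserves the Gevrey constants.
  have hpull : ∀ {g : Pt m n → ℂ}, GevreyIn s R g → UniformGevrey s S (fun i => i.1)
      fun i w => g (i.2.2, i.2.1 • w.2) := by
    intro g hg
    have h1 : UniformGevrey s S (fun i => (i.2.2, i.2.1 • i.1.2)) fun _ => g :=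
      UniformGevrey.reindex hg (fun i : Pt m n × (ℝ × EuclideanSpace ℝ (Fin m)) =>
        (i.2.2, i.2.1 • i.1.2)) fun i hi =>
          ⟨hKR hi.2.2, smul_mem_ball (hBR hi.1).2 hi.2.1⟩
    have h2 := h1.comp_affine (fun i => (ContinuousLinearMap.inr ℝ _ _).comp
        (i.2.1 • ContinuousLinearMap.snd ℝ (EuclideanSpace ℝ (Fin m)) (EuclideanSpace ℝ (Fin n))))
      (fun i => (i.2.2, 0)) (Q := fun i => i.1) (fun i hi => norm_inr_smul_snd_le hi.2.1)
      fun i _ => by simp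
    simpa using h2
  have hq : UniformGevrey s S (fun i => i.1) fun i w =>
      -∑ k, (Z φ w k - Z φ (i.2.2, i.2.1 • w.2) k) * (Z φ w k - Z φ (i.2.2, i.2.1 • w.2) k) := by
    refine (UniformGevrey.sum _ fun k _ => ?_).neg
    have h1 : UniformGevrey s S (fun i => i.1) fun i w =>
        Z φ w k - Z φ (i.2.2, i.2.1 • w.2) k :=
      ((h.Z k).reindex (fun i : Pt m n × (ℝ × EuclideanSpace ℝ (Fin m)) => i.1)
        fun i hi => hBR hi.1).sub (hpull (h.Z k))
    exact h1.mul h.one_le h1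
  obtain ⟨H₁, hH₁, hexp⟩ := hq.cexp h.one_le hδ
  obtain ⟨C₂, H₂, hC₂, hH₂, hrest⟩ := (hpull hψ).mul h.one_le
    (UniformGevrey.const_of_bound (c := fun i => ((i.2.1 : ℝ) : ℂ) ^ r) (C := 1) fun i hi => by
      rw [norm_pow, Complex.norm_real, Real.norm_of_nonneg hi.2.1.1]
      exact pow_le_one₀ hi.2.1.1 hi.2.1.2)
  refine ⟨C₂ * ((volume K).toReal + 1), H₁ + H₂, by positivity, by positivity,
    fun τ hτ w hw => ?_⟩
  have hpt : ∀ σ ∈ Icc (0 : ℝ) 1, ∀ x' ∈ K, GevreyAt s (Real.exp (τ * (δ - c)) * C₂) (H₁ + H₂)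
      (fun w => coneKernel φ τ ψ r (w, σ) x') w := by
    intro σ hσ x' hx'
    have hi : (w, (σ, x')) ∈ S := ⟨hw, hσ, hx'⟩
    have h1 := hexp _ hi τ hτ.le
    have h2 : GevreyAt s (Real.exp (τ * (δ - c))) H₁ (fun w =>
        Complex.exp (-(τ : ℂ) * ∑ k, (Z φ w k - Z φ (x', σ • w.2) k) ^ 2)) w := by
      refine (h1.mono hH₁.le (Real.exp_nonneg _) (Real.exp_le_exp.mpr ?_) le_rfl).congr
        (Eventually.of_forall fun v => ?_)
      · refine mul_le_mul_of_nonneg_left ?_ hτ.le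
        have := hc w hw x' hx' σ hσ
        simp only [pow_two] at this
        rw [Complex.neg_re]
        linarith
      · simp only [pow_two]
        congr 1
        ring
    refine (h2.mul h.one_le (hrest _ hi) (Real.exp_nonneg _) hC₂.le hH₁.le hH₂.le).congr
      (Eventually.of_forall fun v => ?_)
    simp only [coneKernel, mul_assoc]
  have hKm : volume K ≠ ⊤ := hK.measure_lt_top.ne
  have hinner : ∀ σ ∈ Icc (0 : ℝ) 1, GevreyAt s
      (C₂ * ((volume K).toReal + 1) * Real.exp (τ * (δ - c))) (H₁ + H₂)
      (fun w => ∫ x' in K, coneKernel φ τ ψ r (w, σ) x') w := by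
    intro σ hσ
    have hσ' := Icc_subset_Ioo_two hσ
    refine gevreyAt_setIntegral (μ := volume) (by positivity) (isOpen_box R (R / 2)) hK
      Metric.isOpen_ball hKR ?_ (hB hw) (b := fun _ => Real.exp (τ * (δ - c)) * C₂)
      (integrableOn_const hKm) (hpt σ hσ) ?_
    · rintro ⟨v, x⟩ ⟨hv, hx⟩
      exact (ContDiffAt.comp (g := Function.uncurry (coneKernel φ τ ψ r))
        (f := fun p : Pt m n × EuclideanSpace ℝ (Fin m) => ((p.1, σ), p.2)) (v, x)
        (contDiffAt_coneKernel h hψ τ r hv hσ' hx) (by fun_prop)).contDiffWithinAt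
    · rw [setIntegral_const, smul_eq_mul, Measure.real]
      have : 0 ≤ Real.exp (τ * (δ - c)) * C₂ := by positivity
      nlinarith
  have houter := gevreyAt_setIntegral (μ := volume) (by positivity : 0 ≤ H₁ + H₂)
    (isOpen_box R (R / 2)) isCompact_Icc isOpen_Ioo Icc_subset_Ioo_two
    (H := fun w σ => ∫ x' in K, coneKernel φ τ ψ r (w, σ) x')
    (contDiffOn_integral_coneKernel h hK hKR hψ τ r) (hB hw)
    (b := fun _ => C₂ * ((volume K).toReal + 1) * Real.exp (τ * (δ - c)))
    (integrableOn_const (by simp)) hinner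
    (C := C₂ * ((volume K).toReal + 1) * Real.exp (τ * (δ - c))) (by simp)
  simpa only [← coneIntegral_eq] using houter

end Cone

/-! ### Signs of the exterior algebra -/

section Signs

variable {n : ℕ}

theorem eps_mul_self (j : Fin n) (J : Finset (Fin n)) : eps j J * eps j J = 1 := by
  rw [eps, ← mul_pow]
  simp

/-- Anticommutation of `dt_j` and `dt_l` in terms of coefficients: exactly one of `j < l` and `l <
j` holds, so exactly one of the two factors changes sign. -/
theorem eps_mul_eps_insert_erase {K : Finset (Fin n)} {j l : Fin n} (hj : j ∈ K) (hl : l ∉ K) :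
    eps l K * eps j (insert l (K.erase j)) = -(eps j (K.erase j) * eps l (K.erase j)) := by
  have hjl : j ≠ l := fun h => hl (h ▸ hj)
  have hl' : l ∉ K.erase j := fun h => hl (Finset.mem_of_mem_erase h)
  have h1 : eps l K = eps l (K.erase j) * (if j < l then -1 else 1) := by
    conv_lhs => rw [← Finset.insert_erase hj]
    rw [eps, eps, Finset.filter_insert]
    split_ifs with h
    · rw [Finset.card_insert_of_notMem (by simp), pow_succ]
    · rw [mul_one]
  have h2 : eps j (insert l (K.erase j)) = eps j (K.erase j) * (if l < j then -1 else 1) := by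
    rw [eps, eps, Finset.filter_insert]
    split_ifs with h
    · rw [Finset.card_insert_of_notMem (by simp [hl']), pow_succ]
    · rw [mul_one]
  rw [h1, h2]
  rcases lt_or_gt_of_ne hjl with h | h
  · rw [if_pos h, if_neg h.not_gt]
    ring
  · rw [if_neg h.not_gt, if_pos h]
    ring

/-- The sign bookkeeping in the homotopy formula. -/
theorem sum_eps_homotopy (K : Finset (Fin n)) (t : Fin n → ℂ) (B : Finset (Fin n) → ℂ)
    (A : Fin n → Finset (Fin n) → ℂ) :
    ∑ j ∈ K, eps j (K.erase j) * ∑ l ∈ (K.erase j)ᶜ, eps l (K.erase j) *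
        (A j (insert l (K.erase j)) * t l + B (insert l (K.erase j)) * if l = j then 1 else 0)
      = (K.card * B K + ∑ j, t j * A j K) - ∑ l ∈ Kᶜ, eps l K * t l *
          ∑ j ∈ insert l K, eps j ((insert l K).erase j) * A j ((insert l K).erase j) := by
  -- The index `l = j` is isolated: only it carries `B`, and its sign squares to one. The other
  -- terms form the double sum that reappears in `h2` with the opposite sign.
  have h1 : ∀ j ∈ K, eps j (K.erase j) * ∑ l ∈ (K.erase j)ᶜ, eps l (K.erase j) *
        (A j (insert l (K.erase j)) * t l + B (insert l (K.erase j)) * if l = j then 1 else 0)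
      = (t j * A j K + B K) + ∑ l ∈ Kᶜ, eps j (K.erase j) * eps l (K.erase j) *
        (A j (insert l (K.erase j)) * t l) := by
    intro j hj
    rw [Finset.compl_erase, Finset.sum_insert (by simpa using hj), mul_add, Finset.mul_sum,
      Finset.insert_erase hj, ← mul_assoc, eps_mul_self]
    congr 1
    · simp only [if_true]
      ring
    · refine Finset.sum_congr rfl fun l hl => ?_
      have hlj : l ≠ j := fun h => (Finset.mem_compl.mp hl) (h ▸ hj)
      rw [if_neg hlj]
      ring
  have h2 : ∀ l ∈ Kᶜ, eps l K * t l *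
        ∑ j ∈ insert l K, eps j ((insert l K).erase j) * A j ((insert l K).erase j)
      = t l * A l K - ∑ j ∈ K, eps j (K.erase j) * eps l (K.erase j) *
        (A j (insert l (K.erase j)) * t l) := by
    intro l hl
    have hlK := Finset.mem_compl.mp hl
    rw [Finset.sum_insert hlK, Finset.erase_insert hlK, mul_add, Finset.mul_sum,
      sub_eq_add_neg, ← Finset.sum_neg_distrib]
    congr 1
    · linear_combination (t l * A l K) * eps_mul_self l K
    · refine Finset.sum_congr rfl fun j hj => ?_
      have hlj : l ≠ j := fun h => hlK (h ▸ hj)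
      rw [Finset.erase_insert_of_ne hlj]
      linear_combination (t l * A j (insert l (K.erase j))) * eps_mul_eps_insert_erase hj hlK
  rw [Finset.sum_congr rfl h1, Finset.sum_congr rfl h2, Finset.sum_add_distrib,
    Finset.sum_add_distrib, Finset.sum_sub_distrib, Finset.sum_comm (s := Kᶜ) (t := K),
    ← Finset.sum_add_sum_compl K fun j => t j * A j K]
  simp only [Finset.sum_const, nsmul_eq_mul]
  ring

end Signs

/-! ### The homotopy formula for `𝒦_τ` -/

section Homotopy

variable {m n : ℕ} {s R : ℝ} {φ : Pt m n → EuclideanSpace ℝ (Fin m)}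
  {χ : EuclideanSpace ℝ (Fin m) → ℂ} {p q : ℕ}

theorem Lv_congr {f g : Pt m n → ℂ} {w : Pt m n} (hfg : f =ᶠ[nhds w] g) (j : Fin n) :
    Lv φ j f w = Lv φ j g w := by
  simp only [Lv, hfg.fderiv_eq]

theorem Lv_const_mul {f : Pt m n → ℂ} {w : Pt m n} (hf : DifferentiableAt ℝ f w) (c : ℂ)
    (j : Fin n) : Lv φ j (fun w => c * f w) w = c * Lv φ j f w := by
  simp only [Lv, fderiv_const_mul hf, smul_apply, smul_eq_mul, mul_sub, Finset.mul_sum]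
  congr 1
  exact Finset.sum_congr rfl fun k _ => by ring

theorem Lv_sum {α : Type*} (A : Finset α) {f : α → Pt m n → ℂ} {w : Pt m n}
    (hf : ∀ a ∈ A, DifferentiableAt ℝ (f a) w) (j : Fin n) :
    Lv φ j (fun w => ∑ a ∈ A, f a w) w = ∑ a ∈ A, Lv φ j (f a) w := by
  simp only [Lv, fderiv_fun_sum hf, sum_apply, Finset.mul_sum, Finset.sum_sub_distrib]
  rw [Finset.sum_comm]

/-- The coefficients of a form, indexed by all finite sets. -/
def extCoeff (f : Form m n p q) (I : MIdx p m) (S : Finset (Fin n)) : Pt m n → ℂ :=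
  if h : S.card = q then f I ⟨S, h⟩ else 0

theorem extCoeff_coe (f : Form m n p q) (I : MIdx p m) (J : MIdx q n) :
    extCoeff f I J.1 = f I J := by
  simp [extCoeff, J.2]

theorem gevreyIn_extCoeff {f : Form m n p q} (hf : ∀ I J, GevreyIn s R (f I J)) (I : MIdx p m)
    (S : Finset (Fin n)) : GevreyIn s R (extCoeff f I S) := by
  unfold extCoeff
  split_ifs with h
  · exact hf I ⟨S, h⟩
  · exact UniformGevrey.const 0

theorem LL_eq (f : Form m n p q) (I : MIdx p m) (K : MIdx (q + 1) n) (w : Pt m n) :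
    LL φ f I K w = (-1) ^ p * ∑ j ∈ K.1, eps j (K.1.erase j)
      * Lv φ j (extCoeff f I (K.1.erase j)) w := by
  rw [LL, ← Finset.sum_coe_sort K.1]
  congr 1
  refine Finset.sum_congr rfl fun j _ => ?_
  rw [← extCoeff_coe f I (K.del j.1 j.2)]
  rfl

theorem calG_eq_kernelIntegral (hχ : Cutoff s χ R) (τ : ℝ) (u : Pt m n → ℂ) (z : Fin m → ℂ)
    (t : EuclideanSpace ℝ (Fin n)) : calG φ χ τ u z t
      = (gaussConst m τ : ℂ) * kernelIntegral φ (tsupport χ) τ (density φ χ u) z t :=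
  calG_eq_setIntegral hχ τ z t

theorem pullback_calK_eq (hχ : Cutoff s χ R) (τ : ℝ) (f : Form m n p (q + 1)) (I : MIdx p m)
    (J : MIdx q n) (w : Pt m n) : pullback φ (calK φ χ τ f) I J w
      = ((-1) ^ p * (gaussConst m τ : ℂ)) * ∑ l ∈ J.1ᶜ, eps l J.1 *
        (coneIntegral φ (tsupport χ) τ (density φ χ (extCoeff f I (insert l J.1))) q (Z φ w) w.2
          * (w.2 l : ℂ)) := by
  rw [pullback, calK, Finset.sum_subtype J.1ᶜ (p := fun j => j ∉ J.1) (by simp), mul_assoc]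
  congr 1
  rw [Finset.mul_sum]
  refine Finset.sum_congr rfl fun l _ => ?_
  have h1 : ∀ σ : ℝ, calG φ χ τ (f I (J.ins l.1 l.2)) (Z φ w) (σ • w.2) * (σ : ℂ) ^ q
      = (gaussConst m τ : ℂ) * (kernelIntegral φ (tsupport χ) τ
        (density φ χ (extCoeff f I (insert l.1 J.1))) (Z φ w) (σ • w.2) * (σ : ℂ) ^ q) := by
    intro σ
    rw [calG_eq_kernelIntegral hχ, mul_assoc, ← extCoeff_coe f I (J.ins l.1 l.2)]
    rfl
  simp only [h1, intervalIntegral.integral_const_mul, coneIntegral]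
  ring

/-- The density of the error term in the homotopy formula. -/
def errorDensity (φ : Pt m n → EuclideanSpace ℝ (Fin m)) (χ : EuclideanSpace ℝ (Fin m) → ℂ)
    (f : Form m n p q) (I : MIdx p m) (M : Finset (Fin n)) (w : Pt m n) : ℂ :=
  ∑ j ∈ M, eps j (M.erase j) * detLv φ j (fun w => χ w.1 * extCoeff f I (M.erase j) w) w

theorem gevreyIn_errorDensity (h : Setup s φ R) (hχ : Cutoff s χ R) {f : Form m n p q}
    (hf : ∀ I J, GevreyIn s R (f I J)) (I : MIdx p m) (M : Finset (Fin n)) :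
    GevreyIn s R (errorDensity φ χ f I M) :=
  UniformGevrey.sum _ fun j _ => (UniformGevrey.const _).mul h.one_le
    (gevreyIn_detLv h j (hχ.gevreyIn.mul h.one_le (gevreyIn_extCoeff hf I _)))

/-- Near such a point `χ = 1`, and the density is, up to sign, `det Z_x` times a coefficient of `𝕃
f`. -/
theorem errorDensity_eq_zero (hχ : Cutoff s χ R) {f : Form m n p q} {I : MIdx p m}
    {M : Finset (Fin n)} (hM : M.card = q + 1) {w : Pt m n} (hw : LL φ f I ⟨M, hM⟩ w = 0)
    (hw1 : w.1 ∈ Metric.ball (0 : EuclideanSpace ℝ (Fin m)) (R / 2)) :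
    errorDensity φ χ f I M w = 0 := by
  have h1 : ∀ j, detLv φ j (fun w => χ w.1 * extCoeff f I (M.erase j) w) w
      = (Zx φ w).det * Lv φ j (extCoeff f I (M.erase j)) w := fun j => by
    rw [detLv]
    congr 1
    refine Lv_congr ?_ j
    filter_upwards [(Metric.isOpen_ball.preimage continuous_fst).mem_nhds hw1] with v hv
    rw [hχ.eq_one v.1 hv, one_mul]
  rw [LL_eq] at hw
  have h2 := (mul_eq_zero.mp hw).resolve_left (pow_ne_zero _ (by norm_num))
  simp only [errorDensity, h1]
  calc _ = (Zx φ w).det * ∑ j ∈ M, eps j (M.erase j) * Lv φ j (extCoeff f I (M.erase j)) w := by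
        rw [Finset.mul_sum]
        exact Finset.sum_congr rfl fun j _ => by ring
    _ = 0 := by rw [h2, mul_zero]

theorem coneIntegral_eq_of_eq_zero {K K' : Set (EuclideanSpace ℝ (Fin m))} (hK : IsCompact K)
    (hK' : K' ⊆ K) {τ : ℝ} {ψ : Pt m n → ℂ} {r : ℕ} {z : Fin m → ℂ}
    {t : EuclideanSpace ℝ (Fin n)} (ht : t ∈ Metric.ball 0 R)
    (h0 : ∀ x ∈ K \ K', ∀ t ∈ Metric.ball 0 R, ψ (x, t) = 0) :
    coneIntegral φ K τ ψ r z t = coneIntegral φ K' τ ψ r z t := by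
  refine intervalIntegral.integral_congr fun σ hσ => ?_
  rw [uIcc_of_le zero_le_one] at hσ
  have h1 : kernelIntegral φ K τ ψ z (σ • t) = kernelIntegral φ K' τ ψ z (σ • t) := by
    rw [kernelIntegral, kernelIntegral]
    apply setIntegral_eq_of_subset_of_forall_sdiff_eq_zero hK.measurableSet hK'
    intro x hx
    rw [h0 x hx _ (smul_mem_ball ht hσ), mul_zero]
  simp only [h1]

/-- The homotopy formula for `calK`. -/
theorem LL_pullback_calK (h : Setup s φ R) (hχ : Cutoff s χ R) {f : Form m n p (q + 1)}
    (hf : ∀ I J, GevreyIn s R (f I J))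
    (hLL : ∀ I M, ∀ w ∈ box m n R R, LL φ f I M w = 0) (τ : ℝ) (I : MIdx p m) (K : MIdx (q + 1) n)
    {w : Pt m n} (hw : w ∈ box m n R (R / 2)) :
    LL φ (pullback φ (calK φ χ τ f)) I K w = calG φ χ τ (f I K) (Z φ w) w.2
      - ∑ l ∈ K.1ᶜ, eps l K.1 * (w.2 l : ℂ) * ((gaussConst m τ : ℂ) *
        coneIntegral φ (tsupport χ \ Metric.ball 0 (R / 2)) τ (errorDensity φ χ f I (insert l K.1))
          (q + 1) (Z φ w) w.2) := by
  have hR := h.R_pos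
  have hw' : w ∈ box m n R R := box_subset_box le_rfl (by linarith) hw
  have hext := gevreyIn_extCoeff hf I
  have hdL : ∀ j S, GevreyIn s R (detLv φ j fun w => χ w.1 * extCoeff f I S w) := fun j S =>
    gevreyIn_detLv h j (hχ.gevreyIn.mul h.one_le (hext S))
  have hN : ∀ S, DifferentiableAt ℝ (fun w => coneIntegral φ (tsupport χ) τ
      (density φ χ (extCoeff f I S)) q (Z φ w) w.2) w := fun S =>
    ((contDiffOn_coneIntegral h hχ.isCompact hχ.subset (gevreyIn_density h hχ (hext S)) τ
      q).contDiffAt ((isOpen_box _ _).mem_nhds hw)).differentiableAt (by simp)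
  have ht : ∀ l : Fin n, DifferentiableAt ℝ (fun w : Pt m n => ((w.2 l : ℝ) : ℂ)) w := fun l =>
    (Complex.ofRealCLM.comp ((EuclideanSpace.proj (𝕜 := ℝ) l).comp
      (ContinuousLinearMap.snd ℝ (EuclideanSpace ℝ (Fin m)) _))).differentiableAt
  set B : Finset (Fin n) → ℂ := fun S => coneIntegral φ (tsupport χ) τ
    (density φ χ (extCoeff f I S)) q (Z φ w) w.2 with hB
  set A : Fin n → Finset (Fin n) → ℂ := fun j S => coneIntegral φ (tsupport χ) τ
    (detLv φ j fun w => χ w.1 * extCoeff f I S w) (q + 1) (Z φ w) w.2 with hA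
  -- By the product rule `L_j` either differentiates the cone integral, giving `A`, or the
  -- coordinate `t_l`, giving `δ_{jl}` times `B`.
  have h1 : ∀ j ∈ K.1, Lv φ j (extCoeff (pullback φ (calK φ χ τ f)) I (K.1.erase j)) w
      = ((-1) ^ p * (gaussConst m τ : ℂ)) * ∑ l ∈ (K.1.erase j)ᶜ, eps l (K.1.erase j) *
        (A j (insert l (K.1.erase j)) * (w.2 l : ℂ)
          + B (insert l (K.1.erase j)) * if l = j then 1 else 0) := by
    intro j hj
    have h2 : extCoeff (pullback φ (calK φ χ τ f)) I (K.1.erase j) = _ :=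
      (extCoeff_coe (pullback φ (calK φ χ τ f)) I (K.del j hj)).trans
        (funext (pullback_calK_eq hχ τ f I (K.del j hj)))
    have h3 : ∀ l, DifferentiableAt ℝ (fun w : Pt m n => coneIntegral φ (tsupport χ) τ
        (density φ χ (extCoeff f I (insert l (K.del j hj).1))) q (Z φ w) w.2
          * ((w.2 l : ℝ) : ℂ)) w := fun l => (hN _).fun_mul (ht l)
    rw [h2, Lv_const_mul (DifferentiableAt.fun_sum fun l _ => (h3 l).const_mul _),
      Lv_sum _ fun l _ => (h3 l).const_mul _]
    congr 1
    refine Finset.sum_congr rfl fun l _ => ?_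
    rw [Lv_const_mul (h3 l), Lv_mul (hN _) (ht l), Lv_t,
      Lv_coneIntegral h hχ (hext _) τ q hw j, add_comm]
    rfl
  have h4 : LL φ (pullback φ (calK φ χ τ f)) I K w = (gaussConst m τ : ℂ) *
      ∑ j ∈ K.1, eps j (K.1.erase j) * ∑ l ∈ (K.1.erase j)ᶜ, eps l (K.1.erase j) *
        (A j (insert l (K.1.erase j)) * (w.2 l : ℂ)
          + B (insert l (K.1.erase j)) * if l = j then 1 else 0) := by
    rw [LL_eq, Finset.mul_sum, Finset.mul_sum]
    refine Finset.sum_congr rfl fun j hj => ?_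
    rw [h1 j hj]
    have h5 : ((-1 : ℂ) ^ p) * (-1) ^ p = 1 := by
      rw [← mul_pow]
      simp
    linear_combination (eps j (K.1.erase j) * (gaussConst m τ : ℂ) *
      ∑ l ∈ (K.1.erase j)ᶜ, eps l (K.1.erase j) * (A j (insert l (K.1.erase j)) * (w.2 l : ℂ)
        + B (insert l (K.1.erase j)) * if l = j then 1 else 0)) * h5
  -- The radial formula is used with `r = q`: its factor `r + 1` is the cardinality of `K`, so the
  -- `B` term and the sum of the `t_j A_j` add up to `𝒢_τ`.
  rw [h4, sum_eps_homotopy K.1 (fun l => (w.2 l : ℂ)) B A, mul_sub, calG_eq_kernelIntegral hχ,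
    ← extCoeff_coe f I K, kernelIntegral_eq_coneIntegral h hχ (hext K.1) τ q (Z φ w) hw'.2, K.2]
  congr 1
  · push_cast
    rfl
  · rw [Finset.mul_sum]
    refine Finset.sum_congr rfl fun l hl => ?_
    have hM : (insert l K.1).card = q + 1 + 1 := by
      rw [Finset.card_insert_of_notMem (Finset.mem_compl.mp hl), K.2]
    -- By linearity the `A` terms combine into one cone integral of the error density. That density
    -- vanishes for `|x'| < R/2`, so this ball is removed from the domain.
    have h6 : ∑ j ∈ insert l K.1, eps j ((insert l K.1).erase j) * A j ((insert l K.1).erase j)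
        = coneIntegral φ (tsupport χ \ Metric.ball 0 (R / 2)) τ
          (errorDensity φ χ f I (insert l K.1)) (q + 1) (Z φ w) w.2 := by
      rw [← coneIntegral_eq_of_eq_zero (R := R) hχ.isCompact sdiff_subset hw'.2]
      · exact (coneIntegral_sum h hχ.isCompact hχ.subset τ (q + 1) (Z φ w) hw'.2 _ _
          fun j _ => hdL j _).symm
      · intro x hx t ht
        have hx' : x ∈ Metric.ball (0 : EuclideanSpace ℝ (Fin m)) (R / 2) := by
          by_contra hx'
          exact hx.2 ⟨hx.1, hx'⟩
        exact errorDensity_eq_zero hχ hM (hLL I ⟨_, hM⟩ (x, t) ⟨hχ.subset hx.1, ht⟩) hx'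
    rw [h6]
    ring

end Homotopy

/-! ### Exponential smallness of the error and convergence -/

section Estimates

variable {m n : ℕ} {s R T : ℝ} {φ : Pt m n → EuclideanSpace ℝ (Fin m)}
  {χ : EuclideanSpace ℝ (Fin m) → ℂ} {ψ : Pt m n → ℂ} {p q : ℕ}

theorem exists_gaussConst_mul_exp_le (m : ℕ) {c : ℝ} (hc : 0 < c) :
    ∃ C : ℝ, 0 < C ∧ ∀ τ : ℝ, 0 < τ → gaussConst m τ * Real.exp (-(τ * c)) ≤ C := by
  refine ⟨m.factorial / c ^ m * Real.exp c, by positivity, fun τ hτ => ?_⟩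
  have h1 : gaussConst m τ ≤ (1 + τ) ^ m := by
    have hb : τ / Real.pi ≤ 1 + τ :=
      (div_le_self hτ.le (by linarith [Real.pi_gt_three])).trans (by linarith)
    calc gaussConst m τ ≤ (1 + τ) ^ ((m : ℝ) / 2) :=
          Real.rpow_le_rpow (by positivity) hb (by positivity)
      _ ≤ (1 + τ) ^ (m : ℝ) := Real.rpow_le_rpow_of_exponent_le (by linarith)
          (half_le_self (by positivity))
      _ = _ := Real.rpow_natCast _ _
  have h2 := Real.pow_div_factorial_le_exp (c * (1 + τ)) (by positivity) m
  have h3 : (1 + τ) ^ m ≤ m.factorial / c ^ m * Real.exp (c * (1 + τ)) := by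
    rw [div_mul_eq_mul_div, le_div_iff₀ (by positivity)]
    rw [div_le_iff₀ (by positivity), mul_pow] at h2
    linarith
  calc _ ≤ m.factorial / c ^ m * Real.exp (c * (1 + τ)) * Real.exp (-(τ * c)) := by
        gcongr
        exact h1.trans h3
    _ = m.factorial / c ^ m * (Real.exp (c * (1 + τ)) * Real.exp (-(τ * c))) := by ring
    _ = _ := by
      rw [← Real.exp_add]
      congr 2
      ring

theorem isGevreyOn_of_gevreyAt {E F : Type*} [NormedAddCommGroup E] [NormedSpace ℝ E]
    [NormedAddCommGroup F] [NormedSpace ℝ F] {C H : ℝ} {g : E → F} {U : Set E} (hH : 0 < H)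
    (hg : ∀ x ∈ U, GevreyAt s C H g x) : IsGevreyOn s g U :=
  ⟨fun x hx => (hg x hx).1.contDiffWithinAt,
    fun _ hK _ => ⟨H, hH, C, fun k x hx => (hg x (hK hx)).2 k⟩⟩

theorem uniformGevrey_coord {ι : Type*} {S : Set ι} {P : ι → Pt m n} (hs : 0 ≤ s)
    (hP : ∀ i ∈ S, P i ∈ box m n R R) (l : Fin n) :
    UniformGevrey s S P fun _ w => ((w.2 l : ℝ) : ℂ) :=
  UniformGevrey.clm hs (Complex.ofRealCLM.comp ((EuclideanSpace.proj (𝕜 := ℝ) l).comp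
    (ContinuousLinearMap.snd ℝ (EuclideanSpace ℝ (Fin m)) _))) (B := R) fun i hi =>
    max_le (mem_ball_zero_iff.mp (hP i hi).1).le (mem_ball_zero_iff.mp (hP i hi).2).le

theorem box_quarter_subset (hR : 0 < R) (hT : T ≤ R / 2) :
    box m n (R / 4) T ⊆ box m n R (R / 2) := box_subset_box (by linarith) hT

/-- Here `τ` is fixed and no decay is needed: boundedness of `φ` alone bounds the real part of the
phase from below. -/
theorem isGevreyOn_pullback_calK (h : Setup s φ R) (hχ : Cutoff s χ R) (hT : T ≤ R / 2)
    {f : Form m n p (q + 1)} (hf : ∀ I J, GevreyIn s R (f I J)) {τ : ℝ} (hτ : 0 < τ)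
    (I : MIdx p m) (J : MIdx q n) :
    IsGevreyOn s (pullback φ (calK φ χ τ f) I J) (box m n (R / 4) T) := by
  have hR := h.R_pos
  have hsub := box_quarter_subset (m := m) (n := n) hR hT
  have hsub' : box m n (R / 4) T ⊆ box m n R R :=
    box_subset_box (by linarith) (by linarith)
  obtain ⟨Cφ, hCφ, hφb⟩ := h.gevrey.exists_norm_le
  have hlow : ∀ w ∈ box m n (R / 4) T, ∀ x' ∈ tsupport χ, ∀ σ ∈ Icc (0 : ℝ) 1,
      -(2 * Cφ) ^ 2 ≤ (∑ k, (Z φ w k - Z φ (x', σ • w.2) k) ^ 2).re := by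
    intro w hw x' hx' σ hσ
    rw [re_sum_sq_Z_sub]
    have h1 : ‖φ w - φ (x', σ • w.2)‖ ≤ 2 * Cφ := by
      have h2 := hφb w (hsub' hw)
      have h3 := hφb (x', σ • w.2) ⟨hχ.subset hx', smul_mem_ball (hsub' hw).2 hσ⟩
      simp only [id] at h2 h3
      linarith [norm_sub_le (φ w) (φ (x', σ • w.2))]
    have h4 := pow_le_pow_left₀ (norm_nonneg _) h1 2
    have h5 := sq_nonneg ‖w.1 - x'‖
    dsimp only
    linarith
  have hU : UniformGevrey s (box m n (R / 4) T) id fun _ w =>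
      ((-1) ^ p * (gaussConst m τ : ℂ)) * ∑ l ∈ J.1ᶜ, eps l J.1 *
        (coneIntegral φ (tsupport χ) τ (density φ χ (extCoeff f I (insert l J.1))) q (Z φ w) w.2
          * (w.2 l : ℂ)) := by
    refine (UniformGevrey.const _).mul h.one_le (UniformGevrey.sum _ fun l _ =>
      (UniformGevrey.const _).mul h.one_le (UniformGevrey.mul h.one_le ?_
        (uniformGevrey_coord (by linarith [h.one_le]) hsub' l)))
    obtain ⟨C, H, hC, hH, hb⟩ := exists_gevreyAt_coneIntegral h hχ.isCompact hχ.subset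
      (gevreyIn_density h hχ (gevreyIn_extCoeff hf I (insert l J.1))) q hsub one_pos hlow
    exact ⟨_, H, by positivity, hH, fun w hw => hb τ hτ w hw⟩
  obtain ⟨C, H, _, hH, hb⟩ := hU
  refine isGevreyOn_of_gevreyAt hH (C := C) fun w hw => ?_
  rw [funext (pullback_calK_eq hχ τ f I J)]
  exact hb w hw

/-- The real part of the phase is bounded below away from the diagonal. -/
theorem le_re_sum_sq (h : Setup s φ R) {L : ℝ} (hL : 0 < L)
    (hLip : ∀ w ∈ box m n R R, ∀ w' ∈ box m n R R, ‖φ w - φ w'‖ ≤ L * ‖w - w'‖)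
    (hT : T ≤ R / 2) (hLT : L * T ≤ R / 16) {w : Pt m n} (hw : w ∈ box m n (R / 4) T)
    {x' : EuclideanSpace ℝ (Fin m)} (hx' : x' ∈ Metric.ball 0 R)
    (hx'' : x' ∉ Metric.ball (0 : EuclideanSpace ℝ (Fin m)) (R / 2)) {σ : ℝ}
    (hσ : σ ∈ Icc (0 : ℝ) 1) :
    R ^ 2 / 64 ≤ (∑ k, (Z φ w k - Z φ (x', σ • w.2) k) ^ 2).re := by
  have hR := h.R_pos
  have hw' : w ∈ box m n R R := box_subset_box (by linarith) (by linarith) hw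
  have hxt : (x', w.2) ∈ box m n R R := ⟨hx', hw'.2⟩
  have hxσ : (x', σ • w.2) ∈ box m n R R := ⟨hx', smul_mem_ball hw'.2 hσ⟩
  rw [re_sum_sq_Z_sub]
  have h1 : R / 4 ≤ ‖w.1 - x'‖ := by
    have h4 := norm_sub_norm_le x' w.1
    rw [mem_ball_zero_iff, not_lt] at hx''
    have h5 := mem_ball_zero_iff.mp hw.1
    rw [norm_sub_rev]
    linarith
  have h2 := h.lipschitz w.1 x' w.2 hw' hxt
  have h3 : ‖φ (x', w.2) - φ (x', σ • w.2)‖ ≤ R / 16 := by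
    refine (hLip _ hxt _ hxσ).trans (le_trans ?_ hLT)
    refine mul_le_mul_of_nonneg_left ?_ hL.le
    have h6 : ((x', w.2) : Pt m n) - (x', σ • w.2) = (0, (1 - σ) • w.2) := by
      ext <;> simp [sub_mul]
    have h7 := mem_ball_zero_iff.mp hw.2
    rw [h6, Prod.norm_def, norm_zero, max_eq_right (norm_nonneg _), norm_smul,
      Real.norm_of_nonneg (by linarith [hσ.2])]
    exact (mul_le_of_le_one_left (norm_nonneg _) (by linarith [hσ.1])).trans h7.le
  -- The increment in `x` costs `|x - x'|/2`, the one in `t` at most `R/16 ≤ |x - x'|/4`. Hence the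
  -- real part is at least `(7/16)|x - x'|² ≥ 7R²/256`, which exceeds `R²/64`.
  have h4 : ‖φ w - φ (x', σ • w.2)‖ ≤ 3 / 4 * ‖w.1 - x'‖ := by
    have h5 : φ w - φ (x', σ • w.2)
        = (φ (w.1, w.2) - φ (x', w.2)) + (φ (x', w.2) - φ (x', σ • w.2)) := by
      rw [sub_add_sub_cancel]
    rw [h5]
    refine (norm_add_le _ _).trans ?_
    linarith
  have h5 := pow_le_pow_left₀ (norm_nonneg _) h4 2
  dsimp only
  nlinarith

theorem gevreyTendsto_LL_pullback_calK (h : Setup s φ R) (hχ : Cutoff s χ R) {L : ℝ} (hL : 0 < L)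
    (hLip : ∀ w ∈ box m n R R, ∀ w' ∈ box m n R R, ‖φ w - φ w'‖ ≤ L * ‖w - w'‖)
    (hT : T ≤ R / 2) (hLT : L * T ≤ R / 16) {f : Form m n p (q + 1)}
    (hf : ∀ I J, GevreyIn s R (f I J)) (hLL : ∀ I M, ∀ w ∈ box m n R R, LL φ f I M w = 0)
    (I : MIdx p m) (K : MIdx (q + 1) n) :
    GevreyTendsto s (fun τ => LL φ (pullback φ (calK φ χ τ f)) I K) (f I K)
      (box m n (R / 4) T) := by
  have hR := h.R_pos
  set U := box m n (R / 4) T with hU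
  have hsub : U ⊆ box m n R (R / 2) := box_quarter_subset hR hT
  have hsub' : U ⊆ box m n R R := box_subset_box (by linarith) (by linarith)
  have hUo : IsOpen U := isOpen_box _ _
  -- A quarter of the bound `R²/64`: one `κ` is the loss `δ`, one pays for the factor `exp(τκ)` in
  -- `hEg`, and one absorbs the growth of `gaussConst`.
  set κ : ℝ := R ^ 2 / 256 with hκ
  have hκ0 : 0 < κ := by positivity
  set S : Set (ℝ × Pt m n) := Ioi 0 ×ˢ U with hS
  set E : ℝ → Pt m n → ℂ := fun τ w => ∑ l ∈ K.1ᶜ, eps l K.1 * (w.2 l : ℂ) *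
    ((gaussConst m τ : ℂ) * coneIntegral φ (tsupport χ \ Metric.ball 0 (R / 2)) τ
      (errorDensity φ χ f I (insert l K.1)) (q + 1) (Z φ w) w.2) with hE
  have hLLE : ∀ τ, ∀ w ∈ U, LL φ (pullback φ (calK φ χ τ f)) I K w
      = calG φ χ τ (f I K) (Z φ w) w.2 - E τ w := fun τ w hw =>
    LL_pullback_calK h hχ hf hLL τ I K (hsub hw)
  have hKc : IsCompact (tsupport χ \ Metric.ball (0 : EuclideanSpace ℝ (Fin m)) (R / 2)) :=
    hχ.isCompact.diff Metric.isOpen_ball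
  -- The error multiplied by `exp(τκ)` is still bounded uniformly in `τ`; this yields both its
  -- Gevrey bounds and its decay.
  have hEg : UniformGevrey s S (fun i => i.2) fun i w =>
      ((Real.exp (i.1 * κ) : ℝ) : ℂ) * E i.1 w := by
    have h1 : UniformGevrey s S (fun i => i.2) fun i w => ∑ l ∈ K.1ᶜ, eps l K.1 * (w.2 l : ℂ) *
        (((Real.exp (i.1 * κ) * gaussConst m i.1 : ℝ) : ℂ) *
          coneIntegral φ (tsupport χ \ Metric.ball 0 (R / 2)) i.1
            (errorDensity φ χ f I (insert l K.1)) (q + 1) (Z φ w) w.2) := by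
      refine UniformGevrey.sum _ fun l _ => ((UniformGevrey.const _).mul h.one_le
        (uniformGevrey_coord (by linarith [h.one_le]) (fun i hi => hsub' hi.2) l)).mul h.one_le ?_
      obtain ⟨C, H, hC, hH, hb⟩ := exists_gevreyAt_coneIntegral h hKc
        (sdiff_subset.trans hχ.subset) (gevreyIn_errorDensity h hχ hf I (insert l K.1)) (q + 1)
        hsub hκ0 (c := R ^ 2 / 64) fun w hw x' hx' σ hσ =>
          le_re_sum_sq h hL hLip hT hLT hw (hχ.subset hx'.1) hx'.2 hσ
      obtain ⟨Cg, hCg, hgb⟩ := exists_gaussConst_mul_exp_le m hκ0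
      refine ⟨Cg * C, H, by positivity, hH, fun i hi => ?_⟩
      have hτ : 0 < i.1 := hi.1
      have hg := gaussConst_pos (m := m) hτ
      have h2 := (hb i.1 hi.1 i.2 hi.2).clm_comp
        ((Real.exp (i.1 * κ) * gaussConst m i.1) • ContinuousLinearMap.id ℝ ℂ)
      have h3 : ‖(Real.exp (i.1 * κ) * gaussConst m i.1) • ContinuousLinearMap.id ℝ ℂ‖
          ≤ Real.exp (i.1 * κ) * gaussConst m i.1 := by
        rw [norm_smul, Real.norm_of_nonneg (by positivity)]
        exact mul_le_of_le_one_right (by positivity) ContinuousLinearMap.norm_id_le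
      have h4 : Real.exp (i.1 * (κ - R ^ 2 / 64)) * Real.exp (i.1 * κ)
          ≤ Real.exp (-(i.1 * κ)) := by
        rw [← Real.exp_add, Real.exp_le_exp]
        have : 0 ≤ i.1 * R ^ 2 := by positivity
        rw [hκ]
        linarith
      refine (h2.mono hH.le (by positivity) ?_ le_rfl).congr (Eventually.of_forall fun w => ?_)
      · calc _ ≤ Real.exp (i.1 * κ) * gaussConst m i.1
              * (C * Real.exp (i.1 * (κ - R ^ 2 / 64))) := by gcongr
          _ = gaussConst m i.1 * (Real.exp (i.1 * (κ - R ^ 2 / 64)) * Real.exp (i.1 * κ)) * C := by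
            ring
          _ ≤ gaussConst m i.1 * Real.exp (-(i.1 * κ)) * C := by gcongr
          _ ≤ Cg * C := by gcongr; exact hgb i.1 hτ
      · simp
    refine h1.congr fun i _ => Eventually.of_forall fun w => ?_
    simp only [hE, Finset.mul_sum]
    refine Finset.sum_congr rfl fun l _ => ?_
    push_cast
    ring
  have hexp1 : ∀ i ∈ S, ‖((Real.exp (-(i.1 * κ)) : ℝ) : ℂ)‖ ≤ 1 := fun i hi => by
    have hτ : 0 < i.1 := hi.1
    rw [Complex.norm_real, Real.norm_of_nonneg (Real.exp_nonneg _), Real.exp_le_one_iff]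
    have : 0 < i.1 * κ := by positivity
    linarith
  have hcancel : ∀ τ w, ((Real.exp (-(τ * κ)) : ℝ) : ℂ) * (((Real.exp (τ * κ) : ℝ) : ℂ) * E τ w)
      = E τ w := fun τ w => by
    rw [← mul_assoc, ← Complex.ofReal_mul, ← Real.exp_add, neg_add_cancel, Real.exp_zero,
      Complex.ofReal_one, one_mul]
  -- The bounds come from the homotopy formula, not from differentiating `𝒦_τ`, so the inverse of
  -- `Z_x` in `L_j` is never estimated.
  have hgU : UniformGevrey s S (fun i => i.2) fun i =>
      LL φ (pullback φ (calK φ χ i.1 f)) I K := by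
    obtain ⟨C, H, hC, hH, hb⟩ := exists_gevreyAt_calG h hχ (hf I K)
    have h1 : UniformGevrey s S (fun i => i.2) fun i w => calG φ χ i.1 (f I K) (Z φ w) w.2 :=
      ⟨C, H, hC, hH, fun i hi => hb i.1 hi.1 i.2 (hsub' hi.2)⟩
    refine (h1.sub ((UniformGevrey.const_of_bound hexp1).mul h.one_le hEg)).congr fun i hi => ?_
    filter_upwards [hUo.mem_nhds hi.2] with w hw
    rw [hcancel, hLLE i.1 w hw]
  obtain ⟨C, H, hC, hH, hb⟩ := hgU
  obtain ⟨Cf, Hf, _, hHf, hbf⟩ := hf I K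
  refine gevreyTendsto_of_uniform_bound hUo
    (fun τ hτ => isGevreyOn_of_gevreyAt hH fun w hw => hb (τ, w) ⟨hτ, hw⟩)
    ⟨fun w hw => (hbf w (hsub' hw)).1.contDiffWithinAt,
      Hf, hHf, Cf, fun k w hw => (hbf w (hsub' hw)).2 k⟩
    ⟨C, H, hC, hH, fun τ hτ w hw => hb (τ, w) ⟨zero_lt_one.trans_le hτ, hw⟩⟩ ?_
  obtain ⟨C₁, hC₁, hb₁⟩ := exists_norm_calG_sub_le h hχ (hf I K)
  obtain ⟨C₂, hC₂, hb₂⟩ := hEg.exists_norm_le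
  have hlim : Tendsto (fun τ : ℝ => C₁ * (√τ)⁻¹ + Real.exp (-(τ * κ)) * C₂) atTop (nhds 0) := by
    have h1 : Tendsto (fun τ : ℝ => (√τ)⁻¹) atTop (nhds 0) :=
      tendsto_inv_atTop_zero.comp Real.tendsto_sqrt_atTop
    have h2 : Tendsto (fun τ : ℝ => Real.exp (-(τ * κ))) atTop (nhds 0) :=
      Real.tendsto_exp_neg_atTop_nhds_zero.comp (tendsto_id.atTop_mul_const hκ0)
    simpa using (h1.const_mul C₁).add (h2.mul_const C₂)
  intro ε hε
  filter_upwards [hlim.eventually_le_const hε, eventually_gt_atTop 0] with τ hτ hτ0 w hw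
  rw [hLLE τ w hw, sub_right_comm]
  refine (norm_sub_le _ _).trans (le_trans (add_le_add (hb₁ τ hτ0 w
    (box_subset_box le_rfl (by linarith) hw)) ?_) hτ)
  rw [← hcancel, norm_mul, Complex.norm_real, Real.norm_of_nonneg (Real.exp_nonneg _)]
  exact mul_le_mul_of_nonneg_left (hb₂ (τ, w) ⟨hτ0, hw⟩) (Real.exp_nonneg _)

end Estimates

/-! ### Existence and use of admissible pairs -/

section Admissible

variable {m n : ℕ} {s R : ℝ} {φ : Pt m n → EuclideanSpace ℝ (Fin m)} {Ω W : Set (Pt m n)}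

theorem closedBall_prod_closedBall (R : ℝ) :
    (Metric.closedBall 0 R ×ˢ Metric.closedBall 0 R : Set (Pt m n)) = Metric.closedBall 0 R :=
  closedBall_prod_same 0 0 R

/-- The `x`-differential of `φ` vanishes at the origin and is continuous, so its norm is at most
`1/2` on a small ball; the mean value inequality on convex slices gives the Lipschitz bound. -/
theorem exists_admissible (hΩ : IsOpen Ω) (h0 : (0 : Pt m n) ∈ Ω) (hφ : ContDiffOn ℝ ∞ φ Ω)
    (hdφ0 : ∀ k : Fin m, fderiv ℝ φ 0 (ex k) = 0) :
    ∃ (R : ℝ) (W : Set (Pt m n)), Admissible φ Ω R W := by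
  set A : Pt m n → EuclideanSpace ℝ (Fin m) →L[ℝ] EuclideanSpace ℝ (Fin m) := fun w =>
    (fderiv ℝ φ w).comp (ContinuousLinearMap.inl ℝ _ _) with hA
  have hA0 : A 0 = 0 := by
    ext1 v
    have h1 : v = ∑ k, v k • EuclideanSpace.single k (1 : ℝ) := by
      ext j
      simp [Finset.sum_apply, Pi.single_apply]
    rw [h1, map_sum]
    refine Finset.sum_eq_zero fun k _ => ?_
    rw [map_smul]
    have : A 0 (EuclideanSpace.single k 1) = 0 := hdφ0 k
    rw [this, smul_zero]
  have hAc : ContinuousAt A 0 :=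
    (((hφ.contDiffAt (hΩ.mem_nhds h0)).fderiv_right (m := ∞) (by simp)).continuousAt).clm_comp
      continuousAt_const
  have hev : ∀ᶠ w in nhds (0 : Pt m n), ‖A w‖ ≤ 1 / 2 ∧ w ∈ Ω := by
    refine (hAc.norm.eventually_le_const ?_).and (hΩ.mem_nhds h0)
    dsimp only
    rw [hA0, norm_zero]
    norm_num
  obtain ⟨ε, hε, hball⟩ := Metric.nhds_basis_closedBall.mem_iff.mp hev
  have hcl : closure (box m n ε ε) = Metric.closedBall 0 ε := by
    rw [closure_box hε, closedBall_prod_closedBall]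
  have hcl2 : closure (box m n (ε / 2) (ε / 2)) = Metric.closedBall 0 (ε / 2) := by
    rw [closure_box (by positivity), closedBall_prod_closedBall]
  -- In the maximum norm the closure of this `W` is the closed ball of radius `ε` found above, while
  -- the half radius puts the closure of `V` inside `W`.
  refine ⟨ε / 2, box m n ε ε, by positivity, isOpen_box _ _, ?_, ?_, ?_, ?_⟩
  · rw [closure_box (by positivity)]
    exact prod_mono (Metric.closedBall_subset_ball (by linarith))
      (Metric.closedBall_subset_ball (by linarith))
  · rw [hcl]
    exact isCompact_closedBall _ _
  · rw [hcl]
    exact fun w hw => (hball hw).2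
  · intro x y t hx hy
    rw [closure_box (by positivity)] at hx hy
    have hsub : ∀ z ∈ Metric.closedBall (0 : EuclideanSpace ℝ (Fin m)) (ε / 2),
        ((z, t) : Pt m n) ∈ Metric.closedBall 0 ε := fun z hz => by
      rw [← closedBall_prod_closedBall]
      exact ⟨Metric.closedBall_subset_closedBall (by linarith) hz,
        Metric.closedBall_subset_closedBall (by linarith) hx.2⟩
    refine (convex_closedBall (0 : EuclideanSpace ℝ (Fin m))
      (ε / 2)).norm_image_sub_le_of_norm_hasFDerivWithin_le (f := fun z => φ (z, t))
      (f' := fun z => A (z, t)) (fun z hz => ?_) (fun z hz => (hball (hsub z hz)).1) hy.1 hx.1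
    exact (HasFDerivAt.comp (f := fun z => (z, t)) z
      ((hφ.contDiffAt (hΩ.mem_nhds (hball (hsub z hz)).2)).differentiableAt (by simp)).hasFDerivAt
      (hasFDerivAt_prodMk_left z t)).hasFDerivWithinAt

theorem Admissible.box_subset (hA : Admissible φ Ω R W) : box m n R R ⊆ W :=
  subset_closure.trans hA.closure_subset

theorem Admissible.setup (hA : Admissible φ Ω R W) (hs : 1 ≤ s) (hΩ : IsOpen Ω)
    (hφ : IsGevreyOn s φ Ω) (hframe : ∀ w ∈ Ω, (GevreyPoincare.Zx φ w).det ≠ 0) :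
    Setup s φ R where
  one_le := hs
  R_pos := hA.R_pos
  gevrey := UniformGevrey.of_isGevreyOn hΩ hφ hA.isCompact_closure hA.closure_subset_domain
    fun _ hw => subset_closure (hA.box_subset hw)
  lipschitz x y t hx hy := hA.lipschitz x y t (subset_closure hx) (subset_closure hy)
  det_ne_zero w hw := hframe w (hA.closure_subset_domain (subset_closure (hA.box_subset hw)))

theorem cutoff_of_isGevreyOn {χ : EuclideanSpace ℝ (Fin m) → ℂ} (hχ : IsGevreyOn s χ univ)
    (hc : HasCompactSupport χ) (hsub : tsupport χ ⊆ Metric.ball 0 R)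
    (h1 : ∀ x ∈ Metric.ball (0 : EuclideanSpace ℝ (Fin m)) (R / 2), χ x = 1) : Cutoff s χ R where
  gevrey := by
    obtain ⟨C, h, hC, hh, hb⟩ := UniformGevrey.of_isGevreyOn (S := tsupport χ) (P := id) isOpen_univ
      hχ hc.isCompact (subset_univ _) fun _ hx => hx
    refine ⟨C, h, hC, hh, fun x _ => ?_⟩
    by_cases hx : x ∈ tsupport χ
    · exact hb x hx
    · refine GevreyAt.of_eventuallyEq_zero ?_ hC.le hh.le
      exact notMem_tsupport_iff_eventuallyEq.mp hx
  isCompact := hc.isCompact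
  subset := hsub
  eq_one := h1

end Admissible

end GevreyPoincare

end

/-- Approximate Poincaré lemma in Gevrey classes, for forms of bidegree `(p, q + 1)`. -/
theorem mainTheorem2 {m n : ℕ} (s : ℝ) (hs : 1 < s)
    (Ω : Set (Pt m n)) (hΩ : IsOpen Ω) (h0 : (0 : Pt m n) ∈ Ω)
    (φ : Pt m n → EuclideanSpace ℝ (Fin m)) (hφ : IsGevreyOn s φ Ω)
    (hφ0 : φ 0 = 0) (hdφ0 : ∀ k : Fin m, fderiv ℝ φ 0 (ex k) = 0)
    (hframe : ∀ w ∈ Ω, (Zx φ w).det ≠ 0)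
    (p q : ℕ) (hp : p ≤ m) (hq : q + 1 ≤ n) :
    (∃ (R : ℝ) (W : Set (Pt m n)), Admissible φ Ω R W) ∧
    ∀ (R : ℝ) (W : Set (Pt m n)), Admissible φ Ω R W →
      ∃ T : ℝ, 0 < T ∧ T < R ∧
        ∀ f : Form m n p (q + 1),
          (∀ I J, IsGevreyUpToClosure s (f I J) W) →
          (∀ I K, ∀ w ∈ W, LL φ f I K w = 0) →
          ∀ χ : EuclideanSpace ℝ (Fin m) → ℂ,
            IsGevreyOn s χ Set.univ → HasCompactSupport χ → tsupport χ ⊆ Metric.ball 0 R →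
            (∀ x ∈ Metric.ball (0 : EuclideanSpace ℝ (Fin m)) (R / 2), χ x = 1) →
            (∀ τ : ℝ, 0 < τ → ∀ I J,
              IsGevreyOn s (pullback φ (calK φ χ τ f) I J) (box m n (R / 4) T)) ∧
            ∀ I J, GevreyTendsto s (fun τ => LL φ (pullback φ (calK φ χ τ f)) I J) (f I J)
              (box m n (R / 4) T) := by
  have hs1 : 1 ≤ s := hs.le
  refine ⟨exists_admissible hΩ h0 hφ.1 hdφ0, fun R W hA => ?_⟩
  have h : Setup s φ R := hA.setup hs1 hΩ hφ hframe
  have hR := h.R_pos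
  obtain ⟨L, hL, hLip⟩ := h.gevrey.exists_lipschitz (by linarith)
  -- `T ≤ R/2` leaves room for `σ` beyond `[0,1]`. `T ≤ R/(16L)` keeps the variation of `φ` from `σ
  -- t` to `t` below `R/16`, as `le_re_sum_sq` requires. Only `φ` and `R` enter the choice, so `T`
  -- is independent of `f` and `χ`.
  refine ⟨min (R / 2) (R / (16 * L)), by positivity,
    (min_le_left _ _).trans_lt (half_lt_self hR), fun f hf hLL χ hχ hc hsub hone => ?_⟩
  have hT : min (R / 2) (R / (16 * L)) ≤ R / 2 := min_le_left _ _
  have hLT : L * min (R / 2) (R / (16 * L)) ≤ R / 16 := by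
    calc _ ≤ L * (R / (16 * L)) := mul_le_mul_of_nonneg_left (min_le_right _ _) hL.le
      _ = R / 16 := by field_simp
  have hcut : Cutoff s χ R := cutoff_of_isGevreyOn hχ hc hsub hone
  have hfg : ∀ I J, GevreyIn s R (f I J) := fun I J =>
    UniformGevrey.of_upToClosure hA.isOpen (hf I J) fun _ hw => hA.box_subset hw
  exact ⟨fun τ hτ I J => isGevreyOn_pullback_calK h hcut hT hfg hτ I J, fun I J =>
    gevreyTendsto_LL_pullback_calK h hcut hL hLip hT hLT hfg
      (fun I M w hw => hLL I M w (hA.box_subset hw)) I J⟩
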